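/- **Model.** Tier 1 (macro base stations, MBSs) and tier 2 (helpers) form independent homogeneous Poisson point processes in the plane with densities $\lambda_1,\lambda_2>0$ and transmit powers $P_1,P_2>0$; the tagged user is at the origin, the path loss exponent is $\alpha>2$, fading gains $h$ are i.i.d. $\exp(1)$, and the noise power is $\sigma^2$. Content $n\in\{1,\dots,N\}$ is requested with probability $q_n=n^{-\gamma}/\sum_{k=1}^N k^{-\gamma}$, $\gamma\ge 0$. The first group $\{1,\dots,N_{Mp}\}$ is cached by all MBSs; each helper independently caches $N_2\ge1$ of the $N_{Lp}=N-N_{Mp}\ge N_2$ contents of the second group, each with probability $p_{Lp}=N_2/N_{Lp}$. Put $Q_{Mp}=\sum_{n\le N_{Mp}}q_n$, $Q_{Lp}=1-Q_{Mp}$, $\lambda_1'=\lambda_1$, $\lambda_2'=p_{Lp}\lambda_2$. The user is served by the strongest (largest $P_iz^{-\alpha}$, $z$ the distance) among all MBSs and the helpers that cache the requested content; all other MBSs and all other active helpers interfere. For a content of the second group the serving tier is $k$ with probability $A_{Lp,k}=\lambda_k'P_k^{2/\alpha}/\sum_{i}\lambda_i'P_i^{2/\alpha}$. Put $A_1=Q_{Mp}+Q_{Lp}A_{Lp,1}$,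 $A_2=Q_{Lp}A_{Lp,2}$, $p_b=Q_{Lp}A_{Lp,1}/A_1$. With user density $\lambda_u>0$, the load $L_k$ of a serving station of tier $k$ is modelled, independently of everything else, by $$P_{L_k}(l+1)=\frac{3.5^{3.5}}{l!}\frac{\Gamma(l+4.5)}{\Gamma(3.5)}\Big(\frac{A_k\lambda_u}{\lambda_k}\Big)^{l}\Big(3.5+\frac{A_k\lambda_u}{\lambda_k}\Big)^{-(l+4.5)},\quad l\ge 0,$$ and helpers are active independently with probability $p_a=1-\big(1+\tfrac{A_2\lambda_u}{3.5\lambda_2}\big)^{-3.5}$. The access rate is $\frac{W}{L_k}\log_2(1+\mathrm{SINR})$ with bandwidth $W>0$. A user requesting a second-group content and served by an MBS also needs the backhaul link: given $L_1=l_1+1$, each of the $l_1$ other users needs it independently with probability $p_b$, and if $m$ of them do, the tagged user obtains the backhaul rate $R_0$ with probability $\min\{1,N_b/(m+1)\}$ and $0$ otherwise, where $N_b=C_b/R_0$ and $C_b>0$ is the backhaul capacity. Delivery is successful if the access rate and, where it is needed, the backhaul rate are at least the demand $R_0>0$. **Notation.** For the load $l+1$ let $\delta=\delta(l)=2^{(l+1)R_0/W}-1$,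 and $$G(x,y)=\tfrac{2x}{y-2}\,{}_2F_1\big(1,1-\tfrac2y;2-\tfrac2y;-x\big),\qquad H(x,y)=\tfrac2y x^{2/y}B\big(\tfrac2y,1-\tfrac2y\big),$$ $$\xi_k=\frac{\lambda_1P_1^{2/\alpha}+p_ap_{Lp}\lambda_2P_2^{2/\alpha}}{\lambda_k'P_k^{2/\alpha}},\quad \varsigma_k=\frac{p_a(1-p_{Lp})\lambda_2P_2^{2/\alpha}}{\lambda_k'P_k^{2/\alpha}},\quad \zeta_k=\frac{\lambda_1P_1^{2/\alpha}+p_{Lp}\lambda_2P_2^{2/\alpha}}{\lambda_k'P_k^{2/\alpha}}.$$ **Claim.** As $\sigma^2\to0^+$, the following hold, and all the series converge. (i) For every content of the first group, the probability that the access rate is at least $R_0$ tends to $$\tilde C_{Mp}=\sum_{l\ge0}\Big(G(\delta,\alpha)+p_a\tfrac{\lambda_2}{\lambda_1}\big(\tfrac{P_2}{P_1}\big)^{2/\alpha}H(\delta,\alpha)+1\Big)^{-1}P_{L_1}(l+1).$$ For every content of the second group, the probability that tier $k$ serves the user and the access rate is at least $R_0$ tends to $$\sum_{l\ge0}\big(\xi_kG(\delta,\alpha)+\varsigma_kH(\delta,\alpha)+\zeta_k\big)^{-1}P_{L_k}(l+1),$$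 which is $\tilde C_{Lp,2}$ for $k=2$ and $\tilde C^w_{Lp,1}$ for $k=1$. (ii) For every $\sigma^2$, the probability that the backhaul rate is at least $R_0$ given $L_1=l+1$ is $$C^b_{Lp,1}(l+1)=\sum_{m=0}^{l}\binom lm(1-p_b)^{l-m}p_b^m\min\Big\{1,\frac{N_b}{m+1}\Big\},$$ and unconditionally it is $\bar C^b:=\sum_{l\ge0}P_{L_1}(l+1)\,C^b_{Lp,1}(l+1)$. (iii) The successful content delivery probability tends to $$\tilde C=Q_{Mp}\tilde C_{Mp}+Q_{Lp}\tilde C_{Lp,2}+Q_{Lp}\sum_{l\ge0}\big(\xi_1G(\delta,\alpha)+\varsigma_1H(\delta,\alpha)+\zeta_1\big)^{-1}P_{L_1}(l+1)\,C^b_{Lp,1}(l+1).$$ (iv) If the access link and the backhaul link of a user served by an MBS are treated as independent, i.e. if the probability that both rates are at least $R_0$ is replaced by the product of the two probabilities, the limit is instead $Q_{Mp}\tilde C_{Mp}+Q_{Lp}\tilde C_{Lp,2}+Q_{Lp}\tilde C^w_{Lp,1}\,\bar C^b$. -/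

import Mathlib

open MeasureTheory ProbabilityTheory Filter Topology
open scoped ENNReal NNReal

namespace HetNet

noncomputable section

/-! ### Special functions -/

/-- The Gauss hypergeometric function `₂F₁(a, b; c; z)` for `c > b > 0` and `z < 1`, through Euler's
integral. (The power series represents it only for `|z| < 1`; here `z` ranges over `(-∞, 0]`.) -/
def gaussHyp (a b c z : ℝ) : ℝ :=
  Real.Gamma c / (Real.Gamma b * Real.Gamma (c - b)) *
    ∫ t in (0 : ℝ)..1, t ^ (b - 1) * (1 - t) ^ (c - b - 1) * (1 - z * t) ^ (-a)

/-- `G(x, y) = 2x / (y - 2) · ₂F₁(1, 1 - 2/y; 2 - 2/y; -x)`. -/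
def G (x y : ℝ) : ℝ := 2 * x / (y - 2) * gaussHyp 1 (1 - 2 / y) (2 - 2 / y) (-x)

/-- `H(x, y) = (2/y) x^{2/y} B(2/y, 1 - 2/y)`. -/
def H (x y : ℝ) : ℝ := 2 / y * x ^ (2 / y) * beta (2 / y) (1 - 2 / y)

/-! ### Parameters and derived quantities -/

/-- Parameters of the two-tier network. Tier `0` is the tier of macro base stations (MBSs), tier `1`
the tier of helpers. Contents are numbered `1, …, N`; the first group is `1, …, NMp`, the second
group is `NMp + 1, …, N`. -/
structure Params where
  /-- path loss exponent -/
  α : ℝ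
  /-- base station densities -/
  lam : Fin 2 → ℝ
  /-- user density -/
  lamU : ℝ
  /-- transmit powers -/
  P : Fin 2 → ℝ
  /-- bandwidth -/
  W : ℝ
  /-- rate demand -/
  R0 : ℝ
  /-- backhaul capacity -/
  Cb : ℝ
  /-- Zipf exponent -/
  γ : ℝ
  /-- size of the content library -/
  N : ℕ
  /-- size of the first (most popular) group -/
  NMp : ℕ
  /-- cache size of a helper -/
  N2 : ℕ
  two_lt_α : 2 < α
  lam_pos : ∀ i, 0 < lam i
  lamU_pos : 0 < lamU
  P_pos : ∀ i, 0 < P i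
  W_pos : 0 < W
  R0_pos : 0 < R0
  Cb_pos : 0 < Cb
  γ_nonneg : 0 ≤ γ
  N2_pos : 0 < N2
  N2_le : NMp + N2 ≤ N

namespace Params

variable (p : Params)

/-- Contents of the first group. -/
def groupMp : Finset ℕ := Finset.Icc 1 p.NMp

/-- Contents of the second group. -/
def groupLp : Finset ℕ := Finset.Ioc p.NMp p.N

/-- Zipf popularity of the content of rank `n`. -/
def q (n : ℕ) : ℝ := (n : ℝ) ^ (-p.γ) / ∑ k ∈ Finset.Icc 1 p.N, (k : ℝ) ^ (-p.γ)

def QMp : ℝ := ∑ n ∈ p.groupMp, p.q n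

def QLp : ℝ := ∑ n ∈ p.groupLp, p.q n

/-- Probability that a helper caches a given content of the second group. -/
def pLp : ℝ := p.N2 / ((p.N : ℝ) - p.NMp)

/-- Equivalent densities `λ'₁ = λ₁`, `λ'₂ = p_Lp λ₂` of the stations able to deliver a content of
the second group. -/
def lamEq : Fin 2 → ℝ := ![p.lam 0, p.pLp * p.lam 1]

/-- Association probabilities with the two tiers for a content of the second group. -/
def ALp (k : Fin 2) : ℝ :=
  p.lamEq k * p.P k ^ (2 / p.α) / ∑ i, p.lamEq i * p.P i ^ (2 / p.α)

/-- Overall association probabilities with the two tiers. -/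
def A : Fin 2 → ℝ := ![p.QMp + p.QLp * p.ALp 0, p.QLp * p.ALp 1]

/-- Probability that a user of an MBS needs the backhaul link. -/
def pb : ℝ := p.QLp * p.ALp 0 / p.A 0

/-- `P_{L_k}(l + 1)`: probability that the load of the tagged station of tier `k` (which includes
the tagged user) is `l + 1`. -/
def loadPMF (k : Fin 2) (l : ℕ) : ℝ :=
  (3.5 : ℝ) ^ (3.5 : ℝ) / (l.factorial : ℝ) * (Real.Gamma (l + 4.5) / Real.Gamma 3.5) *
    (p.A k * p.lamU / p.lam k) ^ l * (3.5 + p.A k * p.lamU / p.lam k) ^ (-((l : ℝ) + 4.5))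

/-- Probability that a helper is active. -/
def pa : ℝ := 1 - (1 + p.A 1 * p.lamU / (3.5 * p.lam 1)) ^ (-3.5 : ℝ)

/-- Number of users that a backhaul link can support. -/
def Nb : ℝ := p.Cb / p.R0

/-- SINR threshold when the load is `l + 1`. -/
def δ (l : ℕ) : ℝ := 2 ^ (((l : ℝ) + 1) * (p.R0 / p.W)) - 1

def ξ (k : Fin 2) : ℝ :=
  (p.lam 0 * p.P 0 ^ (2 / p.α) + p.pa * p.pLp * p.lam 1 * p.P 1 ^ (2 / p.α)) /
    (p.lamEq k * p.P k ^ (2 / p.α))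

def ς (k : Fin 2) : ℝ :=
  p.pa * (1 - p.pLp) * p.lam 1 * p.P 1 ^ (2 / p.α) / (p.lamEq k * p.P k ^ (2 / p.α))

def ζ (k : Fin 2) : ℝ :=
  (p.lam 0 * p.P 0 ^ (2 / p.α) + p.pLp * p.lam 1 * p.P 1 ^ (2 / p.α)) /
    (p.lamEq k * p.P k ^ (2 / p.α))

/-- `l`-th term of the closed form for the first group. -/
def termMp (l : ℕ) : ℝ :=
  (G (p.δ l) p.α + p.pa * (p.lam 1 / p.lam 0) * (p.P 1 / p.P 0) ^ (2 / p.α) * H (p.δ l) p.α + 1)⁻¹ *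
    p.loadPMF 0 l

/-- `l`-th term of the closed form for the second group and serving tier `k`. -/
def termLp (k : Fin 2) (l : ℕ) : ℝ :=
  (p.ξ k * G (p.δ l) p.α + p.ς k * H (p.δ l) p.α + p.ζ k)⁻¹ * p.loadPMF k l

/-- Successful backhaul delivery probability at load `l + 1`. -/
def sbdp (l : ℕ) : ℝ :=
  ∑ m ∈ Finset.range (l + 1),
    (l.choose m : ℝ) * (1 - p.pb) ^ (l - m) * p.pb ^ m * min 1 (p.Nb / ((m : ℝ) + 1))

end Params

/-! ### The random network -/

/-- The Euclidean plane; the tagged user sits at the origin. -/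
abbrev Plane : Type := EuclideanSpace ℝ (Fin 2)

/-- The random points `X 0, X 1, …` form a homogeneous Poisson point process of intensity `lam` in
the plane: numbers of points in sets of finite area are Poisson, and numbers of points in disjoint
sets are independent. -/
structure IsPoissonProcess {Ω : Type*} [MeasurableSpace Ω] (X : ℕ → Ω → Plane) (lam : ℝ)
    (μ : Measure Ω) : Prop where
  measurable : ∀ j, Measurable (X j)
  count_law : ∀ B : Set Plane, MeasurableSet B → volume B ≠ ∞ → ∀ n : ℕ,
    μ {ω | {j | X j ω ∈ B}.encard = n} = poissonMeasure (lam * volume.real B).toNNReal {n}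
  count_indep : ∀ (m : ℕ) (B : Fin m → Set Plane), (∀ k, MeasurableSet (B k)) →
    (Pairwise fun k k' => Disjoint (B k) (B k')) →
    iIndepFun (fun k ω => {j | X j ω ∈ B k}.encard) μ

/-- The random quantities of the network. A base station is a pair (tier, index). -/
structure Network (Ω : Type*) where
  /-- position of station `j` of tier `i` -/
  X : Fin 2 → ℕ → Ω → Plane
  /-- Rayleigh fading gain from station `j` of tier `i` to the tagged user -/
  h : Fin 2 → ℕ → Ω → ℝ
  /-- set of contents cached by helper `j` -/
  cache : ℕ → Ω → Set ℕ
  /-- whether helper `j` is active -/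
  active : ℕ → Ω → Bool
  /-- load of the tagged station if it belongs to tier `i` (tagged user included) -/
  L : Fin 2 → Ω → ℕ
  /-- whether the `k`-th other user of the tagged MBS needs the backhaul link -/
  miss : ℕ → Ω → Bool
  /-- seed of the random choice of the users scheduled on the backhaul link -/
  U : Ω → ℝ

/-- Labels of the independent sources of randomness. -/
inductive Source : Type
  | pos (i : Fin 2)
  | fade (i : Fin 2) (j : ℕ)
  | cache (j : ℕ)
  | active (j : ℕ)
  | load (i : Fin 2)
  | miss (k : ℕ)
  | sched

/-- The space in which each source takes its values. -/
def Source.Val : Source → Type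
  | .pos _ => ℕ → Plane
  | .fade _ _ => ℝ
  | .cache _ => Set ℕ
  | .active _ => Bool
  | .load _ => ℕ
  | .miss _ => Bool
  | .sched => ℝ

instance Source.instMeasurableSpaceVal : ∀ s : Source, MeasurableSpace s.Val
  | .pos _ => inferInstanceAs (MeasurableSpace (ℕ → Plane))
  | .fade _ _ => inferInstanceAs (MeasurableSpace ℝ)
  | .cache _ => inferInstanceAs (MeasurableSpace (Set ℕ))
  | .active _ => inferInstanceAs (MeasurableSpace Bool)
  | .load _ => inferInstanceAs (MeasurableSpace ℕ)
  | .miss _ => inferInstanceAs (MeasurableSpace Bool)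
  | .sched => inferInstanceAs (MeasurableSpace ℝ)

namespace Network

variable {Ω : Type*}

/-- The random variable with a given label. -/
def source (S : Network Ω) : ∀ s : Source, Ω → s.Val
  | .pos i => fun ω j => S.X i j ω
  | .fade i j => S.h i j
  | .cache j => S.cache j
  | .active j => S.active j
  | .load i => S.L i
  | .miss k => S.miss k
  | .sched => S.U

/-- The probabilistic model: Poisson base stations, i.i.d. `Exp(1)` fading, helpers that
independently cache `N2` contents of the second group with equal caching probabilities, helpers
independently active with probability `pa`, loads distributed as `loadPMF`, every other user of the
tagged MBS independently in need of the backhaul with probability `pb`, and a uniform seed for the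
backhaul scheduling; all these sources are independent. -/
structure IsModel [MeasurableSpace Ω] (S : Network Ω) (p : Params) (μ : Measure Ω) : Prop where
  measurable : ∀ s, Measurable (S.source s)
  indep : iIndepFun S.source μ
  poisson : ∀ i, IsPoissonProcess (S.X i) (p.lam i) μ
  fading : ∀ i j, μ.map (S.h i j) = expMeasure 1
  cache_subset : ∀ j ω, S.cache j ω ⊆ (p.groupLp : Set ℕ)
  cache_size : ∀ j ω, (S.cache j ω).ncard = p.N2
  cache_prob : ∀ j, ∀ n ∈ p.groupLp, μ.real {ω | n ∈ S.cache j ω} = p.pLp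
  active_prob : ∀ j, μ.real {ω | S.active j ω = true} = p.pa
  load_law : ∀ i (l : ℕ), μ.real {ω | S.L i ω = l + 1} = p.loadPMF i l
  miss_prob : ∀ k, μ.real {ω | S.miss k ω = true} = p.pb
  sched_law : μ.map S.U = volume.restrict (Set.Icc (0 : ℝ) 1)

variable (S : Network Ω) (p : Params)

/-- Received power `P_i z^{-α}` without fading, which governs the association. -/
def meanPower (b : Fin 2 × ℕ) (ω : Ω) : ℝ := p.P b.1 * ‖S.X b.1 b.2 ω‖ ^ (-p.α)

/-- Received power `P_i h z^{-α}`. -/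
def rxPower (b : Fin 2 × ℕ) (ω : Ω) : ℝ :=
  p.P b.1 * S.h b.1 b.2 ω * ‖S.X b.1 b.2 ω‖ ^ (-p.α)

/-- Station `b` can deliver content `n`: every MBS can (from its cache for the first group, through
the backhaul link for the second group), and a helper can if it has cached `n`. -/
def CanDeliver (n : ℕ) (b : Fin 2 × ℕ) (ω : Ω) : Prop := b.1 = 0 ∨ n ∈ S.cache b.2 ω

/-- Station `b` serves the tagged user requesting content `n`: it is the strongest station able to
deliver `n`. -/
def Serves (n : ℕ) (b : Fin 2 × ℕ) (ω : Ω) : Prop :=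
  S.CanDeliver n b ω ∧ ∀ c, S.CanDeliver n c ω → S.meanPower p c ω ≤ S.meanPower p b ω

/-- Transmitting stations: all MBSs and the active helpers. -/
def Transmits (b : Fin 2 × ℕ) (ω : Ω) : Prop := b.1 = 0 ∨ S.active b.2 ω = true

/-- Total interference when `b` serves the tagged user. -/
def interference (b : Fin 2 × ℕ) (ω : Ω) : ℝ≥0∞ :=
  ∑' c : Fin 2 × ℕ, Set.indicator {c | c ≠ b ∧ S.Transmits c ω}
    (fun c => ENNReal.ofReal (S.rxPower p c ω)) c

/-- SINR at the tagged user served by `b`, with noise power `v = σ²`. -/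
def sinr (v : ℝ) (b : Fin 2 × ℕ) (ω : Ω) : ℝ :=
  (ENNReal.ofReal (S.rxPower p b ω) / (S.interference p b ω + ENNReal.ofReal v)).toReal

/-- Delivery rate of the access link from `b`. -/
def accessRate (v : ℝ) (b : Fin 2 × ℕ) (ω : Ω) : ℝ :=
  p.W / (S.L b.1 ω : ℝ) * Real.logb 2 (1 + S.sinr p v b ω)

/-- Number of other users of the tagged MBS that need the backhaul link. -/
def otherMisses (ω : Ω) : ℕ := {k | k + 1 < S.L 0 ω ∧ S.miss k ω = true}.ncard

/-- Backhaul rate of the tagged user: `R0` if the user is scheduled, which happens with probability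
`min 1 (Nb / (m + 1))` when `m` other users need the backhaul link, and `0` otherwise. -/
def backhaulRate (ω : Ω) : ℝ :=
  Set.indicator {ω | S.U ω * ((S.otherMisses ω : ℝ) + 1) ≤ p.Nb} (fun _ => p.R0) ω

/-- Content `n` is delivered by tier `k` with access rate at least `R0`. -/
def accessEvent (v : ℝ) (n : ℕ) (k : Fin 2) : Set Ω :=
  {ω | ∃ j, S.Serves p n (k, j) ω ∧ p.R0 ≤ S.accessRate p v (k, j) ω}

/-- The backhaul rate is at least `R0`. -/
def backhaulEvent : Set Ω := {ω | p.R0 ≤ S.backhaulRate p ω}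

/-- Content `n` is successfully delivered: the access rate from the serving station is at least `R0`,
and so is the backhaul rate if a content of the second group is served by an MBS. -/
def successEvent (v : ℝ) (n : ℕ) : Set Ω :=
  {ω | ∃ b, S.Serves p n b ω ∧ p.R0 ≤ S.accessRate p v b ω ∧
    (b.1 = 0 → n ∈ p.groupLp → ω ∈ S.backhaulEvent p)}

/-- Successful content delivery probability with noise power `v`. -/
def scdp [MeasurableSpace Ω] (μ : Measure Ω) (v : ℝ) : ℝ :=
  ∑ n ∈ Finset.Icc 1 p.N, p.q n * μ.real (S.successEvent p v n)

/-- The same probability when the access link and the backhaul link of a user served by an MBS are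
treated as independent of each other. -/
def scdpIndepLinks [MeasurableSpace Ω] (μ : Measure Ω) (v : ℝ) : ℝ :=
  ∑ n ∈ p.groupMp, p.q n * μ.real (S.accessEvent p v n 0) +
  ∑ n ∈ p.groupLp, p.q n * μ.real (S.accessEvent p v n 1) +
  ∑ n ∈ p.groupLp, p.q n * (μ.real (S.accessEvent p v n 0) * μ.real (S.backhaulEvent p))

end Network

end

end HetNet

/-! The plane matters only through the normalised squared distances T = P_i^(-2/α) ‖x‖², in which
the mean power is T^(-α/2) for either tier. The two tiers become independent Poisson processes on
(0, ∞) with rates a_i proportional to λ_i P_i^(2/α) (`map_norm_sq_volume`). Each station carries an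
independent mark: its gain, whether it can deliver the content (probability π_i), and whether it
transmits (probability ρ_i).

Fix a threshold δ and a server of tier k at t. Its gain is exponential, so the probability that it
exceeds the normalised interference is the mean of e^(-interference). A capable station closer than
t is given cost ∞, so that "served from t" and "ratio above δ" form one exponent, a sum over the
other stations. Averaging the mark of a station at s gives `factor`, and the Laplace functional of
the Poisson processes (`lintegral_count_mul_expNeg`) turns the product of these factors into e^(-tK)
with K = ∑ a_i loss_i. The exponent is linear in t because `factor` depends on s/t alone
(`lintegral_one_sub_factor`). In `loss`, π counts blockers, H the interferers that cannot deliver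
and so may be anywhere, and G the capable interferers, which must lie beyond t. Heuristically the
server has density π_k a_k e^(-tK) dt, with total mass π_k a_k / K (`measureReal_good`). Taking (π,
ρ) = (1, 1) for MBSs and (pLp, pa) or (0, pa) for helpers gives the closed forms, and δ = 0 gives
the association probabilities.

Conditioning on a point at t is avoided by cutting the half-line into intervals of length ε. A
first-moment bound (`measure_goodIn_le`) and the event of exactly one point in the interval
(`le_measure_goodIn`) bound each contribution from above and below. Both bounds sum to geometric
series, which agree as ε → 0 (`eq_div_of_interval_bounds`).

As the noise decreases to 0 the events increase, so the limit is the probability of their union.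
There, SINR ≥ δ for some positive noise means signal-to-interference ratio strictly above δ
(`exists_noise_le_toReal_div`). The union splits into disjoint pieces according to the load, so
countable additivity gives both the value of each series and its convergence. Positions and marks
use other sources of randomness than loads and backhaul, hence every piece factorises
(`hasSum_accessEvent_inter`). Access and backhaul still share the load of the MBS: the joint formula
is a sum of products over the load, while treating the links as independent gives a product of sums.
-/

namespace HetNet

/-! ### The function `x ↦ e^{-x}` on `[0, ∞]` -/

/-- `e^{-x}` for `x ∈ [0, ∞]`. -/
noncomputable def expNeg (x : ℝ≥0∞) : ℝ≥0∞ := (EReal.exp x)⁻¹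

/-- The inverse of `expNeg`, on `[0, 1]`. -/
noncomputable def negLog (y : ℝ≥0∞) : ℝ≥0∞ := (ENNReal.log y⁻¹).toENNReal

theorem expNeg_negLog {y : ℝ≥0∞} (hy : y ≤ 1) : expNeg (negLog y) = y := by
  have h : (0 : EReal) ≤ ENNReal.log y⁻¹ := by
    rw [ENNReal.zero_le_log_iff]; exact ENNReal.one_le_inv.2 hy
  rw [expNeg, negLog, EReal.coe_toENNReal h, ENNReal.exp_log, inv_inv]

@[simp] theorem expNeg_zero : expNeg 0 = 1 := by simp [expNeg]

@[simp] theorem expNeg_top : expNeg ∞ = 0 := by simp [expNeg]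

theorem expNeg_add (x y : ℝ≥0∞) : expNeg (x + y) = expNeg x * expNeg y := by
  rw [expNeg, expNeg, expNeg, EReal.coe_ennreal_add, EReal.exp_add, ENNReal.mul_inv]
  · exact Or.inl (by simp)
  · exact Or.inr (by simp)

theorem continuous_expNeg : Continuous expNeg :=
  continuous_inv.comp (ENNReal.continuous_exp.comp continuous_coe_ennreal_ereal)

@[fun_prop]
theorem measurable_expNeg : Measurable expNeg := continuous_expNeg.measurable

@[fun_prop]
theorem measurable_negLog : Measurable negLog :=
  measurable_ereal_toENNReal.comp (ENNReal.measurable_log.comp measurable_inv)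

theorem expNeg_anti {x y : ℝ≥0∞} (h : x ≤ y) : expNeg y ≤ expNeg x :=
  ENNReal.inv_le_inv.2 (EReal.exp_monotone (by exact_mod_cast h))

theorem expNeg_le_one (x : ℝ≥0∞) : expNeg x ≤ 1 := by
  simpa using expNeg_anti (zero_le (a := x))

theorem expNeg_ofReal {x : ℝ} (hx : 0 ≤ x) :
    expNeg (ENNReal.ofReal x) = ENNReal.ofReal (Real.exp (-x)) := by
  rw [expNeg, EReal.coe_ennreal_ofReal, max_eq_left hx, EReal.exp_coe, Real.exp_neg,
    ENNReal.ofReal_inv_of_pos (Real.exp_pos x)]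

theorem expNeg_sum {ι : Type*} (s : Finset ι) (f : ι → ℝ≥0∞) :
    expNeg (∑ i ∈ s, f i) = ∏ i ∈ s, expNeg (f i) := by
  classical
  induction s using Finset.induction_on with
  | empty => simp
  | insert a s ha ih => rw [Finset.sum_insert ha, Finset.prod_insert ha, expNeg_add, ih]

/-- Sums in [0, ∞] always converge, so infinite products of numbers in [0, 1] are handled through
their exponents; a factor 0 is a term ∞. -/
theorem tendsto_prod_expNeg {ι : Type*} (f : ι → ℝ≥0∞) :
    Tendsto (fun s : Finset ι => ∏ i ∈ s, expNeg (f i)) atTop (𝓝 (expNeg (∑' i, f i))) := by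
  simp_rw [← expNeg_sum]
  exact (continuous_expNeg.tendsto _).comp ENNReal.summable.hasSum

/-- Laplace transform of a sum of independent variables. -/
theorem lintegral_expNeg_tsum {Ω ι : Type*} [MeasurableSpace Ω] {μ : Measure Ω}
    [IsProbabilityMeasure μ] [Countable ι] {ψ : ι → Ω → ℝ≥0∞} (hψ : ∀ i, Measurable (ψ i))
    (hind : iIndepFun ψ μ) :
    ∫⁻ ω, expNeg (∑' i, ψ i ω) ∂μ = expNeg (∑' i, negLog (∫⁻ ω, expNeg (ψ i ω) ∂μ)) := by
  have hle : ∀ i, ∫⁻ ω, expNeg (ψ i ω) ∂μ ≤ 1 := fun i =>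
    (lintegral_mono fun ω => expNeg_le_one _).trans (by simp)
  -- Both sides are limits of the same finite products along finite sets of indices; on the left the
  -- bound 1 allows dominated convergence.
  refine tendsto_nhds_unique ?_ (tendsto_prod_expNeg _)
  simp_rw [expNeg_negLog (hle _)]
  have h1 : ∀ s : Finset ι, ∏ i ∈ s, ∫⁻ ω, expNeg (ψ i ω) ∂μ
      = ∫⁻ ω, ∏ i ∈ s, expNeg (ψ i ω) ∂μ := fun s =>
    (lintegral_prod_eq_prod_lintegral_of_indepFun s (fun i ω => expNeg (ψ i ω))
      (hind.comp (fun _ => expNeg) fun _ => measurable_expNeg)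
      fun i => measurable_expNeg.comp (hψ i)).symm
  simp_rw [h1]
  refine tendsto_lintegral_filter_of_dominated_convergence (fun _ => 1)
    (Eventually.of_forall fun s => ?_) (Eventually.of_forall fun s => ae_of_all _ fun ω => ?_)
    (by simp) (ae_of_all _ fun ω => tendsto_prod_expNeg _)
  · exact Finset.measurable_prod _ fun i _ => measurable_expNeg.comp (hψ i)
  · exact Finset.prod_le_one' fun i _ => expNeg_le_one _

/-! ### Poisson point processes -/

/-- Number of points of `y` in `B`. -/
noncomputable def count {E : Type*} (y : ℕ → E) (B : Set E) : ℕ∞ := {j | y j ∈ B}.encard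

theorem tsum_indicator_const {E : Type*} (y : ℕ → E) (B : Set E) (c : ℝ≥0∞) :
    ∑' j, B.indicator (fun _ => c) (y j) = c * (count y B : ℝ≥0∞) := by
  have h : ∀ j, B.indicator (fun _ => c) (y j) = {j | y j ∈ B}.indicator (fun _ => c) j := by
    intro j; by_cases hj : y j ∈ B <;> simp [hj]
  simp_rw [h]
  rw [← tsum_subtype, ENNReal.tsum_set_const, mul_comm, count]

theorem measurable_count {E : Type*} [MeasurableSpace E] {B : Set E} (hB : MeasurableSet B) :
    Measurable fun y : ℕ → E => count y B := by
  have h : Measurable fun y : ℕ → E => ((count y B : ℕ∞) : ℝ≥0∞) := by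
    have : (fun y : ℕ → E => ((count y B : ℕ∞) : ℝ≥0∞))
        = fun y => ∑' j, B.indicator (fun _ => (1 : ℝ≥0∞)) (y j) := by
      ext y; rw [tsum_indicator_const, one_mul]
    rw [this]
    exact Measurable.tsum fun j =>
      (measurable_const.indicator hB).comp (measurable_pi_apply j)
  refine measurable_to_countable' fun n => ?_
  have : (fun y : ℕ → E => count y B) ⁻¹' {n}
      = (fun y : ℕ → E => ((count y B : ℕ∞) : ℝ≥0∞)) ⁻¹' {(n : ℝ≥0∞)} := by
    ext y; simp
  rw [this]
  exact h (measurableSet_singleton _)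

/-- The points `Y 0, Y 1, …` form a Poisson point process with intensity measure `Λ`. -/
structure IsPoissonProcessWith {Ω E : Type*} [MeasurableSpace Ω] [MeasurableSpace E]
    (Y : ℕ → Ω → E) (Λ : Measure E) (μ : Measure Ω) : Prop where
  measurable : ∀ j, Measurable (Y j)
  count_law : ∀ B : Set E, MeasurableSet B → Λ B ≠ ∞ → ∀ n : ℕ,
    μ {ω | count (fun j => Y j ω) B = n} = poissonMeasure (Λ B).toNNReal {n}
  count_indep : ∀ (m : ℕ) (B : Fin m → Set E), (∀ k, MeasurableSet (B k)) →
    (Pairwise fun k k' => Disjoint (B k) (B k')) →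
    iIndepFun (fun k ω => count (fun j => Y j ω) (B k)) μ

/-- This is the generating function E[x^N] = e^(-r(1-x)) at x = e^(-c), summed by the exponential
series. The value c = ∞, i.e. x = 0, is included and gives the void probability. -/
theorem tsum_mul_poisson_expNeg (r : ℝ≥0) (c : ℝ≥0∞) :
    ∑' n : ℕ, expNeg (c * n) * poissonMeasure r {n} = expNeg ((1 - expNeg c) * r) := by
  have hpow : ∀ n : ℕ, expNeg (c * n) = expNeg c ^ n := by
    intro n
    induction n with
    | zero => simp
    | succ n ih => rw [Nat.cast_succ, mul_add, mul_one, expNeg_add, ih, pow_succ]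
  obtain ⟨x, hx0, hx1, hx⟩ : ∃ x : ℝ, 0 ≤ x ∧ x ≤ 1 ∧ expNeg c = ENNReal.ofReal x := by
    refine ⟨(expNeg c).toReal, ENNReal.toReal_nonneg, ?_, ?_⟩
    · simpa using ENNReal.toReal_mono (by simp) (expNeg_le_one c)
    · rw [ENNReal.ofReal_toReal ((expNeg_le_one c).trans_lt (by simp)).ne]
  have hr : (r : ℝ≥0∞) = ENNReal.ofReal (r : ℝ) := by simp
  rw [hx, hr, ← ENNReal.ofReal_one, ← ENNReal.ofReal_sub _ hx0, ← ENNReal.ofReal_mul (by linarith),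
    expNeg_ofReal (mul_nonneg (sub_nonneg.2 hx1) r.coe_nonneg)]
  simp_rw [hpow, hx, poissonMeasure_singleton, ← ENNReal.ofReal_pow hx0]
  have hs := (NormedSpace.expSeries_div_hasSum_exp (x * (r : ℝ))).mul_left (Real.exp (-r))
  rw [← Real.exp_eq_exp_ℝ, ← Real.exp_add] at hs
  have : ∀ n : ℕ, ENNReal.ofReal (x ^ n) * ENNReal.ofReal (Real.exp (-r) * r ^ n / n.factorial)
      = ENNReal.ofReal (Real.exp (-r) * ((x * r) ^ n / n.factorial)) := by
    intro n
    rw [← ENNReal.ofReal_mul (by positivity)]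
    congr 1; rw [mul_pow]; ring
  simp_rw [this]
  rw [← ENNReal.ofReal_tsum_of_nonneg (fun n => by positivity) hs.summable, hs.tsum_eq]
  congr 2; ring

theorem tsum_mul_poisson (r : ℝ≥0) : ∑' n : ℕ, (n : ℝ≥0∞) * poissonMeasure r {n} = r := by
  rw [tsum_eq_zero_add' ENNReal.summable]
  -- Size-biasing shifts a Poisson law by one. The factor `expNeg (0 * n)` equals 1 and lets the
  -- generating function at c = 0 supply the total mass.
  have h : ∀ n : ℕ, ((n + 1 : ℕ) : ℝ≥0∞) * poissonMeasure r {n + 1}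
      = r * (expNeg (0 * n) * poissonMeasure r {n}) := by
    intro n
    have hr : (r : ℝ≥0∞) = ENNReal.ofReal (r : ℝ) := by simp
    rw [zero_mul, expNeg_zero, one_mul, poissonMeasure_singleton, poissonMeasure_singleton, hr,
      ← ENNReal.ofReal_natCast, ← ENNReal.ofReal_mul (by positivity),
      ← ENNReal.ofReal_mul (by positivity)]
    congr 1
    rw [Nat.factorial_succ]
    push_cast
    field_simp
    exact pow_succ' _ _
  simp_rw [h]
  rw [ENNReal.tsum_mul_left, tsum_mul_poisson_expNeg]
  simp

theorem tsum_enat (f : ℕ∞ → ℝ≥0∞) : ∑' x, f x = f ⊤ + ∑' n : ℕ, f n := by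
  have hinj : Function.Injective (Nat.cast : ℕ → ℕ∞) := Nat.cast_injective
  have hcompl : (Set.range (Nat.cast : ℕ → ℕ∞))ᶜ = {⊤} := by
    ext x
    induction x using ENat.recTopCoe <;> simp
  rw [← ENNReal.summable.tsum_add_tsum_compl (s := {(⊤ : ℕ∞)}) ENNReal.summable,
    tsum_singleton ⊤ f, ← hcompl, compl_compl, tsum_range f hinj]

namespace IsPoissonProcessWith

variable {Ω E : Type*} [MeasurableSpace Ω] [MeasurableSpace E] {Y : ℕ → Ω → E} {Λ : Measure E}
  {μ : Measure Ω}

theorem measurable_count (h : IsPoissonProcessWith Y Λ μ) {B : Set E} (hB : MeasurableSet B) :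
    Measurable fun ω => count (fun j => Y j ω) B :=
  (HetNet.measurable_count hB).comp (measurable_pi_lambda _ h.measurable)

theorem lintegral_prod_count (h : IsPoissonProcessWith Y Λ μ) {ι : Type*} [Fintype ι]
    {B : ι → Set E} (hB : ∀ i, MeasurableSet (B i))
    (hd : Pairwise fun i j => Disjoint (B i) (B j)) (φ : ι → ℕ∞ → ℝ≥0∞) :
    ∫⁻ ω, ∏ i, φ i (count (fun j => Y j ω) (B i)) ∂μ
      = ∏ i, ∫⁻ ω, φ i (count (fun j => Y j ω) (B i)) ∂μ := by
  have e := (Fintype.equivFin ι).symm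
  have hi := h.count_indep _ (fun k => B (e k)) (fun k => hB _)
    fun k k' hk => hd (e.injective.ne hk)
  have hi' := hi.comp (fun k => φ (e k)) fun k => measurable_of_countable _
  have := lintegral_prod_eq_prod_lintegral_of_indepFun Finset.univ _ hi'
    fun k => (measurable_of_countable _).comp (h.measurable_count (hB _))
  simp only [Function.comp_apply] at this
  rw [← Equiv.prod_comp e, ← this]
  congr 1 with ω
  rw [← Equiv.prod_comp e]

variable [IsProbabilityMeasure μ]

/-- The law of the count is prescribed at finite values only; these already carry mass 1, so the
value ⊤ is null and contributes nothing, whatever φ is there. -/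
theorem lintegral_count (h : IsPoissonProcessWith Y Λ μ) {B : Set E} (hB : MeasurableSet B)
    (hΛ : Λ B ≠ ∞) (φ : ℕ∞ → ℝ≥0∞) :
    ∫⁻ ω, φ (count (fun j => Y j ω) B) ∂μ
      = ∑' n : ℕ, φ n * poissonMeasure (Λ B).toNNReal {n} := by
  have hm := h.measurable_count hB
  set ν := μ.map fun ω => count (fun j => Y j ω) B with hν
  have : IsProbabilityMeasure ν := Measure.isProbabilityMeasure_map hm.aemeasurable
  have hn : ∀ n : ℕ, ν {(n : ℕ∞)} = poissonMeasure (Λ B).toNNReal {n} := fun n => by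
    rw [hν, Measure.map_apply hm (measurableSet_singleton _), ← h.count_law B hB hΛ n]; rfl
  have hcount : ∀ ψ : ℕ∞ → ℝ≥0∞, ∫⁻ x, ψ x ∂ν = ψ ⊤ * ν {⊤} + ∑' n : ℕ, ψ n * ν {(n : ℕ∞)} := by
    intro ψ
    rw [lintegral_countable']
    exact tsum_enat fun x : ℕ∞ => ψ x * ν {x}
  have hsum : ∑' n : ℕ, ν {(n : ℕ∞)} = 1 := by
    simp_rw [hn]
    have := measure_iUnion (μ := poissonMeasure (Λ B).toNNReal) (f := fun n : ℕ => {n})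
      (fun i j hij => by simpa using hij) fun _ => measurableSet_singleton _
    rw [← this, Set.iUnion_of_singleton, measure_univ]
  have htop : ν {⊤} = 0 := by
    have := hcount fun _ => 1
    simp only [lintegral_const, measure_univ, one_mul, hsum] at this
    have h1 : (0 : ℝ≥0∞) + 1 = ν {⊤} + 1 := by rw [zero_add]; exact this
    exact ((ENNReal.add_left_inj (by simp)).1 h1).symm
  rw [← lintegral_map (g := fun ω => count (fun j => Y j ω) B) (f := φ)
    (measurable_of_countable _) hm, hcount, htop, mul_zero, zero_add]
  simp_rw [hn]

/-- Joint law of the number of points in `B` and the shot noise of a simple function. -/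
theorem lintegral_count_mul_expNeg_simpleFunc (h : IsPoissonProcessWith Y Λ μ) {B : Set E}
    (hB : MeasurableSet B) (φ : ℕ∞ → ℝ≥0∞) (g : SimpleFunc E ℝ≥0∞)
    (hg : ∀ c ≠ 0, Λ (g ⁻¹' {c}) ≠ ∞) (hgB : ∀ x ∈ B, g x = 0) :
    ∫⁻ ω, φ (count (fun j => Y j ω) B) * expNeg (∑' j, g (Y j ω)) ∂μ
      = (∫⁻ ω, φ (count (fun j => Y j ω) B) ∂μ) * expNeg (∫⁻ x, (1 - expNeg (g x)) ∂Λ) := by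
  classical
  set s := g.range.filter (· ≠ 0) with hs
  have hgsum : ∀ x, g x = ∑ c ∈ s, (g ⁻¹' {c}).indicator (fun _ => c) x := by
    intro x
    by_cases hx : g x = 0
    · rw [Finset.sum_eq_zero, hx]
      intro c hc
      rw [Set.indicator_of_notMem]
      simp only [Set.mem_preimage, Set.mem_singleton_iff, hx]
      exact (Finset.mem_filter.1 hc).2.symm
    · rw [Finset.sum_eq_single (g x)]
      · simp
      · intro c _ hc; simp [hc.symm]
      · intro hc; simp [hs, hx] at hc
  have hshot : ∀ ω, expNeg (∑' j, g (Y j ω))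
      = ∏ c : s, expNeg (c * (count (fun j => Y j ω) (g ⁻¹' {(c : ℝ≥0∞)}) : ℝ≥0∞)) := by
    intro ω
    rw [← expNeg_sum]
    congr 1
    calc ∑' j, g (Y j ω) = ∑' j, ∑ c ∈ s, (g ⁻¹' {c}).indicator (fun _ => c) (Y j ω) := by
          congr 1 with j; exact hgsum _
      _ = ∑ c ∈ s, ∑' j, (g ⁻¹' {c}).indicator (fun _ => c) (Y j ω) :=
          Summable.tsum_finsetSum fun _ _ => ENNReal.summable
      _ = ∑ c ∈ s, c * (count (fun j => Y j ω) (g ⁻¹' {c}) : ℝ≥0∞) := by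
          congr 1 with c
          exact tsum_indicator_const (fun j => Y j ω) _ _
      _ = _ := (Finset.sum_coe_sort s _).symm
  have hint : ∫⁻ x, (1 - expNeg (g x)) ∂Λ = ∑ c : s, (1 - expNeg c) * Λ (g ⁻¹' {(c : ℝ≥0∞)}) := by
    have : ∀ x, 1 - expNeg (g x) = ∑ c ∈ s, (g ⁻¹' {c}).indicator (fun _ => 1 - expNeg c) x := by
      intro x
      by_cases hx : g x = 0
      · rw [Finset.sum_eq_zero, hx]
        · simp
        intro c hc
        rw [Set.indicator_of_notMem]
        simp only [Set.mem_preimage, Set.mem_singleton_iff, hx]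
        exact (Finset.mem_filter.1 hc).2.symm
      · rw [Finset.sum_eq_single (g x)]
        · simp
        · intro c _ hc; simp [hc.symm]
        · intro hc; simp [hs, hx] at hc
    simp_rw [this]
    rw [lintegral_finsetSum _ fun c _ => measurable_const.indicator (g.measurableSet_fiber c),
      ← Finset.sum_coe_sort]
    congr 1 with c
    rw [lintegral_indicator_const (g.measurableSet_fiber _)]
  -- Since g vanishes on B, the set B (index `none`) and the fibres of g over its nonzero values
  -- form a finite disjoint family, so their counts are independent.
  set D : Option s → Set E := fun o => o.elim B fun c => g ⁻¹' {(c : ℝ≥0∞)} with hD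
  set Φ : Option s → ℕ∞ → ℝ≥0∞ := fun o => o.elim φ fun c n => expNeg (c * (n : ℝ≥0∞)) with hΦ
  have hDm : ∀ o, MeasurableSet (D o) := by
    rintro (_ | c)
    · exact hB
    · exact g.measurableSet_fiber _
  have hBc : ∀ c : s, Disjoint B (g ⁻¹' {(c : ℝ≥0∞)}) := fun c => Set.disjoint_left.2 fun x hx hc =>
    (Finset.mem_filter.1 c.2).2 (by rw [← Set.mem_singleton_iff.1 hc, hgB x hx])
  have hDd : Pairwise fun i j => Disjoint (D i) (D j) := by
    rintro (_ | c) (_ | c') hne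
    · exact absurd rfl hne
    · exact hBc c'
    · exact (hBc c).symm
    · refine Set.disjoint_left.2 fun x hx hx' => hne ?_
      have : (c : ℝ≥0∞) = c' := (Set.mem_singleton_iff.1 hx).symm.trans (Set.mem_singleton_iff.1 hx')
      rw [Subtype.ext this]
  have key := h.lintegral_prod_count hDm hDd Φ
  simp only [Fintype.prod_option] at key
  simp only [hD, hΦ, Option.elim] at key
  simp_rw [hshot, hint, expNeg_sum]
  rw [key]
  congr 1
  refine Finset.prod_congr rfl fun c _ => ?_
  have hfin := hg c (Finset.mem_filter.1 c.2).2
  refine (h.lintegral_count (g.measurableSet_fiber _) hfin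
    fun n => expNeg (c * (n : ℝ≥0∞))).trans ?_
  have := tsum_mul_poisson_expNeg (Λ (g ⁻¹' {(c : ℝ≥0∞)})).toNNReal c
  rw [ENNReal.coe_toNNReal hfin] at this
  rw [← this]
  simp

/-- Joint law of the number of points in `B` and a shot noise that ignores `B`. -/
theorem lintegral_count_mul_expNeg [SigmaFinite Λ] (h : IsPoissonProcessWith Y Λ μ) {B : Set E}
    (hB : MeasurableSet B) (φ : ℕ∞ → ℝ≥0∞)
    (hφ : ∫⁻ ω, φ (count (fun j => Y j ω) B) ∂μ ≠ ∞) {g : E → ℝ≥0∞} (hg : Measurable g)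
    (hgB : ∀ x ∈ B, g x = 0) :
    ∫⁻ ω, φ (count (fun j => Y j ω) B) * expNeg (∑' j, g (Y j ω)) ∂μ
      = (∫⁻ ω, φ (count (fun j => Y j ω) B) ∂μ) * expNeg (∫⁻ x, (1 - expNeg (g x)) ∂Λ) := by
  -- Cutting the approximations off outside spanning sets gives their nonzero fibres finite
  -- intensity, as the simple case demands.
  set u : ℕ → SimpleFunc E ℝ≥0∞ := fun n =>
    (SimpleFunc.eapprox g n).restrict (spanningSets Λ n) with hu
  have hu_apply : ∀ n x, u n x = (spanningSets Λ n).indicator (SimpleFunc.eapprox g n) x :=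
    fun n x => by rw [hu]; simp only [SimpleFunc.restrict_apply _ (measurableSet_spanningSets Λ n)]
  have hmono : ∀ x, Monotone fun n => u n x := by
    intro x n m hnm
    simp only [hu_apply]
    by_cases hx : x ∈ spanningSets Λ n
    · rw [Set.indicator_of_mem hx, Set.indicator_of_mem (monotone_spanningSets Λ hnm hx)]
      exact SimpleFunc.monotone_eapprox g hnm x
    · rw [Set.indicator_of_notMem hx]; exact zero_le
  have hsup : ∀ x, Tendsto (fun n => u n x) atTop (𝓝 (g x)) := by
    intro x
    refine (SimpleFunc.tendsto_eapprox hg x).congr' ?_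
    filter_upwards [eventually_ge_atTop (spanningSetsIndex Λ x)] with n hn
    rw [hu_apply, Set.indicator_of_mem (mem_spanningSets_of_index_le Λ x hn)]
  have hle : ∀ n x, u n x ≤ g x := fun n x => (hmono x).ge_of_tendsto (hsup x) n
  have hfin : ∀ n, ∀ c ≠ 0, Λ (u n ⁻¹' {c}) ≠ ∞ := by
    intro n c hc
    refine (lt_of_le_of_lt (measure_mono fun x hx => ?_) (measure_spanningSets_lt_top Λ n)).ne
    by_contra hxn
    rw [Set.mem_preimage, hu_apply, Set.indicator_of_notMem hxn] at hx
    exact hc (Set.mem_singleton_iff.1 hx).symm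
  have hsimple := fun n => h.lintegral_count_mul_expNeg_simpleFunc hB φ (u n) (hfin n)
    fun x hx => le_antisymm ((hle n x).trans (hgB x hx).le) zero_le
  have hcm := h.measurable_count hB
  refine tendsto_nhds_unique (f := fun n => ∫⁻ ω, φ (count (fun j => Y j ω) B) *
    expNeg (∑' j, u n (Y j ω)) ∂μ) (l := atTop) ?_ ?_
  · refine tendsto_lintegral_of_dominated_convergence (fun ω => φ (count (fun j => Y j ω) B))
      (fun n => ?_) (fun n => ae_of_all _ fun ω => ?_) hφ ?_
    · refine ((measurable_of_countable φ).comp hcm).mul (measurable_expNeg.comp ?_)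
      exact Measurable.tsum fun j => (u n).measurable.comp (h.measurable j)
    · exact mul_le_of_le_one_right' (expNeg_le_one _)
    · filter_upwards [ae_lt_top ((measurable_of_countable φ).comp hcm) hφ] with ω hω
      have hsum : Tendsto (fun n => ∑' j, u n (Y j ω)) atTop (𝓝 (∑' j, g (Y j ω))) := by
        simp_rw [← MeasureTheory.lintegral_count]
        exact lintegral_tendsto_of_tendsto_of_monotone
          (fun n => (measurable_of_countable _).aemeasurable)
          (ae_of_all _ fun j => hmono _) (ae_of_all _ fun j => hsup _)
      exact ENNReal.Tendsto.const_mul ((continuous_expNeg.tendsto _).comp hsum) (Or.inr hω.ne)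
  · simp_rw [hsimple]
    have hint : Tendsto (fun n => ∫⁻ x, (1 - expNeg (u n x)) ∂Λ) atTop
        (𝓝 (∫⁻ x, (1 - expNeg (g x)) ∂Λ)) := by
      refine lintegral_tendsto_of_tendsto_of_monotone
        (fun n => (measurable_const.sub (measurable_expNeg.comp (u n).measurable)).aemeasurable)
        (ae_of_all _ fun x n m hnm => tsub_le_tsub_left (expNeg_anti (hmono x hnm)) _)
        (ae_of_all _ fun x => ?_)
      exact ENNReal.Tendsto.sub tendsto_const_nhds ((continuous_expNeg.tendsto _).comp (hsup x))
        (Or.inl (by simp))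
    exact ENNReal.Tendsto.const_mul ((continuous_expNeg.tendsto _).comp hint) (Or.inr hφ)

end IsPoissonProcessWith

/-! ### The integrals behind `G` and `H` -/

theorem lintegral_Ioi_exp_neg_mul {c : ℝ} (hc : 0 < c) :
    ∫⁻ y in Set.Ioi (0 : ℝ), ENNReal.ofReal (Real.exp (-(c * y))) = ENNReal.ofReal c⁻¹ := by
  have hi : IntegrableOn (fun y => Real.exp (-(c * y))) (Set.Ioi 0) := by
    simpa [neg_mul] using exp_neg_integrableOn_Ioi 0 hc
  rw [← ofReal_integral_eq_lintegral_ofReal hi (ae_of_all _ fun y => (Real.exp_pos _).le)]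
  congr 1
  have := Real.integral_rpow_mul_exp_neg_mul_Ioi (a := 1) one_pos hc
  simpa using this

/-- Write 1/(s^p + δ) as the integral of e^(-(s^p + δ)y) over y > 0 and exchange the integrals.
Integrating in s gives Γ(1/p + 1) y^(-1/p), then integrating in y gives Γ(1 - 1/p) and a power of δ.
The two Gamma values combine into the beta function because its arguments add up to 1. -/
theorem lintegral_Ioi_div_rpow_add {p δ : ℝ} (hp : 1 < p) (hδ : 0 < δ) :
    ∫⁻ s in Set.Ioi (0 : ℝ), ENNReal.ofReal (δ / (s ^ p + δ))
      = ENNReal.ofReal (1 / p * δ ^ (1 / p) * beta (1 / p) (1 - 1 / p)) := by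
  have hp0 : 0 < p := by linarith
  have hp1 : 1 / p < 1 := by rw [div_lt_one hp0]; exact hp
  have hp2 : 0 < 1 / p := by positivity
  have h1 : ∀ s ∈ Set.Ioi (0 : ℝ), ENNReal.ofReal (δ / (s ^ p + δ))
      = ∫⁻ y in Set.Ioi (0 : ℝ), ENNReal.ofReal (δ * Real.exp (-((s ^ p + δ) * y))) := by
    intro s hs
    have : 0 < s ^ p + δ := add_pos (Real.rpow_pos_of_pos hs _) hδ
    simp_rw [ENNReal.ofReal_mul hδ.le]
    rw [lintegral_const_mul _ (by fun_prop), lintegral_Ioi_exp_neg_mul this,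
      ← ENNReal.ofReal_mul hδ.le, div_eq_mul_inv]
  rw [setLIntegral_congr_fun measurableSet_Ioi h1, lintegral_lintegral_swap (by fun_prop)]
  have h2 : ∀ y ∈ Set.Ioi (0 : ℝ),
      ∫⁻ s in Set.Ioi (0 : ℝ), ENNReal.ofReal (δ * Real.exp (-((s ^ p + δ) * y)))
        = ENNReal.ofReal (δ * Real.Gamma (1 / p + 1) *
            (y ^ ((1 - 1 / p) - 1) * Real.exp (-(δ * y)))) := by
    intro y hy
    have hy : 0 < y := hy
    have : ∀ s : ℝ, δ * Real.exp (-((s ^ p + δ) * y))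
        = (δ * Real.exp (-(δ * y))) * (Real.exp (-y * s ^ p)) := by
      intro s
      rw [mul_assoc, ← Real.exp_add]; congr 2; ring
    simp_rw [this]
    simp_rw [ENNReal.ofReal_mul (show 0 ≤ δ * Real.exp (-(δ * y)) by positivity)]
    have hi := integrableOn_rpow_mul_exp_neg_mul_rpow (s := 0) (by norm_num) hp0 hy
    simp only [Real.rpow_zero, one_mul] at hi
    rw [lintegral_const_mul _ (by fun_prop), ← ofReal_integral_eq_lintegral_ofReal hi
      (ae_of_all _ fun y => (Real.exp_pos _).le), integral_exp_neg_mul_rpow hp0 hy,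
      ← ENNReal.ofReal_mul (by positivity)]
    congr 1
    rw [show (1 - 1 / p) - 1 = -1 / p by ring]
    ring
  rw [setLIntegral_congr_fun measurableSet_Ioi h2]
  have hG : 0 < Real.Gamma (1 / p + 1) := Real.Gamma_pos_of_pos (by linarith)
  simp_rw [ENNReal.ofReal_mul (show 0 ≤ δ * Real.Gamma (1 / p + 1) by positivity)]
  have hi : IntegrableOn (fun y => y ^ ((1 - 1 / p) - 1) * Real.exp (-(δ * y))) (Set.Ioi 0) := by
    have := integrableOn_rpow_mul_exp_neg_mul_rpow (s := (1 - 1 / p) - 1) (p := 1) (by linarith)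
      one_pos hδ
    simpa using this
  rw [lintegral_const_mul _ (by fun_prop), ← ofReal_integral_eq_lintegral_ofReal hi,
    Real.integral_rpow_mul_exp_neg_mul_Ioi (by linarith) hδ, ← ENNReal.ofReal_mul (by positivity)]
  · congr 1
    rw [beta, Real.Gamma_add_one hp2.ne', add_sub_cancel, Real.Gamma_one, Real.rpow_sub' (by positivity)]
    · rw [Real.rpow_one, one_div δ, Real.inv_rpow hδ.le]
      field_simp
    · linarith
  · filter_upwards [self_mem_ae_restrict measurableSet_Ioi] with y hy
    have hy : 0 < y := hy
    positivity

/-- Density of the interference deficit at relative area `s` for a station always transmitting. -/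
noncomputable def deficit (δ α s : ℝ) : ℝ := δ / (s ^ (α / 2) + δ)

theorem deficit_nonneg {δ α s : ℝ} (hδ : 0 ≤ δ) (hs : 0 ≤ s) : 0 ≤ deficit δ α s := by
  unfold deficit; positivity

theorem measurable_deficit (δ α : ℝ) : Measurable (deficit δ α) := by
  unfold deficit; fun_prop

theorem lintegral_deficit_Ioi_zero {δ α : ℝ} (hα : 2 < α) (hδ : 0 ≤ δ) :
    ∫⁻ s in Set.Ioi (0 : ℝ), ENNReal.ofReal (deficit δ α s) = ENNReal.ofReal (H δ α) := by
  have e : 2 / α = 1 / (α / 2) := by field_simp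
  rcases hδ.eq_or_lt with rfl | hδ
  · simp [deficit, H, Real.zero_rpow (show 2 / α ≠ 0 by positivity)]
  · rw [H, e]
    exact lintegral_Ioi_div_rpow_add (by linarith) hδ

theorem H_nonneg {δ α : ℝ} (hα : 2 < α) (hδ : 0 ≤ δ) : 0 ≤ H δ α := by
  have h1 : 0 < 2 / α := by positivity
  have h2 : 2 / α < 1 := by rw [div_lt_one (by linarith)]; exact hα
  have := beta_pos h1 (show 0 < 1 - 2 / α by linarith)
  unfold H; positivity

theorem integrableOn_deficit {δ α : ℝ} (hα : 2 < α) (hδ : 0 ≤ δ) :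
    IntegrableOn (deficit δ α) (Set.Ioi 0) := by
  refine ⟨(measurable_deficit δ α).aestronglyMeasurable, ?_⟩
  rw [hasFiniteIntegral_iff_ofReal, lintegral_deficit_Ioi_zero hα hδ]
  · exact ENNReal.ofReal_lt_top
  · filter_upwards [self_mem_ae_restrict measurableSet_Ioi] with s hs
    exact deficit_nonneg hδ (le_of_lt hs)

theorem integral_deficit_Ioi_zero {δ α : ℝ} (hα : 2 < α) (hδ : 0 ≤ δ) :
    ∫ s in Set.Ioi (0 : ℝ), deficit δ α s = H δ α := by
  rw [integral_eq_lintegral_of_nonneg_ae, lintegral_deficit_Ioi_zero hα hδ,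
    ENNReal.toReal_ofReal (H_nonneg hα hδ)]
  · filter_upwards [self_mem_ae_restrict measurableSet_Ioi] with s hs
    exact deficit_nonneg hδ (le_of_lt hs)
  · exact (measurable_deficit δ α).aestronglyMeasurable

/-- The substitution t = s^(-α/2) maps (1, ∞) onto (0, 1) and produces Euler's integrand t^(-2/α) (1
+ δt)^(-1). Here c - b = 1, so the Gamma quotient is just b = 1 - 2/α, which cancels the α - 2 in
the prefactor of `G`. -/
theorem integral_deficit_Ioi_one {δ α : ℝ} (hα : 2 < α) (hδ : 0 ≤ δ) :
    ∫ s in Set.Ioi (1 : ℝ), deficit δ α s = G δ α := by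
  have hα0 : 0 < α := by linarith
  set f : ℝ → ℝ := fun s => s ^ (-(α / 2)) with hf
  set g : ℝ → ℝ := fun t => 2 / α * δ * (t ^ (-(2 / α)) * (1 + δ * t)⁻¹) with hg
  have himg : f '' Set.Ioi 1 = Set.Ioo 0 1 := by
    ext t
    constructor
    · rintro ⟨s, hs, rfl⟩
      have hs : 1 < s := hs
      exact ⟨Real.rpow_pos_of_pos (by linarith) _,
        Real.rpow_lt_one_of_one_lt_of_neg hs (by linarith)⟩
    · rintro ⟨h0, h1⟩
      refine ⟨t ^ (-(2 / α)), Real.one_lt_rpow_of_pos_of_lt_one_of_neg h0 h1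
        (by have : 0 < 2 / α := by positivity
            linarith), ?_⟩
      rw [hf]
      simp only
      rw [← Real.rpow_mul h0.le]
      have : -(2 / α) * -(α / 2) = 1 := by field_simp
      rw [this, Real.rpow_one]
  have hderiv : ∀ s ∈ Set.Ioi (1 : ℝ),
      HasDerivWithinAt f (-(α / 2) * s ^ (-(α / 2) - 1)) (Set.Ioi 1) s := fun s hs =>
    (Real.hasDerivAt_rpow_const (Or.inl (by have : 1 < s := hs
                                            positivity))).hasDerivWithinAt
  have hinj : Set.InjOn f (Set.Ioi 1) := by
    intro a ha b hb hab
    have ha : 1 < a := ha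
    have hb : 1 < b := hb
    exact (Real.rpow_left_inj (by linarith) (by linarith) (by linarith)).1 hab
  have hcv := integral_image_eq_integral_abs_deriv_smul measurableSet_Ioi hderiv hinj g
  rw [himg] at hcv
  have hcongr : ∀ s ∈ Set.Ioi (1 : ℝ), deficit δ α s = |-(α / 2) * s ^ (-(α / 2) - 1)| • g (f s) := by
    intro s hs
    have hs : 1 < s := hs
    have hs0 : 0 < s := by linarith
    have hx : 0 < s ^ (α / 2) := Real.rpow_pos_of_pos hs0 _
    rw [abs_mul, abs_neg, abs_of_pos (by positivity : 0 < α / 2),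
      abs_of_pos (Real.rpow_pos_of_pos hs0 _), smul_eq_mul, hg, hf]
    simp only
    rw [← Real.rpow_mul hs0.le]
    have : -(α / 2) * -(2 / α) = 1 := by field_simp
    rw [this, Real.rpow_one, Real.rpow_sub hs0, Real.rpow_one, Real.rpow_neg hs0.le, deficit]
    field_simp
  rw [setIntegral_congr_fun measurableSet_Ioi hcongr, ← hcv, ← integral_Ioc_eq_integral_Ioo,
    ← intervalIntegral.integral_of_le zero_le_one, intervalIntegral.integral_const_mul, G, gaussHyp]
  have hb : 2 - 2 / α - (1 - 2 / α) = 1 := by ring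
  have h2 : 2 / α < 1 := by rw [div_lt_one (by linarith)]; exact hα
  have hc : 2 - 2 / α = (1 - 2 / α) + 1 := by ring
  have hΓ : 0 < Real.Gamma (1 - 2 / α) := Real.Gamma_pos_of_pos (by linarith)
  rw [hb, Real.Gamma_one, hc, Real.Gamma_add_one (by linarith), mul_one]
  have hint : ∀ t : ℝ, t ^ (1 - 2 / α - 1) * (1 - t) ^ ((1 : ℝ) - 1) * (1 - -δ * t) ^ (-1 : ℝ)
      = t ^ (-(2 / α)) * (1 + δ * t)⁻¹ := by
    intro t
    rw [sub_self, Real.rpow_zero, mul_one, Real.rpow_neg_one]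
    congr 2 <;> ring
  simp_rw [hint]
  rw [← mul_assoc]
  congr 1
  have : α - 2 ≠ 0 := by linarith
  generalize Real.Gamma (1 - 2 / α) = Γ at hΓ ⊢
  field_simp

theorem G_nonneg {δ α : ℝ} (hα : 2 < α) (hδ : 0 ≤ δ) : 0 ≤ G δ α := by
  rw [← integral_deficit_Ioi_one hα hδ]
  exact setIntegral_nonneg measurableSet_Ioi fun s hs =>
    deficit_nonneg hδ (zero_le_one.trans (le_of_lt hs))

/-! ### The mean contribution of one station -/

/-- Mean factor contributed by a station at `s` when the user is served from `t`: the station can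
deliver with probability `π`, and is active with probability `ρ`. -/
noncomputable def factor (δ α π ρ s t : ℝ) : ℝ :=
  (1 - π * (if s < t then 1 else 0)) * (1 - ρ + ρ * (1 + δ * (t / s) ^ (α / 2))⁻¹)

/-- Total deficit, per unit distance, of the stations with delivery probability `π` and activity
probability `ρ`. -/
noncomputable def loss (δ α π ρ : ℝ) : ℝ := π + (1 - π) * ρ * H δ α + π * ρ * G δ α

theorem measurable_factor (δ α π ρ t : ℝ) : Measurable fun s => factor δ α π ρ s t := by
  unfold factor
  have : Measurable fun s : ℝ => if s < t then (1 : ℝ) else 0 :=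
    Measurable.ite measurableSet_Iio measurable_const measurable_const
  fun_prop

theorem factor_mem {δ α π ρ s t : ℝ} (hδ : 0 ≤ δ) (hπ : π ∈ Set.Icc (0 : ℝ) 1)
    (hρ : ρ ∈ Set.Icc (0 : ℝ) 1) (hs : 0 ≤ s) (ht : 0 ≤ t) :
    factor δ α π ρ s t ∈ Set.Icc (0 : ℝ) 1 := by
  obtain ⟨hπ0, hπ1⟩ := hπ
  obtain ⟨hρ0, hρ1⟩ := hρ
  have hu : 0 ≤ δ * (t / s) ^ (α / 2) := by positivity
  have hv0 : 0 ≤ (1 + δ * (t / s) ^ (α / 2))⁻¹ := by positivity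
  have hv1 : (1 + δ * (t / s) ^ (α / 2))⁻¹ ≤ 1 := inv_le_one_of_one_le₀ (by linarith)
  have h1 : 0 ≤ 1 - π * (if s < t then 1 else 0) := by split_ifs <;> linarith
  have h2 : 1 - π * (if s < t then 1 else 0) ≤ 1 := by split_ifs <;> linarith
  have h3 : 0 ≤ 1 - ρ + ρ * (1 + δ * (t / s) ^ (α / 2))⁻¹ := by
    have := mul_nonneg hρ0 hv0
    linarith
  have h4 : 1 - ρ + ρ * (1 + δ * (t / s) ^ (α / 2))⁻¹ ≤ 1 := by
    have := mul_le_mul_of_nonneg_left hv1 hρ0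
    linarith
  exact ⟨mul_nonneg h1 h3, mul_le_one₀ h2 h3 h4⟩

/-- Only the ratio s/t enters, so scaling reduces to t = 1 and brings out a factor t. At t = 1 the
integrand is π on (0, 1), plus (1 - π)ρ times the deficit everywhere, plus πρ times the deficit on
[1, ∞). The last two integrals are H and G. -/
theorem lintegral_one_sub_factor {δ α π ρ t : ℝ} (hα : 2 < α) (hδ : 0 ≤ δ)
    (hπ : π ∈ Set.Icc (0 : ℝ) 1) (hρ : ρ ∈ Set.Icc (0 : ℝ) 1) (ht : 0 ≤ t) :
    ∫⁻ s in Set.Ioi (0 : ℝ), ENNReal.ofReal (1 - factor δ α π ρ s t)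
      = ENNReal.ofReal (t * loss δ α π ρ) := by
  rcases ht.eq_or_lt with rfl | ht
  -- At t = 0 the scaling is unavailable, but nothing lies in front and the interference vanishes,
  -- so the factor is 1.
  · rw [zero_mul, ENNReal.ofReal_zero]
    refine setLIntegral_eq_zero measurableSet_Ioi fun s hs => ?_
    have hs : 0 < s := hs
    simp [factor, not_lt.2 hs.le, Real.zero_rpow (show α / 2 ≠ 0 by linarith)]
  set k : ℝ → ℝ := fun r => 1 - factor δ α π ρ r 1 with hk
  have hfac : ∀ s, 1 - factor δ α π ρ s t = k (t⁻¹ * s) := by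
    intro s
    have h1 : (t⁻¹ * s < 1) ↔ s < t := by rw [inv_mul_lt_iff₀ ht, mul_one]
    have h2 : 1 / (t⁻¹ * s) = t / s := by rw [one_div, mul_inv, inv_inv, div_eq_mul_inv]
    simp only [hk, factor, h1, h2]
  have hkd : ∀ r ∈ Set.Ioi (0 : ℝ), k r
      = (Set.Iio 1).indicator (fun _ => π) r + (1 - π) * ρ * deficit δ α r
        + π * ρ * (Set.Ici 1).indicator (deficit δ α) r := by
    intro r hr
    have hr : 0 < r := hr
    have hx : 0 < r ^ (α / 2) := Real.rpow_pos_of_pos hr _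
    have hv : (1 + δ * (1 / r) ^ (α / 2))⁻¹ = 1 - deficit δ α r := by
      rw [Real.div_rpow zero_le_one hr.le, Real.one_rpow, deficit]
      field_simp
      ring
    simp only [hk, factor, hv]
    rcases lt_or_ge r 1 with h | h
    · rw [Set.indicator_of_mem (Set.mem_Iio.2 h), Set.indicator_of_notMem (by simpa using h), if_pos h]
      ring
    · rw [Set.indicator_of_notMem (by simpa using h), Set.indicator_of_mem (Set.mem_Ici.2 h),
        if_neg (not_lt.2 h)]
      ring
  have hI1 : IntegrableOn ((Set.Iio (1 : ℝ)).indicator fun _ => π) (Set.Ioi 0) := by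
    rw [IntegrableOn, integrable_indicator_iff measurableSet_Iio, IntegrableOn,
      Measure.restrict_restrict measurableSet_Iio]
    refine integrableOn_const ?_
    rw [Set.Iio_inter_Ioi]; simp
  have hI2 := integrableOn_deficit hα hδ
  have hI3 : IntegrableOn ((Set.Ici (1 : ℝ)).indicator (deficit δ α)) (Set.Ioi 0) :=
    hI2.indicator measurableSet_Ici
  have hI12 : IntegrableOn (fun r => (Set.Iio (1 : ℝ)).indicator (fun _ => π) r
      + (1 - π) * ρ * deficit δ α r) (Set.Ioi 0) := hI1.add (hI2.const_mul ((1 - π) * ρ))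
  have hkI : IntegrableOn k (Set.Ioi 0) :=
    ((hI12.add (hI3.const_mul (π * ρ))).congr_fun
      (fun r hr => (hkd r hr).symm) measurableSet_Ioi)
  have hkint : ∫ r in Set.Ioi 0, k r = loss δ α π ρ := by
    rw [setIntegral_congr_fun measurableSet_Ioi hkd,
      integral_add hI12 (hI3.const_mul (π * ρ)),
      integral_add hI1 (hI2.const_mul ((1 - π) * ρ)), integral_const_mul, integral_const_mul,
      integral_deficit_Ioi_zero hα hδ, setIntegral_indicator measurableSet_Ici,
      setIntegral_indicator measurableSet_Iio, loss]
    have e1 : Set.Ioi (0 : ℝ) ∩ Set.Ici 1 = Set.Ici 1 :=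
      Set.inter_eq_right.2 fun x hx => show (0 : ℝ) < x from zero_lt_one.trans_le hx
    rw [e1, integral_Ici_eq_integral_Ioi, integral_deficit_Ioi_one hα hδ, Set.Ioi_inter_Iio]
    simp
  simp_rw [hfac]
  rw [← ofReal_integral_eq_lintegral_ofReal, integral_comp_mul_left_Ioi k 0 (inv_pos.2 ht), mul_zero,
    hkint, inv_inv, smul_eq_mul]
  · rw [← IntegrableOn, integrableOn_Ioi_comp_mul_left_iff k 0 (inv_pos.2 ht), mul_zero]
    exact hkI
  · filter_upwards [self_mem_ae_restrict measurableSet_Ioi] with s hs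
    have hs : 0 < s := hs
    exact sub_nonneg.2 (factor_mem hδ hπ hρ (by positivity) zero_le_one).2

/-! ### Exponential fading -/

theorem expMeasure_tail (y : ℝ≥0∞) : expMeasure 1 {x | y < ENNReal.ofReal x} = expNeg y := by
  induction y using ENNReal.recTopCoe with
  | top => simp
  | coe y =>
    have := isProbabilityMeasure_expMeasure one_pos
    have hset : {x | (y : ℝ≥0∞) < ENNReal.ofReal x} = (Set.Iic (y : ℝ))ᶜ := by
      ext x
      rw [Set.mem_ofPred_eq, Set.compl_Iic, Set.mem_Ioi, ← ENNReal.ofReal_coe_nnreal]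
      exact ENNReal.ofReal_lt_ofReal_iff_of_nonneg y.coe_nonneg
    have h1 : (expMeasure 1).real (Set.Iic (y : ℝ)) = 1 - Real.exp (-y) := by
      rw [← cdf_eq_real, cdf_expMeasure_eq one_pos, if_pos y.coe_nonneg, one_mul]
    rw [hset, ← ENNReal.ofReal_coe_nnreal, expNeg_ofReal y.coe_nonneg,
      ← ofReal_measureReal, measureReal_compl measurableSet_Iic, h1]
    simp

theorem lintegral_expNeg_mul_expMeasure {u : ℝ} (hu : 0 ≤ u) :
    ∫⁻ x, expNeg (ENNReal.ofReal u * ENNReal.ofReal x) ∂(expMeasure 1)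
      = ENNReal.ofReal (1 + u)⁻¹ := by
  have hm : Measurable (exponentialPDF 1) :=
    (measurable_exponentialPDFReal 1).ennreal_ofReal
  have hd : expMeasure 1 = volume.withDensity (exponentialPDF 1) := rfl
  rw [hd, lintegral_withDensity_eq_lintegral_mul _ hm (by fun_prop),
    ← lintegral_add_compl _ (measurableSet_Ioi (a := (0 : ℝ))), Set.compl_Ioi]
  have h0 : ∫⁻ x in Set.Iic (0 : ℝ), (exponentialPDF 1 * fun x =>
      expNeg (ENNReal.ofReal u * ENNReal.ofReal x)) x = 0 := by
    rw [setLIntegral_congr Iio_ae_eq_Iic.symm]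
    refine setLIntegral_eq_zero measurableSet_Iio fun x hx => ?_
    simp [exponentialPDF_of_neg (Set.mem_Iio.1 hx)]
  rw [h0, add_zero, ← lintegral_Ioi_exp_neg_mul (show 0 < 1 + u by linarith)]
  refine setLIntegral_congr_fun measurableSet_Ioi fun x hx => ?_
  have hx : 0 < x := hx
  rw [Pi.mul_apply, exponentialPDF_of_nonneg hx.le, ← ENNReal.ofReal_mul hu,
    expNeg_ofReal (by positivity), ← ENNReal.ofReal_mul (by positivity), one_mul, ← Real.exp_add]
  congr 2; ring

/-! ### Integrating out independent variables -/

section Independence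

variable {Ω : Type*} [MeasurableSpace Ω] {μ : Measure Ω}

theorem lintegral_mul_indep {A B : Type*} [MeasurableSpace A] [MeasurableSpace B] {X : Ω → A}
    {Z : Ω → B} (hX : Measurable X) (hZ : Measurable Z) (hind : IndepFun X Z μ)
    {f : A → ℝ≥0∞} {g : B → ℝ≥0∞} (hf : Measurable f) (hg : Measurable g) :
    ∫⁻ ω, f (X ω) * g (Z ω) ∂μ = (∫⁻ ω, f (X ω) ∂μ) * ∫⁻ ω, g (Z ω) ∂μ :=
  lintegral_mul_eq_lintegral_mul_lintegral_of_indepFun'' (hf.comp hX).aemeasurable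
    (hg.comp hZ).aemeasurable (hind.comp hf hg)

variable [IsProbabilityMeasure μ]

/-- The joint law is a product, so Fubini averages Z with X frozen. The inner average is taken over
a second copy ω' of the same probability space, so that no laws need to be named later. -/
theorem lintegral_indep {A B : Type*} [MeasurableSpace A] [MeasurableSpace B] {X : Ω → A}
    {Z : Ω → B} (hX : Measurable X) (hZ : Measurable Z) (hind : IndepFun X Z μ)
    {f : A → B → ℝ≥0∞} (hf : Measurable (Function.uncurry f)) :
    ∫⁻ ω, f (X ω) (Z ω) ∂μ = ∫⁻ ω, ∫⁻ ω', f (X ω) (Z ω') ∂μ ∂μ := by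
  have h1 := (indepFun_iff_map_prod_eq_prod_map_map hX.aemeasurable hZ.aemeasurable).1 hind
  have hp : IsProbabilityMeasure (μ.map Z) := Measure.isProbabilityMeasure_map hZ.aemeasurable
  have hp' : IsProbabilityMeasure (μ.map X) := Measure.isProbabilityMeasure_map hX.aemeasurable
  calc ∫⁻ ω, f (X ω) (Z ω) ∂μ = ∫⁻ q, Function.uncurry f q ∂(μ.map fun ω => (X ω, Z ω)) :=
        (lintegral_map hf (hX.prodMk hZ)).symm
    _ = ∫⁻ a, ∫⁻ b, f a b ∂(μ.map Z) ∂(μ.map X) := by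
        rw [h1, lintegral_prod _ hf.aemeasurable]; rfl
    _ = _ := by
        refine (lintegral_map hf.lintegral_prod_right' hX).trans ?_
        congr 1 with ω
        exact lintegral_map (hf.comp measurable_prodMk_left) hZ

/-- Integrating out an exponential gain that is independent of everything else. -/
theorem lintegral_exp_tail {B : Type*} [MeasurableSpace B] {h : Ω → ℝ} {Z : Ω → B}
    (hh : Measurable h) (hZ : Measurable Z) (hind : IndepFun Z h μ)
    (hlaw : μ.map h = expMeasure 1) {F Y : B → ℝ≥0∞} (hF : Measurable F) (hY : Measurable Y) :
    ∫⁻ ω, F (Z ω) * {x | Y (Z ω) < ENNReal.ofReal x}.indicator 1 (h ω) ∂μ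
      = ∫⁻ ω, F (Z ω) * expNeg (Y (Z ω)) ∂μ := by
  have hs : MeasurableSet {q : B × ℝ | Y q.1 < ENNReal.ofReal q.2} :=
    measurableSet_lt (by fun_prop) (by fun_prop)
  have hf : Measurable (Function.uncurry fun (z : B) (x : ℝ) =>
      F z * {x | Y z < ENNReal.ofReal x}.indicator (1 : ℝ → ℝ≥0∞) x) :=
    (hF.comp measurable_fst).mul (measurable_one.indicator hs)
  rw [lintegral_indep hZ hh hind hf]
  congr 1 with ω
  have hs' : MeasurableSet {x : ℝ | Y (Z ω) < ENNReal.ofReal x} :=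
    measurableSet_lt measurable_const (by fun_prop)
  refine (lintegral_const_mul _ ((measurable_one.indicator hs').comp hh)).trans ?_
  simp only [Function.comp_apply]
  rw [← lintegral_map (f := {x | Y (Z ω) < ENNReal.ofReal x}.indicator (1 : ℝ → ℝ≥0∞))
      (measurable_one.indicator hs') hh, hlaw, lintegral_indicator_one hs', expMeasure_tail]

/-- Averaging over independent marks, given the positions. -/
theorem lintegral_expNeg_marks {ι A M : Type*} [Countable ι] [MeasurableSpace A]
    [MeasurableSpace M] {X : Ω → A} {m : ι → Ω → M} (hX : Measurable X)
    (hm : ∀ c, Measurable (m c)) (hind : IndepFun X (fun ω c => m c ω) μ) (hmind : iIndepFun m μ)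
    {F : A → ℝ≥0∞} (hF : Measurable F) {χ : ι → A → M → ℝ≥0∞}
    (hχ : ∀ c, Measurable (Function.uncurry (χ c))) :
    ∫⁻ ω, F (X ω) * expNeg (∑' c, χ c (X ω) (m c ω)) ∂μ
      = ∫⁻ ω, F (X ω) *
          expNeg (∑' c, negLog (∫⁻ ω', expNeg (χ c (X ω) (m c ω')) ∂μ)) ∂μ := by
  have hf : Measurable (Function.uncurry fun (x : A) (y : ι → M) =>
      F x * expNeg (∑' c, χ c x (y c))) := by
    refine (hF.comp measurable_fst).mul (measurable_expNeg.comp (Measurable.tsum fun c => ?_))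
    exact (hχ c).comp (measurable_fst.prodMk ((measurable_pi_apply c).comp measurable_snd))
  rw [lintegral_indep hX (measurable_pi_lambda _ hm) hind hf]
  congr 1 with ω
  have hc : ∀ c, Measurable (χ c (X ω)) := fun c => (hχ c).comp measurable_prodMk_left
  refine (lintegral_const_mul _ (measurable_expNeg.comp
    (Measurable.tsum fun c => (hc c).comp (hm c)))).trans ?_
  congr 1
  exact lintegral_expNeg_tsum (fun c => (hc c).comp (hm c)) (hmind.comp _ hc)

end Independence

/-! ### Marks of the stations -/

/-- Mark of a station: fading gain, ability to deliver the requested content, activity. -/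
abbrev Mark : Type := ℝ × Prop × Prop

open Classical in
/-- Infinite if a station at `s` prevents the user from being served from `t`. -/
noncomputable def blockCost (t s : ℝ) (m : Mark) : ℝ≥0∞ := if m.2.1 ∧ s < t then ∞ else 0

open Classical in
/-- Normalised interference from a station at `s` when the user is served from `t`. -/
noncomputable def interfCost (δ α t s : ℝ) (m : Mark) : ℝ≥0∞ :=
  if m.2.2 then ENNReal.ofReal (δ * (t / s) ^ (α / 2)) * ENNReal.ofReal m.1 else 0

/-- Total exponent contributed by a station at `s` when the user is served from `t`. -/
noncomputable def cost (δ α t s : ℝ) (m : Mark) : ℝ≥0∞ := blockCost t s m + interfCost δ α t s m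

theorem measurable_blockCost {A : Type*} [MeasurableSpace A] {t s : A → ℝ} {m : A → Mark}
    (ht : Measurable t) (hs : Measurable s) (hm : Measurable m) :
    Measurable fun x => blockCost (t x) (s x) (m x) := by
  unfold blockCost
  refine Measurable.ite ?_ measurable_const measurable_const
  exact (measurableSet_setOfPred.2 (hm.snd.fst)).inter (measurableSet_lt hs ht)

theorem measurable_interfCost (δ α : ℝ) {A : Type*} [MeasurableSpace A] {t s : A → ℝ}
    {m : A → Mark} (ht : Measurable t) (hs : Measurable s) (hm : Measurable m) :
    Measurable fun x => interfCost δ α (t x) (s x) (m x) := by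
  unfold interfCost
  refine Measurable.ite (measurableSet_setOfPred.2 (hm.snd.snd)) ?_ measurable_const
  have := hm.fst
  fun_prop

theorem measurable_cost (δ α : ℝ) {A : Type*} [MeasurableSpace A] {t s : A → ℝ}
    {m : A → Mark} (ht : Measurable t) (hs : Measurable s) (hm : Measurable m) :
    Measurable fun x => cost δ α (t x) (s x) (m x) :=
  (measurable_blockCost ht hs hm).add (measurable_interfCost δ α ht hs hm)

/-- A farther server is easier to block and suffers relatively stronger interference. This is what
allows its random position in a short interval to be replaced by an endpoint. -/
theorem cost_mono {δ α t t' s : ℝ} (hδ : 0 ≤ δ) (hα : 0 ≤ α) (ht : 0 ≤ t) (htt : t ≤ t')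
    (hs : 0 ≤ s) (m : Mark) : cost δ α t s m ≤ cost δ α t' s m := by
  classical
  refine add_le_add ?_ ?_
  · unfold blockCost
    by_cases h : m.2.1 ∧ s < t
    · rw [if_pos h, if_pos ⟨h.1, h.2.trans_le htt⟩]
    · rw [if_neg h]; exact zero_le
  · unfold interfCost
    split_ifs
    · gcongr
    · exact le_rfl

/-- Blocking depends on the ability to deliver, interference on gain and activity, and these are
independent, hence the product. The second factor splits into inactive (1 - ρ) and active, where the
Laplace transform of the exponential law gives 1/(1 + u). -/
theorem lintegral_expNeg_cost {Ω : Type*} [MeasurableSpace Ω] {μ : Measure Ω}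
    [IsProbabilityMeasure μ] {h : Ω → ℝ} {can tr : Ω → Prop} (hh : Measurable h)
    (hcan : Measurable can) (htr : Measurable tr)
    (hind : IndepFun can (fun ω => (h ω, tr ω)) μ) (hind' : IndepFun tr h μ)
    (hlaw : μ.map h = expMeasure 1) {δ α t s : ℝ} (hδ : 0 ≤ δ) (ht : 0 ≤ t)
    (hs : 0 ≤ s) :
    ∫⁻ ω, expNeg (cost δ α t s (h ω, can ω, tr ω)) ∂μ
      = ENNReal.ofReal (factor δ α (μ.real {ω | can ω}) (μ.real {ω | tr ω}) s t) := by
  classical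
  set u := δ * (t / s) ^ (α / 2) with hu
  have hu0 : 0 ≤ u := by positivity
  have hcs : MeasurableSet {ω | can ω} := measurableSet_setOfPred.2 hcan
  have hts : MeasurableSet {ω | tr ω} := measurableSet_setOfPred.2 htr
  have e1 : ∀ ω, expNeg (cost δ α t s (h ω, can ω, tr ω))
      = (if can ω ∧ s < t then 0 else 1) *
        (if tr ω then expNeg (ENNReal.ofReal u * ENNReal.ofReal (h ω)) else 1) := by
    intro ω
    rw [cost, expNeg_add, blockCost, interfCost, apply_ite expNeg, apply_ite expNeg, expNeg_top,
      expNeg_zero]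
  have mA : Measurable fun c : Prop => if c ∧ s < t then (0 : ℝ≥0∞) else 1 :=
    measurable_of_countable _
  have mB : Measurable fun q : ℝ × Prop =>
      if q.2 then expNeg (ENNReal.ofReal u * ENNReal.ofReal q.1) else 1 := by
    refine Measurable.ite (measurableSet_setOfPred.2 measurable_snd) ?_ measurable_const
    fun_prop
  simp_rw [e1]
  refine (lintegral_mul_indep hcan (hh.prodMk htr) hind mA mB).trans ?_
  rw [factor]
  have hA : ∫⁻ ω, (if can ω ∧ s < t then (0 : ℝ≥0∞) else 1) ∂μ
      = ENNReal.ofReal (1 - μ.real {ω | can ω} * (if s < t then 1 else 0)) := by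
    by_cases hst : s < t
    · have : ∀ ω, (if can ω ∧ s < t then (0 : ℝ≥0∞) else 1)
          = {ω | can ω}ᶜ.indicator 1 ω := by
        intro ω; by_cases hc : can ω <;> simp [hc, hst]
      simp_rw [this]
      rw [lintegral_indicator_one hcs.compl, if_pos hst, mul_one, ← ofReal_measureReal,
        measureReal_compl hcs, probReal_univ]
    · simp [hst]
  have hB : ∫⁻ ω, (if tr ω then expNeg (ENNReal.ofReal u * ENNReal.ofReal (h ω)) else 1) ∂μ
      = ENNReal.ofReal (1 - μ.real {ω | tr ω} + μ.real {ω | tr ω} * (1 + u)⁻¹) := by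
    have : ∀ ω, (if tr ω then expNeg (ENNReal.ofReal u * ENNReal.ofReal (h ω)) else 1)
        = {ω | tr ω}ᶜ.indicator 1 ω + (if tr ω then 1 else 0) *
          expNeg (ENNReal.ofReal u * ENNReal.ofReal (h ω)) := by
      intro ω; by_cases hc : tr ω <;> simp [hc]
    simp_rw [this]
    have mC : Measurable fun c : Prop => if c then (1 : ℝ≥0∞) else 0 := measurable_of_countable _
    have mD : Measurable fun x => expNeg (ENNReal.ofReal u * ENNReal.ofReal x) := by fun_prop
    rw [lintegral_add_left (measurable_one.indicator hts.compl), lintegral_indicator_one hts.compl,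
      show ∫⁻ ω, (if tr ω then 1 else 0) * expNeg (ENNReal.ofReal u * ENNReal.ofReal (h ω)) ∂μ = _
        from lintegral_mul_indep htr hh hind' mC mD]
    have h1 : ∫⁻ ω, expNeg (ENNReal.ofReal u * ENNReal.ofReal (h ω)) ∂μ
        = ENNReal.ofReal (1 + u)⁻¹ := by
      rw [← lintegral_expNeg_mul_expMeasure hu0, ← hlaw, lintegral_map mD hh]
    have h2 : ∫⁻ ω, (if tr ω then (1 : ℝ≥0∞) else 0) ∂μ = μ {ω | tr ω} := by
      rw [← lintegral_indicator_one hts]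
      congr 1 with ω
    rw [h1, h2, ← ofReal_measureReal, ← ofReal_measureReal, measureReal_compl hts, probReal_univ,
      ← ENNReal.ofReal_mul measureReal_nonneg, ← ENNReal.ofReal_add]
    · exact sub_nonneg.2 measureReal_le_one
    · positivity
  rw [hA, hB, ← ENNReal.ofReal_mul]
  have := measureReal_le_one (μ := μ) (s := {ω | can ω})
  split_ifs <;> linarith

/-! ### Two independent marked Poisson processes on the half-line -/

/-- A two-tier field: normalised positions `T`, fading gains `h`, and the predicates of being able
to deliver the requested content and of transmitting. -/
structure Field (Ω : Type*) where
  /-- normalised squared distance of station `j` of tier `i` -/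
  T : Fin 2 → ℕ → Ω → ℝ
  /-- fading gains -/
  h : Fin 2 × ℕ → Ω → ℝ
  /-- ability to deliver -/
  can : Fin 2 × ℕ → Ω → Prop
  /-- activity -/
  tr : Fin 2 × ℕ → Ω → Prop

namespace Field

variable {Ω : Type*} (S : Field Ω)

/-- All normalised positions. -/
def pos (ω : Ω) (i : Fin 2) (j : ℕ) : ℝ := S.T i j ω

/-- The mark of a station. -/
def mark (c : Fin 2 × ℕ) (ω : Ω) : Mark := (S.h c ω, S.can c ω, S.tr c ω)

/-- The user is served by `b` with signal-to-interference ratio above the threshold `δ`. -/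
def good (δ α : ℝ) (b : Fin 2 × ℕ) : Set Ω :=
  {ω | S.can b ω ∧ (∀ c, S.can c ω → S.T b.1 b.2 ω ≤ S.T c.1 c.2 ω) ∧
    ∑' c : {c // c ≠ b}, interfCost δ α (S.T b.1 b.2 ω) (S.T c.1.1 c.1.2 ω) (S.mark c ω)
      < ENNReal.ofReal (S.h b ω)}

/-- The user is served by tier `k` from a position in `I`, with signal-to-interference ratio above
the threshold `δ`. -/
def goodIn (δ α : ℝ) (k : Fin 2) (I : Set ℝ) : Set Ω :=
  {ω | ∃ j, S.T k j ω ∈ I ∧ ω ∈ S.good δ α (k, j)}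

/-- The components of a field are measurable. -/
structure IsMeasurable [MeasurableSpace Ω] : Prop where
  T : ∀ i j, Measurable (S.T i j)
  h : ∀ c, Measurable (S.h c)
  can : ∀ c, Measurable (S.can c)
  tr : ∀ c, Measurable (S.tr c)

/-- Two independent Poisson processes on `(0, ∞)` with rates `a`, with independent marks. -/
structure IsModel [MeasurableSpace Ω] (a π ρ : Fin 2 → ℝ) (μ : Measure Ω) : Prop where
  meas : S.IsMeasurable
  a_pos : ∀ i, 0 < a i
  poisson : ∀ i, IsPoissonProcessWith (S.T i)
    (ENNReal.ofReal (a i) • volume.restrict (Set.Ioi 0)) μ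
  indep_tiers : iIndepFun (fun i ω j => S.T i j ω) μ
  indep_marks : iIndepFun S.mark μ
  indep_pos_marks : IndepFun S.pos (fun ω c => S.mark c ω) μ
  indep_fade : ∀ b, IndepFun
    (fun ω => (S.pos ω, S.can b ω, fun c : {c // c ≠ b} => S.mark c ω)) (S.h b) μ
  indep_can : ∀ c, IndepFun (S.can c) (fun ω => (S.h c ω, S.tr c ω)) μ
  indep_tr : ∀ c, IndepFun (S.tr c) (S.h c) μ
  fade_law : ∀ c, μ.map (S.h c) = expMeasure 1
  can_prob : ∀ c, μ.real {ω | S.can c ω} = π c.1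
  tr_prob : ∀ c, μ.real {ω | S.tr c ω} = ρ c.1

section Measurability

variable {S} [MeasurableSpace Ω]

namespace IsMeasurable

theorem pos (hS : S.IsMeasurable) : Measurable S.pos :=
  measurable_pi_lambda _ fun i => measurable_pi_lambda _ fun j => hS.T i j

theorem mark (hS : S.IsMeasurable) (c : Fin 2 × ℕ) : Measurable (S.mark c) :=
  (hS.h c).prodMk ((hS.can c).prodMk (hS.tr c))

theorem good (hS : S.IsMeasurable) (δ α : ℝ) (b : Fin 2 × ℕ) : MeasurableSet (S.good δ α b) := by
  refine (measurableSet_setOfPred.2 (hS.can b)).inter (MeasurableSet.inter ?_ ?_)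
  · have : {ω | ∀ c, S.can c ω → S.T b.1 b.2 ω ≤ S.T c.1 c.2 ω}
        = ⋂ c, ({ω | S.can c ω}ᶜ ∪ {ω | S.T b.1 b.2 ω ≤ S.T c.1 c.2 ω}) := by
      ext ω
      simp only [Set.mem_ofPred_eq, Set.mem_iInter, Set.mem_union, Set.mem_compl_iff]
      exact forall_congr' fun c => imp_iff_not_or
    change MeasurableSet {ω | ∀ c, S.can c ω → S.T b.1 b.2 ω ≤ S.T c.1 c.2 ω}
    rw [this]
    exact MeasurableSet.iInter fun c => (measurableSet_setOfPred.2 (hS.can c)).compl.union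
      (measurableSet_le (hS.T _ _) (hS.T _ _))
  · refine measurableSet_lt (Measurable.tsum fun c => ?_) (hS.h b).ennreal_ofReal
    exact measurable_interfCost δ α (hS.T _ _) (hS.T _ _) (hS.mark _)

theorem goodIn (hS : S.IsMeasurable) (δ α : ℝ) (k : Fin 2) {I : Set ℝ} (hI : MeasurableSet I) :
    MeasurableSet (S.goodIn δ α k I) := by
  have : S.goodIn δ α k I = ⋃ j, (S.T k j ⁻¹' I ∩ S.good δ α (k, j)) := by
    ext ω; simp [Field.goodIn]
  rw [this]
  exact MeasurableSet.iUnion fun j => (hS.T k j hI).inter (hS.good δ α _)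

end IsMeasurable

end Measurability

namespace IsModel

variable {S} [MeasurableSpace Ω] {a π ρ : Fin 2 → ℝ} {μ : Measure Ω} [IsProbabilityMeasure μ]

theorem π_mem (hS : S.IsModel a π ρ μ) (i : Fin 2) : π i ∈ Set.Icc (0 : ℝ) 1 := by
  rw [← hS.can_prob (i, 0)]
  exact ⟨measureReal_nonneg, measureReal_le_one⟩

theorem ρ_mem (hS : S.IsModel a π ρ μ) (i : Fin 2) : ρ i ∈ Set.Icc (0 : ℝ) 1 := by
  rw [← hS.tr_prob (i, 0)]
  exact ⟨measureReal_nonneg, measureReal_le_one⟩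

/-- The intensity does not charge (-∞, 0], so the number of points there is Poisson of mean 0. -/
theorem ae_pos (hS : S.IsModel a π ρ μ) : ∀ᵐ ω ∂μ, ∀ i j, 0 < S.T i j ω := by
  rw [ae_all_iff]
  intro i
  have h0 : (ENNReal.ofReal (a i) • volume.restrict (Set.Ioi (0 : ℝ))) (Set.Iic 0) = 0 := by
    rw [Measure.smul_apply, Measure.restrict_apply measurableSet_Iic, Set.Iic_inter_Ioi]
    simp
  have h1 := (hS.poisson i).count_law (Set.Iic 0) measurableSet_Iic (by simp [h0]) 0
  rw [h0, poissonMeasure_singleton] at h1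
  have hm : MeasurableSet {ω | count (fun j => S.T i j ω) (Set.Iic 0) = 0} :=
    (hS.poisson i).measurable_count measurableSet_Iic (measurableSet_singleton 0)
  have h2 : ∀ᵐ ω ∂μ, ω ∈ {ω | count (fun j => S.T i j ω) (Set.Iic 0) = 0} := by
    refine (mem_ae_iff_prob_eq_one (μ := μ) hm).2 ?_
    simpa using h1
  filter_upwards [h2] with ω hω j
  by_contra hj
  have : j ∈ {j | S.T i j ω ∈ Set.Iic (0 : ℝ)} := not_lt.1 hj
  rw [Set.encard_eq_zero.1 hω] at this
  exact this

/-- Averaging over the fading gain of the serving station. -/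
theorem lintegral_indicator_good (hS : S.IsModel a π ρ μ) (δ α : ℝ) (b : Fin 2 × ℕ)
    {F : (Fin 2 → ℕ → ℝ) → ℝ≥0∞} (hF : Measurable F) :
    ∫⁻ ω, F (S.pos ω) * (S.good δ α b).indicator 1 ω ∂μ
      = ∫⁻ ω, F (S.pos ω) * ({ω | S.can b ω}.indicator 1 ω *
          expNeg (∑' c : {c // c ≠ b},
            cost δ α (S.T b.1 b.2 ω) (S.T c.1.1 c.1.2 ω) (S.mark c ω))) ∂μ := by
  classical
  -- Z gathers everything the event depends on except the gain of b itself, of which it is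
  -- independent.
  set Z : Ω → (Fin 2 → ℕ → ℝ) × Prop × ({c // c ≠ b} → Mark) :=
    fun ω => (S.pos ω, S.can b ω, fun c => S.mark c ω) with hZ
  have hZm : Measurable Z := hS.meas.pos.prodMk ((hS.meas.can b).prodMk
    (measurable_pi_lambda _ fun c => hS.meas.mark c))
  have hT : ∀ i j, Measurable fun z : (Fin 2 → ℕ → ℝ) × Prop × ({c // c ≠ b} → Mark) =>
      z.1 i j := fun i j => by fun_prop
  have hM : ∀ c, Measurable fun z : (Fin 2 → ℕ → ℝ) × Prop × ({c // c ≠ b} → Mark) =>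
      z.2.2 c := fun c => by fun_prop
  have hBm : Measurable fun z : (Fin 2 → ℕ → ℝ) × Prop × ({c // c ≠ b} → Mark) =>
      F z.1 * ((if z.2.1 then 1 else 0) * expNeg (∑' c : {c // c ≠ b},
        blockCost (z.1 b.1 b.2) (z.1 c.1.1 c.1.2) (z.2.2 c))) := by
    refine (hF.comp measurable_fst).mul (Measurable.mul ?_ ?_)
    · exact Measurable.ite (measurableSet_setOfPred.2 (by fun_prop)) measurable_const
        measurable_const
    · exact measurable_expNeg.comp (Measurable.tsum fun c =>
        measurable_blockCost (hT _ _) (hT _ _) (hM _))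
  have hYm : Measurable fun z : (Fin 2 → ℕ → ℝ) × Prop × ({c // c ≠ b} → Mark) =>
      ∑' c : {c // c ≠ b}, interfCost δ α (z.1 b.1 b.2) (z.1 c.1.1 c.1.2) (z.2.2 c) :=
    Measurable.tsum fun c => measurable_interfCost δ α (hT _ _) (hT _ _) (hM _)
  have key := lintegral_exp_tail (hS.meas.h b) hZm (hS.indep_fade b) (hS.fade_law b) hBm hYm
  refine Eq.trans ?_ (key.trans ?_)
  · congr 1 with ω
    simp only [hZ]
    change F (S.pos ω) * (S.good δ α b).indicator 1 ω = F (S.pos ω) *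
      ((if S.can b ω then 1 else 0) * expNeg (∑' c : {c // c ≠ b},
        blockCost (S.T b.1 b.2 ω) (S.T c.1.1 c.1.2 ω) (S.mark c ω))) *
      {x | ∑' c : {c // c ≠ b}, interfCost δ α (S.T b.1 b.2 ω) (S.T c.1.1 c.1.2 ω) (S.mark c ω)
        < ENNReal.ofReal x}.indicator 1 (S.h b ω)
    rw [mul_assoc]
    congr 1
    -- A single blocker makes the sum infinite, so this exponential is an indicator; b is not a
    -- blocker, being not strictly closer than itself.
    have hblock : expNeg (∑' c : {c // c ≠ b},
        blockCost (S.T b.1 b.2 ω) (S.T c.1.1 c.1.2 ω) (S.mark c ω))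
        = if ∀ c, S.can c ω → S.T b.1 b.2 ω ≤ S.T c.1 c.2 ω then 1 else 0 := by
      split_ifs with hall
      · have : ∀ c : {c // c ≠ b},
            blockCost (S.T b.1 b.2 ω) (S.T c.1.1 c.1.2 ω) (S.mark c ω) = 0 := fun c =>
          if_neg fun hc => absurd (hall c hc.1) (not_le.2 hc.2)
        simp [this]
      · push Not at hall
        obtain ⟨c, hc, hlt⟩ := hall
        have hcb : c ≠ b := by rintro rfl; exact lt_irrefl _ hlt
        have htop : ∑' c : {c // c ≠ b},
            blockCost (S.T b.1 b.2 ω) (S.T c.1.1 c.1.2 ω) (S.mark c ω) = ∞ :=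
          ENNReal.tsum_eq_top_of_eq_top ⟨⟨c, hcb⟩, if_pos ⟨hc, hlt⟩⟩
        rw [htop, expNeg_top]
    rw [hblock]
    simp only [Set.indicator_apply, good, Set.mem_ofPred_eq, Pi.one_apply]
    have hite : ∀ (A B C : Prop) [Decidable A] [Decidable B] [Decidable C], (if A ∧ B ∧ C then (1 : ℝ≥0∞) else 0)
        = (if A then 1 else 0) * (if B then 1 else 0) * (if C then 1 else 0) := by
      intro A B C _ _ _
      by_cases hA : A <;> by_cases hB : B <;> simp [hA, hB]
    exact hite _ _ _
  · congr 1 with ω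
    simp only [hZ]
    change F (S.pos ω) * ((if S.can b ω then 1 else 0) * expNeg (∑' c : {c // c ≠ b},
        blockCost (S.T b.1 b.2 ω) (S.T c.1.1 c.1.2 ω) (S.mark c ω))) *
      expNeg (∑' c : {c // c ≠ b},
        interfCost δ α (S.T b.1 b.2 ω) (S.T c.1.1 c.1.2 ω) (S.mark c ω)) = _
    rw [mul_assoc, mul_assoc, ← expNeg_add, ← ENNReal.tsum_add]
    rfl

/-- Exponent at `s` of the mean factor of a station of tier `i`. -/
noncomputable def meanCost (δ α : ℝ) (π ρ : Fin 2 → ℝ) (t : ℝ) (i : Fin 2) (s : ℝ) : ℝ≥0∞ :=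
  negLog (ENNReal.ofReal (factor δ α (π i) (ρ i) s t))

theorem measurable_meanCost (δ α : ℝ) (π ρ : Fin 2 → ℝ) (t : ℝ) (i : Fin 2) :
    Measurable (meanCost δ α π ρ t i) :=
  measurable_negLog.comp (measurable_factor _ _ _ _ _).ennreal_ofReal

theorem negLog_lintegral_cost (hS : S.IsModel a π ρ μ) {δ α t s : ℝ} (hδ : 0 ≤ δ) (ht : 0 ≤ t)
    (hs : 0 ≤ s) (c : Fin 2 × ℕ) :
    negLog (∫⁻ ω, expNeg (cost δ α t s (S.mark c ω)) ∂μ) = meanCost δ α π ρ t c.1 s := by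
  have := lintegral_expNeg_cost (hS.meas.h c) (hS.meas.can c) (hS.meas.tr c) (hS.indep_can c)
    (hS.indep_tr c) (hS.fade_law c) (α := α) hδ ht hs
  rw [hS.can_prob, hS.tr_prob] at this
  rw [meanCost, ← this]
  rfl

theorem negLog_one : negLog 1 = 0 := by simp [negLog]

/-- Averaging over the marks, given that station `b` is in `I`. -/
theorem lintegral_marks (hS : S.IsModel a π ρ μ) {δ α t : ℝ} (hδ : 0 ≤ δ) (ht : 0 ≤ t)
    {I : Set ℝ} (hI : MeasurableSet I) (b : Fin 2 × ℕ)
    {F : (Fin 2 → ℕ → ℝ) → ℝ≥0∞} (hF : Measurable F)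
    (hFI : ∀ x : Fin 2 → ℕ → ℝ, x b.1 b.2 ∉ I → F x = 0) :
    ∫⁻ ω, F (S.pos ω) * ({ω | S.can b ω}.indicator 1 ω *
        expNeg (∑' c : Fin 2 × ℕ,
          Iᶜ.indicator (fun s => cost δ α t s (S.mark c ω)) (S.T c.1 c.2 ω))) ∂μ
      = ∫⁻ ω, F (S.pos ω) * (ENNReal.ofReal (π b.1) *
          expNeg (∑' c : Fin 2 × ℕ, Iᶜ.indicator (meanCost δ α π ρ t c.1) (S.T c.1 c.2 ω))) ∂μ := by
  classical
  -- The requirement that b can deliver is encoded as cost ∞ at b otherwise. The whole integrand is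
  -- then one product over stations. As b lies in I, it contributes nothing else.
  set χ : Fin 2 × ℕ → (Fin 2 → ℕ → ℝ) → Mark → ℝ≥0∞ := fun c x m =>
    (if c = b ∧ ¬ m.2.1 then ∞ else 0) + Iᶜ.indicator (fun s => cost δ α t s m) (x c.1 c.2) with hχ
  have hχm : ∀ c, Measurable (Function.uncurry (χ c)) := by
    intro c
    refine Measurable.add ?_ ?_
    · refine Measurable.ite ?_ measurable_const measurable_const
      exact MeasurableSet.inter (MeasurableSet.const _)
        (measurableSet_setOfPred.2 (by fun_prop)).compl
    · have : (fun q : (Fin 2 → ℕ → ℝ) × Mark =>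
          Iᶜ.indicator (fun s => cost δ α t s q.2) (q.1 c.1 c.2))
          = {q | q.1 c.1 c.2 ∈ Iᶜ}.indicator fun q => cost δ α t (q.1 c.1 c.2) q.2 := by
        ext q; by_cases hq : q.1 c.1 c.2 ∈ I <;> simp [hq]
      change Measurable fun q : (Fin 2 → ℕ → ℝ) × Mark =>
          Iᶜ.indicator (fun s => cost δ α t s q.2) (q.1 c.1 c.2)
      rw [this]
      have hx : Measurable fun q : (Fin 2 → ℕ → ℝ) × Mark => q.1 c.1 c.2 := by fun_prop
      exact (measurable_cost δ α measurable_const hx measurable_snd).indicator (hx hI.compl)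
  have key := lintegral_expNeg_marks hS.meas.pos hS.meas.mark hS.indep_pos_marks hS.indep_marks
    hF hχm
  refine Eq.trans ?_ (key.trans ?_)
  · congr 1 with ω
    congr 1
    simp only [hχ]
    rw [ENNReal.tsum_add, expNeg_add]
    congr 1
    by_cases hc : S.can b ω
    · have : ∀ c : Fin 2 × ℕ, (if c = b ∧ ¬ (S.mark c ω).2.1 then ∞ else (0 : ℝ≥0∞)) = 0 := by
        intro c
        refine if_neg ?_
        rintro ⟨rfl, h⟩
        exact h hc
      simp [this, hc]
    · rw [ENNReal.tsum_eq_top_of_eq_top ⟨b, if_pos ⟨rfl, hc⟩⟩]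
      simp [hc]
  · refine lintegral_congr_ae ?_
    filter_upwards [hS.ae_pos] with ω hω
    by_cases hb : S.T b.1 b.2 ω ∈ I
    swap
    · rw [hFI _ hb, zero_mul, zero_mul]
    congr 1
    have hterm : ∀ c : Fin 2 × ℕ, negLog (∫⁻ ω', expNeg (χ c (S.pos ω) (S.mark c ω')) ∂μ)
        = (if c = b then negLog (ENNReal.ofReal (π b.1)) else 0) +
          Iᶜ.indicator (meanCost δ α π ρ t c.1) (S.T c.1 c.2 ω) := by
      intro c
      have hpos : S.pos ω c.1 c.2 = S.T c.1 c.2 ω := rfl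
      by_cases hcb : c = b
      · subst hcb
        have h1 : ∀ ω', expNeg (χ c (S.pos ω) (S.mark c ω')) = {ω | S.can c ω}.indicator 1 ω' := by
          intro ω'
          simp only [hχ, hpos]
          rw [Set.indicator_of_notMem (by simpa using hb), add_zero]
          by_cases hc : S.can c ω'
          · simp [mark, hc]
          · simp [mark, hc]
        simp_rw [h1]
        rw [lintegral_indicator_one (measurableSet_setOfPred.2 (hS.meas.can c)),
          Set.indicator_of_notMem (by simpa using hb), if_pos trivial, add_zero, ← hS.can_prob c,
          ofReal_measureReal]
      · have h1 : ∀ ω', χ c (S.pos ω) (S.mark c ω')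
            = Iᶜ.indicator (fun s => cost δ α t s (S.mark c ω')) (S.T c.1 c.2 ω) := by
          intro ω'
          simp only [hχ, hpos, hcb, false_and, if_false, zero_add]
        simp_rw [h1]
        rw [if_neg hcb, zero_add]
        by_cases hcI : S.T c.1 c.2 ω ∈ I
        · simp [hcI, negLog_one]
        · have hcI' : S.T c.1 c.2 ω ∈ Iᶜ := hcI
          simp_rw [Set.indicator_of_mem hcI']
          exact hS.negLog_lintegral_cost hδ ht (hω _ _).le c
    simp_rw [hterm]
    rw [ENNReal.tsum_add, expNeg_add, tsum_ite_eq, expNeg_negLog]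
    exact ENNReal.ofReal_le_one.2 (hS.π_mem _).2

end IsModel

end Field

theorem tsum_subtype_ne {ι : Type*} {f : ι → ℝ≥0∞} {b : ι} (hb : f b = 0) :
    ∑' c : {c // c ≠ b}, f c = ∑' c, f c := by
  refine tsum_subtype_eq_of_support_subset (s := {c | c ≠ b}) fun c hc => ?_
  rintro rfl
  exact hc hb

/-- Exponent of the mean number of points of a Poisson process of intensity `Λ` removed by an
independent thinning with retention probability `e^{-g}` outside `I`. -/
noncomputable def removed (Λ : Measure ℝ) (g : ℝ → ℝ≥0∞) (I : Set ℝ) : ℝ≥0∞ :=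
  ∫⁻ s, (1 - expNeg (Iᶜ.indicator g s)) ∂Λ

/-! ### Probability of being served from a given set of positions -/

namespace Field.IsModel

variable {Ω : Type*} {S : Field Ω} [MeasurableSpace Ω] {a π ρ : Fin 2 → ℝ} {μ : Measure Ω}
  [IsProbabilityMeasure μ]

/-- Intensity of a tier with rate `r`. -/
noncomputable def intensity (r : ℝ) : Measure ℝ := ENNReal.ofReal r • volume.restrict (Set.Ioi 0)

instance (r : ℝ) : SigmaFinite (intensity r) :=
  inferInstanceAs (SigmaFinite (r.toNNReal • volume.restrict (Set.Ioi (0 : ℝ))))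

/-- Averaging over the positions. -/
theorem lintegral_prod_count_mul_expNeg (hS : S.IsModel a π ρ μ) {I : Set ℝ}
    (hI : MeasurableSet I) (φ : Fin 2 → ℕ∞ → ℝ≥0∞)
    (hφ : ∀ i, ∫⁻ ω, φ i (count (fun j => S.T i j ω) I) ∂μ ≠ ∞) {g : Fin 2 → ℝ → ℝ≥0∞}
    (hg : ∀ i, Measurable (g i)) :
    ∫⁻ ω, (∏ i, φ i (count (S.pos ω i) I)) *
        expNeg (∑' c : Fin 2 × ℕ, Iᶜ.indicator (g c.1) (S.T c.1 c.2 ω)) ∂μ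
      = (∏ i, ∫⁻ ω, φ i (count (fun j => S.T i j ω) I) ∂μ) *
        expNeg (∑ i, removed (intensity (a i)) (g i) I) := by
  have h1 : ∀ ω, (∏ i, φ i (count (S.pos ω i) I)) *
        expNeg (∑' c : Fin 2 × ℕ, Iᶜ.indicator (g c.1) (S.T c.1 c.2 ω))
      = ∏ i, (φ i (count (fun j => S.T i j ω) I) *
          expNeg (∑' j, Iᶜ.indicator (g i) (S.T i j ω))) := by
    intro ω
    rw [ENNReal.tsum_prod', tsum_fintype, expNeg_sum, ← Finset.prod_mul_distrib]
    rfl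
  simp_rw [h1]
  have hgi : ∀ i, Measurable (Iᶜ.indicator (g i)) := fun i => (hg i).indicator hI.compl
  have hm : ∀ i, Measurable fun y : ℕ → ℝ =>
      φ i (count y I) * expNeg (∑' j, Iᶜ.indicator (g i) (y j)) := fun i =>
    ((measurable_of_countable (φ i)).comp (measurable_count hI)).mul (measurable_expNeg.comp
      (Measurable.tsum fun j => (hgi i).comp (measurable_pi_apply j)))
  refine (lintegral_prod_eq_prod_lintegral_of_indepFun Finset.univ
    (fun i ω => φ i (count (fun j => S.T i j ω) I) *
      expNeg (∑' j, Iᶜ.indicator (g i) (S.T i j ω)))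
    (hS.indep_tiers.comp _ hm)
    (fun i => (hm i).comp (measurable_pi_lambda _ (hS.meas.T i)))).trans ?_
  rw [expNeg_sum, ← Finset.prod_mul_distrib]
  refine Finset.prod_congr rfl fun i _ => ?_
  have hp : IsPoissonProcessWith (S.T i) (intensity (a i)) μ := hS.poisson i
  exact hp.lintegral_count_mul_expNeg hI (φ i) (hφ i) (hgi i)
    fun x hx => Set.indicator_of_notMem (by simpa using hx) _

/-- First-moment bound: sum over all stations of tier k in I. Moving the server to the lower bound u
and forgetting the costs of stations in I both enlarge the integrand. What remains outside I is
independent of the number of points in I, whose mean is the intensity of I. -/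
theorem measure_goodIn_le (hS : S.IsModel a π ρ μ) {δ α u : ℝ} (hδ : 0 ≤ δ) (hα : 0 ≤ α)
    (hu : 0 ≤ u) {I : Set ℝ} (hI : MeasurableSet I) (hIu : I ⊆ Set.Ici u) (k : Fin 2)
    (hfin : intensity (a k) I ≠ ∞) :
    μ (S.goodIn δ α k I) ≤ ENNReal.ofReal (π k) * (intensity (a k) I *
      expNeg (∑ i, removed (intensity (a i)) (meanCost δ α π ρ u i) I)) := by
  classical
  set F : ℕ → (Fin 2 → ℕ → ℝ) → ℝ≥0∞ := fun j x => I.indicator 1 (x k j) with hF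
  have hFm : ∀ j, Measurable (F j) := fun j =>
    (measurable_one.indicator hI).comp (by fun_prop : Measurable fun x : Fin 2 → ℕ → ℝ => x k j)
  have hsub : S.goodIn δ α k I ⊆ ⋃ j, (S.T k j ⁻¹' I ∩ S.good δ α (k, j)) := by
    rintro ω ⟨j, hj⟩
    exact Set.mem_iUnion.2 ⟨j, hj⟩
  have hj : ∀ j, μ (S.T k j ⁻¹' I ∩ S.good δ α (k, j)) ≤
      ∫⁻ ω, F j (S.pos ω) * (ENNReal.ofReal (π k) * expNeg (∑' c : Fin 2 × ℕ,
        Iᶜ.indicator (meanCost δ α π ρ u c.1) (S.T c.1 c.2 ω))) ∂μ := by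
    intro j
    rw [← hS.lintegral_marks hδ hu hI (k, j) (hFm j)
      fun x hx => Set.indicator_of_notMem hx _]
    have h1 : μ (S.T k j ⁻¹' I ∩ S.good δ α (k, j))
        = ∫⁻ ω, F j (S.pos ω) * (S.good δ α (k, j)).indicator 1 ω ∂μ := by
      rw [← lintegral_indicator_one ((hS.meas.T k j hI).inter (hS.meas.good δ α _))]
      congr 1 with ω
      rw [Set.inter_indicator_one]
      rfl
    rw [h1, hS.lintegral_indicator_good δ α (k, j) (hFm j)]
    refine lintegral_mono_ae ?_
    filter_upwards [hS.ae_pos] with ω hω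
    by_cases hb : S.T k j ω ∈ I
    swap
    · have : F j (S.pos ω) = 0 := Set.indicator_of_notMem hb _
      rw [this, zero_mul, zero_mul]
    refine mul_le_mul_right (mul_le_mul_right (expNeg_anti ?_) _) _
    have h0 : Iᶜ.indicator (fun s => cost δ α u s (S.mark (k, j) ω)) (S.T k j ω) = 0 :=
      Set.indicator_of_notMem (by simpa using hb) _
    rw [← tsum_subtype_ne (f := fun c : Fin 2 × ℕ =>
      Iᶜ.indicator (fun s => cost δ α u s (S.mark c ω)) (S.T c.1 c.2 ω)) h0]
    refine ENNReal.tsum_le_tsum fun c => ?_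
    refine (Set.indicator_le_self _ _ _).trans ?_
    exact cost_mono hδ hα hu (hIu hb) (hω _ _).le _
  refine (measure_mono hsub).trans ((measure_iUnion_le _).trans
    ((ENNReal.tsum_le_tsum hj).trans (le_of_eq ?_)))
  have hgm : Measurable fun ω => ENNReal.ofReal (π k) * expNeg (∑' c : Fin 2 × ℕ,
        Iᶜ.indicator (meanCost δ α π ρ u c.1) (S.T c.1 c.2 ω)) :=
    (measurable_expNeg.comp (Measurable.tsum fun c =>
      ((measurable_meanCost _ _ _ _ _ _).indicator hI.compl).comp (hS.meas.T _ _))).const_mul _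
  have hFg : ∀ j, AEMeasurable (fun ω => F j (S.pos ω) * (ENNReal.ofReal (π k) *
      expNeg (∑' c : Fin 2 × ℕ,
        Iᶜ.indicator (meanCost δ α π ρ u c.1) (S.T c.1 c.2 ω)))) μ := fun j =>
    (((hFm j).comp hS.meas.pos).mul hgm).aemeasurable
  rw [← lintegral_tsum hFg]
  set φ : Fin 2 → ℕ∞ → ℝ≥0∞ := fun i n => if i = k then (n : ℝ≥0∞) else 1 with hφ
  have hφint : ∀ i, ∫⁻ ω, φ i (count (fun j => S.T i j ω) I) ∂μ
      = if i = k then intensity (a k) I else 1 := by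
    intro i
    by_cases hik : i = k
    · subst hik
      have hp : IsPoissonProcessWith (S.T i) (intensity (a i)) μ := hS.poisson i
      rw [if_pos rfl, hp.lintegral_count hI hfin (φ i)]
      have := tsum_mul_poisson (intensity (a i) I).toNNReal
      rw [ENNReal.coe_toNNReal hfin] at this
      exact Eq.trans (by simp [hφ]) this
    · simp [hφ, hik]
  have hpos := hS.lintegral_prod_count_mul_expNeg hI φ
    (fun i => by rw [hφint]; split_ifs; exacts [hfin, ENNReal.one_ne_top])
    (fun i => measurable_meanCost δ α π ρ u i)
  simp_rw [hφint] at hpos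
  rw [Finset.prod_ite_eq', if_pos (Finset.mem_univ _)] at hpos
  rw [← hpos, ← lintegral_const_mul']
  · congr 1 with ω
    rw [ENNReal.tsum_mul_right, show ∑' j, F j (S.pos ω) = _ from tsum_indicator_const (S.pos ω k) I 1]
    have : ∏ i, φ i (count (S.pos ω i) I) = count (S.pos ω k) I := by
      simp only [hφ]
      rw [Finset.prod_ite_eq', if_pos (Finset.mem_univ _)]
    rw [this]
    ring
  · exact ENNReal.ofReal_ne_top

/-- Keep only configurations with exactly one point of tier k and none of the other tier in I. All
stations other than the server are then outside I, so ignoring I loses nothing, and moving the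
server to the upper bound v only raises the cost. The Poisson weights at 1 and 0 give the first two
factors. -/
theorem le_measure_goodIn (hS : S.IsModel a π ρ μ) {δ α v : ℝ} (hδ : 0 ≤ δ) (hα : 0 ≤ α)
    (hv : 0 ≤ v) {I : Set ℝ} (hI : MeasurableSet I) (hIv : I ⊆ Set.Iic v) (k : Fin 2)
    (hfin : ∀ i, intensity (a i) I ≠ ∞) :
    ENNReal.ofReal (π k) * (intensity (a k) I * expNeg (∑ i, intensity (a i) I) *
      expNeg (∑ i, removed (intensity (a i)) (meanCost δ α π ρ v i) I))
      ≤ μ (S.goodIn δ α k I) := by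
  classical
  set ψ : Fin 2 → ℕ∞ → ℝ≥0∞ := fun i n => if n = (if i = k then 1 else 0) then 1 else 0 with hψ
  set F : ℕ → (Fin 2 → ℕ → ℝ) → ℝ≥0∞ := fun j x =>
    (∏ i, ψ i (count (x i) I)) * I.indicator 1 (x k j) with hF
  have hψm : Measurable fun x : Fin 2 → ℕ → ℝ => ∏ i, ψ i (count (x i) I) :=
    Finset.measurable_prod _ fun i _ => (measurable_of_countable (ψ i)).comp
      ((measurable_count hI).comp (measurable_pi_apply i))
  have hFm : ∀ j, Measurable (F j) := fun j => hψm.mul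
    ((measurable_one.indicator hI).comp (by fun_prop : Measurable fun x : Fin 2 → ℕ → ℝ => x k j))
  have hψcases : ∀ x : Fin 2 → ℕ → ℝ, (∏ i, ψ i (count (x i) I) = 0) ∨
      ((∏ i, ψ i (count (x i) I) = 1) ∧ ∀ i, count (x i) I = if i = k then 1 else 0) := by
    intro x
    by_cases h : ∀ i, count (x i) I = if i = k then 1 else 0
    · exact Or.inr ⟨Finset.prod_eq_one fun i _ => if_pos (h i), h⟩
    · push Not at h
      obtain ⟨i, hi⟩ := h
      exact Or.inl (Finset.prod_eq_zero (Finset.mem_univ i) (if_neg hi))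
  -- Counts are over indices, so a count of 1 also excludes a second station at the same position as
  -- the server.
  have hmemI : ∀ x : Fin 2 → ℕ → ℝ, (∀ i, count (x i) I = if i = k then 1 else 0) →
      ∀ j, x k j ∈ I → ∀ c : Fin 2 × ℕ, c ≠ (k, j) → x c.1 c.2 ∉ I := by
    rintro x hx j hj ⟨i, j'⟩ hne hmem
    have := hx i
    by_cases hik : i = k
    · subst hik
      rw [if_pos rfl, count, Set.encard_eq_one] at this
      obtain ⟨j₀, hj₀⟩ := this
      have e1 : j ∈ {j | x i j ∈ I} := hj
      have e2 : j' ∈ {j | x i j ∈ I} := hmem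
      rw [hj₀, Set.mem_singleton_iff] at e1 e2
      exact hne (by rw [e1, e2])
    · rw [if_neg hik, count, Set.encard_eq_zero] at this
      have e2 : j' ∈ {j | x i j ∈ I} := hmem
      rw [this] at e2
      exact e2
  have hlow : ∑' j, ∫⁻ ω, F j (S.pos ω) * (S.good δ α (k, j)).indicator 1 ω ∂μ
      ≤ μ (S.goodIn δ α k I) := by
    have hFg : ∀ j, AEMeasurable
        (fun ω => F j (S.pos ω) * (S.good δ α (k, j)).indicator 1 ω) μ := fun j =>
      (((hFm j).comp hS.meas.pos).mul
        (measurable_one.indicator (hS.meas.good δ α _))).aemeasurable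
    rw [← lintegral_tsum hFg,
      ← lintegral_indicator_one (hS.meas.goodIn δ α k hI)]
    refine lintegral_mono fun ω => ?_
    rcases hψcases (S.pos ω) with h0 | ⟨h1, hc⟩
    · simp only [hF, h0, zero_mul, tsum_zero]
      exact zero_le
    · have hterm : ∀ j, F j (S.pos ω) * (S.good δ α (k, j)).indicator 1 ω
          ≤ I.indicator (fun _ => 1) (S.pos ω k j) * (S.goodIn δ α k I).indicator 1 ω := by
        intro j
        simp only [hF, h1, one_mul]
        by_cases hj : S.T k j ω ∈ I
        · refine mul_le_mul_right ?_ _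
          by_cases hg : ω ∈ S.good δ α (k, j)
          · have : ω ∈ S.goodIn δ α k I := ⟨j, hj, hg⟩
            simp [this, hg]
          · simp [hg]
        · rw [Set.indicator_of_notMem (show S.pos ω k j ∉ I from hj), zero_mul]
          exact zero_le
      refine (ENNReal.tsum_le_tsum hterm).trans ?_
      rw [ENNReal.tsum_mul_right, tsum_indicator_const, hc k, if_pos rfl]
      simp
  have hj : ∀ j, ∫⁻ ω, F j (S.pos ω) * (ENNReal.ofReal (π k) * expNeg (∑' c : Fin 2 × ℕ,
        Iᶜ.indicator (meanCost δ α π ρ v c.1) (S.T c.1 c.2 ω))) ∂μ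
      ≤ ∫⁻ ω, F j (S.pos ω) * (S.good δ α (k, j)).indicator 1 ω ∂μ := by
    intro j
    rw [← hS.lintegral_marks hδ hv hI (k, j) (hFm j) fun x hx => by
        simp only [hF]
        rw [Set.indicator_of_notMem hx, mul_zero],
      hS.lintegral_indicator_good δ α (k, j) (hFm j)]
    refine lintegral_mono_ae ?_
    filter_upwards [hS.ae_pos] with ω hω
    rcases hψcases (S.pos ω) with h0 | ⟨h1, hc⟩
    · simp only [hF, h0, zero_mul, le_refl]
    by_cases hb : S.T k j ω ∈ I
    swap
    · have : F j (S.pos ω) = 0 := by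
        simp only [hF]
        rw [Set.indicator_of_notMem (show S.pos ω k j ∉ I from hb), mul_zero]
      rw [this, zero_mul, zero_mul]
    refine mul_le_mul_right (mul_le_mul_right (expNeg_anti ?_) _) _
    have h0 : Iᶜ.indicator (fun s => cost δ α v s (S.mark (k, j) ω)) (S.T k j ω) = 0 :=
      Set.indicator_of_notMem (by simpa using hb) _
    rw [← tsum_subtype_ne (f := fun c : Fin 2 × ℕ =>
      Iᶜ.indicator (fun s => cost δ α v s (S.mark c ω)) (S.T c.1 c.2 ω)) h0]
    refine ENNReal.tsum_le_tsum fun c => ?_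
    rw [Set.indicator_of_mem (show S.T c.1.1 c.1.2 ω ∈ Iᶜ from hmemI _ hc j hb c.1 c.2)]
    exact cost_mono hδ hα (hω _ _).le (hIv hb) (hω _ _).le _
  refine le_trans (le_of_eq ?_) ((ENNReal.tsum_le_tsum hj).trans hlow)
  have hgm : Measurable fun ω => ENNReal.ofReal (π k) * expNeg (∑' c : Fin 2 × ℕ,
        Iᶜ.indicator (meanCost δ α π ρ v c.1) (S.T c.1 c.2 ω)) :=
    (measurable_expNeg.comp (Measurable.tsum fun c =>
      ((measurable_meanCost _ _ _ _ _ _).indicator hI.compl).comp (hS.meas.T _ _))).const_mul _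
  have hFg : ∀ j, AEMeasurable (fun ω => F j (S.pos ω) * (ENNReal.ofReal (π k) *
      expNeg (∑' c : Fin 2 × ℕ,
        Iᶜ.indicator (meanCost δ α π ρ v c.1) (S.T c.1 c.2 ω)))) μ := fun j =>
    (((hFm j).comp hS.meas.pos).mul hgm).aemeasurable
  rw [← lintegral_tsum hFg]
  have hψint : ∀ i, ∫⁻ ω, ψ i (count (fun j => S.T i j ω) I) ∂μ
      = (if i = k then intensity (a i) I else 1) * expNeg (intensity (a i) I) := by
    intro i
    have hp : IsPoissonProcessWith (S.T i) (intensity (a i)) μ := hS.poisson i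
    rw [hp.lintegral_count hI (hfin i) (ψ i), tsum_eq_single (if i = k then 1 else 0)]
    · have hr : intensity (a i) I = ENNReal.ofReal ((intensity (a i) I).toNNReal : ℝ) := by
        simp [hfin i]
      rw [poissonMeasure_singleton]
      nth_rw 3 4 [hr]
      rw [expNeg_ofReal (by positivity)]
      split_ifs with hik
      · rw [← ENNReal.ofReal_mul (by positivity)]
        simp [hψ, hik, mul_comm]
      · simp [hψ, hik]
    · intro n hn
      have : ((n : ℕ) : ℕ∞) ≠ if i = k then 1 else 0 := by
        split_ifs at hn ⊢ <;> exact_mod_cast hn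
      simp only [hψ]
      rw [if_neg this, zero_mul]
  have hpos := hS.lintegral_prod_count_mul_expNeg hI ψ
    (fun i => by
      rw [hψint]
      refine ENNReal.mul_ne_top ?_ ((expNeg_le_one _).trans_lt ENNReal.one_lt_top).ne
      split_ifs
      exacts [hfin i, ENNReal.one_ne_top])
    (fun i => measurable_meanCost δ α π ρ v i)
  simp_rw [hψint] at hpos
  rw [Finset.prod_mul_distrib, Finset.prod_ite_eq', if_pos (Finset.mem_univ _), ← expNeg_sum]
    at hpos
  rw [← hpos, ← lintegral_const_mul' _ _ ENNReal.ofReal_ne_top]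
  congr 1 with ω
  have hFs : ∑' j, F j (S.pos ω) = ∏ i, ψ i (count (S.pos ω i) I) := by
    simp only [hF]
    rw [ENNReal.tsum_mul_left,
      show ∑' j, I.indicator 1 (S.pos ω k j) = _ from tsum_indicator_const (S.pos ω k) I 1]
    rcases hψcases (S.pos ω) with h0 | ⟨h1, hc⟩
    · rw [h0, zero_mul]
    · rw [hc k, if_pos rfl]; simp
  rw [ENNReal.tsum_mul_right, hFs]
  ring

end Field.IsModel

/-! ### From short intervals to the whole half-line -/

theorem loss_nonneg {δ α π ρ : ℝ} (hα : 2 < α) (hδ : 0 ≤ δ) (hπ : π ∈ Set.Icc (0 : ℝ) 1)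
    (hρ : ρ ∈ Set.Icc (0 : ℝ) 1) : π ≤ loss δ α π ρ := by
  have h1 := G_nonneg hα hδ
  have h2 := H_nonneg hα hδ
  have h3 := mul_nonneg (mul_nonneg (sub_nonneg.2 hπ.2) hρ.1) h2
  have h4 := mul_nonneg (mul_nonneg hπ.1 hρ.1) h1
  unfold loss
  linarith

/-- Geometric sandwich: bounds on the contributions of short intervals determine the total. -/
theorem eq_div_of_interval_bounds {P : ℝ} {f : ℝ → ℕ → ℝ} {c K s : ℝ} (hK : 0 < K)
    (hf : ∀ ε > 0, HasSum (f ε) P)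
    (hu : ∀ ε > 0, ∀ q : ℕ, f ε q * Real.exp (-(s * ε)) ≤ c * ε * Real.exp (-(q * ε * K)))
    (hl : ∀ ε > 0, ∀ q : ℕ,
      c * ε * Real.exp (-(s * ε)) * Real.exp (-((q * ε + ε) * K)) ≤ f ε q) :
    P = c / K := by
  have hgeo : ∀ ε > 0, HasSum (fun q : ℕ => Real.exp (-(q * ε * K))) (1 - Real.exp (-(K * ε)))⁻¹ := by
    intro ε hε
    have h1 : Real.exp (-(K * ε)) < 1 := by
      rw [← Real.exp_zero]
      exact Real.exp_lt_exp.2 (neg_lt_zero.2 (mul_pos hK hε))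
    have h2 : (fun q : ℕ => Real.exp (-(q * ε * K))) = fun q : ℕ => Real.exp (-(K * ε)) ^ q := by
      ext q
      rw [← Real.exp_nat_mul]
      congr 1; ring
    rw [h2]
    exact hasSum_geometric_of_lt_one (Real.exp_pos _).le h1
  -- The geometric sum times ε is the inverse of a difference quotient of 1 - e^(-Kε) at 0, whose
  -- derivative is K. The correction factors e^(-sε) and e^(-Kε) tend to 1.
  have hslope : Tendsto (fun ε => ε * (1 - Real.exp (-(K * ε)))⁻¹) (𝓝[>] 0) (𝓝 K⁻¹) := by
    have hd : HasDerivAt (fun ε => 1 - Real.exp (-(K * ε))) K 0 := by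
      have := (((hasDerivAt_id (0 : ℝ)).const_mul K).neg.exp).const_sub 1
      simpa using this
    have h2 := (hd.tendsto_slope_zero_right).inv₀ hK.ne'
    refine h2.congr fun ε => ?_
    simp [mul_comm]
  have hexp : ∀ b : ℝ, Tendsto (fun ε => Real.exp (-(b * ε))) (𝓝[>] 0) (𝓝 1) := by
    intro b
    have : Continuous fun ε => Real.exp (-(b * ε)) := by fun_prop
    have := (this.tendsto 0).mono_left (nhdsWithin_le_nhds (s := Set.Ioi 0))
    simpa using this
  refine le_antisymm ?_ ?_
  · have h1 : Tendsto (fun ε => P * Real.exp (-(s * ε))) (𝓝[>] 0) (𝓝 P) := by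
      simpa using (hexp s).const_mul P
    have h2 := hslope.const_mul c
    rw [← div_eq_mul_inv] at h2
    refine le_of_tendsto_of_tendsto h1 h2 ?_
    filter_upwards [self_mem_nhdsWithin] with ε hε
    rw [← mul_assoc]
    exact hasSum_le (hu ε hε) ((hf ε hε).mul_right _) ((hgeo ε hε).mul_left _)
  · have h1 := ((hslope.const_mul c).mul (hexp s)).mul (hexp K)
    rw [mul_one, mul_one, ← div_eq_mul_inv] at h1
    refine le_of_tendsto h1 ?_
    filter_upwards [self_mem_nhdsWithin] with ε hε
    refine hasSum_le (hl ε hε) ?_ (hf ε hε)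
    have := (((hgeo ε hε).mul_left (c * ε)).mul_right (Real.exp (-(s * ε)))).mul_right
      (Real.exp (-(K * ε)))
    rw [← mul_assoc]
    refine (congrArg (HasSum · _) (funext fun q => ?_)).mpr this
    rw [show -((q * ε + ε) * K) = -(q * ε * K) + -(K * ε) by ring, Real.exp_add]
    ring

theorem hasSum_measureReal_iUnion {Ω : Type*} [MeasurableSpace Ω] {μ : Measure Ω}
    [IsFiniteMeasure μ] {f : ℕ → Set Ω} (hd : Pairwise (Function.onFun Disjoint f))
    (hf : ∀ q, MeasurableSet (f q)) : HasSum (fun q => μ.real (f q)) (μ.real (⋃ q, f q)) := by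
  have h := measure_iUnion (μ := μ) hd hf
  have hne : ∑' q, μ (f q) ≠ ∞ := h ▸ measure_ne_top _ _
  have := ENNReal.hasSum_toReal hne
  rw [← ENNReal.tsum_toReal_eq fun q => measure_ne_top _ _, ← h] at this
  exact this

namespace Field.IsModel

theorem intensity_Ico {r u ε : ℝ} (hr : 0 ≤ r) (hu : 0 ≤ u) :
    intensity r (Set.Ico u (u + ε)) = ENNReal.ofReal (r * ε) := by
  rw [intensity, Measure.smul_apply, restrict_Ioi_eq_restrict_Ici,
    Measure.restrict_apply measurableSet_Ico,
    Set.inter_eq_left.2 (show Set.Ico u (u + ε) ⊆ Set.Ici 0 from fun x hx => hu.trans hx.1), Real.volume_Ico,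
    add_sub_cancel_left, smul_eq_mul, ENNReal.ofReal_mul hr]

variable {Ω : Type*} {S : Field Ω} [MeasurableSpace Ω] {a π ρ : Fin 2 → ℝ} {μ : Measure Ω}
  [IsProbabilityMeasure μ]

theorem lintegral_one_sub_meanCost (hS : S.IsModel a π ρ μ) {δ α t : ℝ} (hδ : 0 ≤ δ) (hα : 2 < α)
    (ht : 0 ≤ t) (i : Fin 2) :
    ∫⁻ s, (1 - expNeg (meanCost δ α π ρ t i s)) ∂(intensity (a i))
      = ENNReal.ofReal (t * (a i * loss δ α (π i) (ρ i))) := by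
  rw [intensity, lintegral_smul_measure, smul_eq_mul]
  have h1 : ∀ s ∈ Set.Ioi (0 : ℝ), 1 - expNeg (meanCost δ α π ρ t i s)
      = ENNReal.ofReal (1 - factor δ α (π i) (ρ i) s t) := by
    intro s hs
    have hm := factor_mem (α := α) hδ (hS.π_mem i) (hS.ρ_mem i) (le_of_lt hs) ht
    rw [meanCost, expNeg_negLog (ENNReal.ofReal_le_one.2 hm.2), ENNReal.ofReal_sub _ hm.1,
      ENNReal.ofReal_one]
  rw [setLIntegral_congr_fun measurableSet_Ioi h1,
    lintegral_one_sub_factor hα hδ (hS.π_mem i) (hS.ρ_mem i) ht,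
    ← ENNReal.ofReal_mul (hS.a_pos i).le]
  congr 1; ring

theorem removed_le (hS : S.IsModel a π ρ μ) {δ α t : ℝ} (hδ : 0 ≤ δ) (hα : 2 < α)
    (ht : 0 ≤ t) (I : Set ℝ) (i : Fin 2) :
    removed (intensity (a i)) (meanCost δ α π ρ t i) I
      ≤ ENNReal.ofReal (t * (a i * loss δ α (π i) (ρ i))) := by
  rw [← hS.lintegral_one_sub_meanCost hδ hα ht i]
  exact lintegral_mono fun s => tsub_le_tsub_left (expNeg_anti (Set.indicator_le_self _ _ _)) _

/-- The integrand is at most 1, so leaving out I loses at most the intensity of I. -/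
theorem le_removed_add (hS : S.IsModel a π ρ μ) {δ α t : ℝ} (hδ : 0 ≤ δ) (hα : 2 < α)
    (ht : 0 ≤ t) {I : Set ℝ} (hI : MeasurableSet I) (i : Fin 2) :
    ENNReal.ofReal (t * (a i * loss δ α (π i) (ρ i)))
      ≤ removed (intensity (a i)) (meanCost δ α π ρ t i) I + intensity (a i) I := by
  rw [← hS.lintegral_one_sub_meanCost hδ hα ht i, removed, ← lintegral_indicator_one hI,
    ← lintegral_add_right _ (measurable_one.indicator hI)]
  refine lintegral_mono fun s => ?_
  by_cases hs : s ∈ I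
  · simp only [Set.indicator_of_mem hs, Pi.one_apply]
    exact tsub_le_self.trans le_add_self
  · have hs' : s ∈ Iᶜ := hs
    rw [Set.indicator_of_mem hs', Set.indicator_of_notMem hs, add_zero]

theorem sum_ofReal {f : Fin 2 → ℝ} (hf : ∀ i, 0 ≤ f i) :
    ∑ i, ENNReal.ofReal (f i) = ENNReal.ofReal (∑ i, f i) :=
  (ENNReal.ofReal_sum_of_nonneg fun i _ => hf i).symm

/-- Ignoring the interval changes the exponent by at most its total intensity (∑ a_i)ε; the
corresponding exponential is kept on the left. -/
theorem measureReal_goodIn_Ico_le (hS : S.IsModel a π ρ μ) {δ α u ε : ℝ} (hδ : 0 ≤ δ)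
    (hα : 2 < α) (hu : 0 ≤ u) (hε : 0 ≤ ε) (k : Fin 2) :
    μ.real (S.goodIn δ α k (Set.Ico u (u + ε))) * Real.exp (-((∑ i, a i) * ε))
      ≤ π k * a k * ε * Real.exp (-(u * ∑ i, a i * loss δ α (π i) (ρ i))) := by
  have hl : ∀ i, 0 ≤ loss δ α (π i) (ρ i) := fun i =>
    (hS.π_mem i).1.trans (loss_nonneg hα hδ (hS.π_mem i) (hS.ρ_mem i))
  have ha := fun i => (hS.a_pos i).le
  set I := Set.Ico u (u + ε) with hI
  have hIm : MeasurableSet I := measurableSet_Ico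
  have h1 := hS.measure_goodIn_le (α := α) hδ (by linarith) hu hIm (fun x hx => hx.1) k
    (by rw [intensity_Ico (ha k) hu]; exact ENNReal.ofReal_ne_top)
  have h2 : expNeg (∑ i, removed (intensity (a i)) (meanCost δ α π ρ u i) I) *
      expNeg (ENNReal.ofReal ((∑ i, a i) * ε))
      ≤ expNeg (ENNReal.ofReal (u * ∑ i, a i * loss δ α (π i) (ρ i))) := by
    rw [← expNeg_add]
    refine expNeg_anti ?_
    rw [Finset.mul_sum, Finset.sum_mul, ← sum_ofReal fun i => mul_nonneg hu (mul_nonneg (ha i) (hl i)),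
      ← sum_ofReal fun i => mul_nonneg (ha i) hε, ← Finset.sum_add_distrib]
    refine Finset.sum_le_sum fun i _ => ?_
    rw [← intensity_Ico (ha i) hu]
    exact hS.le_removed_add hδ hα hu hIm i
  have h3 := (mul_le_mul_left h1 (expNeg (ENNReal.ofReal ((∑ i, a i) * ε)))).trans
    (le_of_eq (by ring : _ = ENNReal.ofReal (π k) * intensity (a k) I *
      (expNeg (∑ i, removed (intensity (a i)) (meanCost δ α π ρ u i) I) *
      expNeg (ENNReal.ofReal ((∑ i, a i) * ε)))))
  have h4 := h3.trans (mul_le_mul_right h2 _)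
  have hs : 0 ≤ ∑ i, a i := Finset.sum_nonneg fun i _ => ha i
  have hK : 0 ≤ ∑ i, a i * loss δ α (π i) (ρ i) :=
    Finset.sum_nonneg fun i _ => mul_nonneg (ha i) (hl i)
  have hπ := (hS.π_mem k).1
  have hak := ha k
  rw [intensity_Ico (ha k) hu, expNeg_ofReal (by positivity), expNeg_ofReal (by positivity),
    ← ofReal_measureReal, ← ENNReal.ofReal_mul measureReal_nonneg, ← ENNReal.ofReal_mul hπ,
    ← ENNReal.ofReal_mul (by positivity), ENNReal.ofReal_le_ofReal_iff (by positivity)] at h4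
  linarith

theorem le_measureReal_goodIn_Ico (hS : S.IsModel a π ρ μ) {δ α u ε : ℝ} (hδ : 0 ≤ δ)
    (hα : 2 < α) (hu : 0 ≤ u) (hε : 0 ≤ ε) (k : Fin 2) :
    π k * a k * ε * Real.exp (-((∑ i, a i) * ε)) *
        Real.exp (-((u + ε) * ∑ i, a i * loss δ α (π i) (ρ i)))
      ≤ μ.real (S.goodIn δ α k (Set.Ico u (u + ε))) := by
  have hl : ∀ i, 0 ≤ loss δ α (π i) (ρ i) := fun i =>
    (hS.π_mem i).1.trans (loss_nonneg hα hδ (hS.π_mem i) (hS.ρ_mem i))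
  have ha := fun i => (hS.a_pos i).le
  set I := Set.Ico u (u + ε) with hI
  have hIm : MeasurableSet I := measurableSet_Ico
  have h1 := hS.le_measure_goodIn hδ (by linarith) (add_nonneg hu hε) hIm (fun x hx => hx.2.le) k
    (fun i => by rw [intensity_Ico (ha i) hu]; exact ENNReal.ofReal_ne_top) (α := α)
  have h2 : expNeg (ENNReal.ofReal ((u + ε) * ∑ i, a i * loss δ α (π i) (ρ i)))
      ≤ expNeg (∑ i, removed (intensity (a i)) (meanCost δ α π ρ (u + ε) i) I) := by
    refine expNeg_anti ?_
    rw [Finset.mul_sum, ← sum_ofReal fun i => mul_nonneg (add_nonneg hu hε) (mul_nonneg (ha i) (hl i))]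
    exact Finset.sum_le_sum fun i _ => hS.removed_le hδ hα (add_nonneg hu hε) I i
  have h4 := (mul_le_mul_right (mul_le_mul_right h2 _) _).trans h1
  have hs : 0 ≤ ∑ i, a i := Finset.sum_nonneg fun i _ => ha i
  have hK : 0 ≤ ∑ i, a i * loss δ α (π i) (ρ i) :=
    Finset.sum_nonneg fun i _ => mul_nonneg (ha i) (hl i)
  have hπ := (hS.π_mem k).1
  have hak := ha k
  simp_rw [hI, fun i => intensity_Ico (ε := ε) (ha i) hu] at h4
  rw [sum_ofReal fun i => mul_nonneg (ha i) hε, ← Finset.sum_mul,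
    expNeg_ofReal (by positivity), expNeg_ofReal (by positivity), ← ENNReal.ofReal_mul (by positivity),
    ← ENNReal.ofReal_mul (by positivity), ← ENNReal.ofReal_mul hπ, ← ofReal_measureReal,
    ENNReal.ofReal_le_ofReal_iff measureReal_nonneg] at h4
  refine le_trans (le_of_eq ?_) h4
  ring

/-- Probability that tier `k` serves the user with signal-to-interference ratio above `δ`. -/
theorem measureReal_good (hS : S.IsModel a π ρ μ) {δ α : ℝ} (hδ : 0 ≤ δ)
    (hα : 2 < α) (k : Fin 2) (hK : 0 < ∑ i, a i * loss δ α (π i) (ρ i)) :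
    μ.real {ω | ∃ j, ω ∈ S.good δ α (k, j)}
      = π k * a k / ∑ i, a i * loss δ α (π i) (ρ i) := by
  refine eq_div_of_interval_bounds (s := ∑ i, a i)
    (f := fun ε q => μ.real (S.goodIn δ α k (Set.Ico (q * ε) (q * ε + ε)))) hK ?_ ?_ ?_
  · intro ε hε
    have hdisj : Pairwise (Function.onFun Disjoint fun q : ℕ =>
        S.goodIn δ α k (Set.Ico (q * ε) (q * ε + ε))) := by
      intro q q' hne
      refine Set.disjoint_left.2 ?_
      rintro ω ⟨j, hj, hg⟩ ⟨j', hj', hg'⟩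
      -- Two stations of tier k that both serve are each no farther than the other, hence at the
      -- same distance and in the same interval.
      have e : S.T k j ω = S.T k j' ω :=
        le_antisymm (hg.2.1 (k, j') hg'.1) (hg'.2.1 (k, j) hg.1)
      rw [← e] at hj'
      refine hne ?_
      have h1 : (q : ℝ) * ε < (q' + 1) * ε := by linarith [hj.1, hj'.2]
      have h2 : (q' : ℝ) * ε < (q + 1) * ε := by linarith [hj.2, hj'.1]
      have h3 := lt_of_mul_lt_mul_right h1 (le_of_lt hε)
      have h4 := lt_of_mul_lt_mul_right h2 (le_of_lt hε)
      have h5 : q < q' + 1 := by exact_mod_cast h3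
      have h6 : q' < q + 1 := by exact_mod_cast h4
      omega
    -- The intervals cover [0, ∞) only, which contains all positions almost surely.
    have hae : μ.real {ω | ∃ j, ω ∈ S.good δ α (k, j)}
        = μ.real (⋃ q : ℕ, S.goodIn δ α k (Set.Ico (q * ε) (q * ε + ε))) := by
      refine measureReal_congr ?_
      filter_upwards [hS.ae_pos] with ω hω
      refine propext ⟨?_, ?_⟩
      · rintro ⟨j, hj⟩
        refine Set.mem_iUnion.2 ⟨⌊S.T k j ω / ε⌋₊, j, ⟨?_, ?_⟩, hj⟩
        · rw [← le_div_iff₀ hε]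
          exact Nat.floor_le (div_nonneg (hω _ _).le (le_of_lt hε))
        · have := Nat.lt_floor_add_one (S.T k j ω / ε)
          rw [div_lt_iff₀ hε] at this
          linarith
      · intro h
        obtain ⟨q, j, -, hj⟩ := Set.mem_iUnion.1 h
        exact ⟨j, hj⟩
    rw [hae]
    exact hasSum_measureReal_iUnion hdisj fun q => hS.meas.goodIn δ α k measurableSet_Ico
  · intro ε hε q
    exact hS.measureReal_goodIn_Ico_le hδ hα (by positivity) (le_of_lt hε) k
  · intro ε hε q
    exact hS.le_measureReal_goodIn_Ico hδ hα (by positivity) (le_of_lt hε) k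

end Field.IsModel

/-! ### Independence of groups of sources -/

/-- Blocks are peeled off one at a time: the block of k is independent of the union of the blocks
still in the finite set. It yields mutual independence of the marks of different stations. -/
theorem iIndep_iSup_of_disjoint {Ω ι κ : Type*} {m : ι → MeasurableSpace Ω}
    {mΩ : MeasurableSpace Ω} {μ : Measure Ω} [IsProbabilityMeasure μ] (hle : ∀ i, m i ≤ mΩ)
    (hind : iIndep m μ) {B : κ → Set ι} (hB : Pairwise (Function.onFun Disjoint B)) :
    iIndep (fun k => ⨆ i ∈ B k, m i) μ := by
  classical
  rw [iIndep_iff]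
  intro s
  induction s using Finset.induction_on with
  | empty => intro f _; simp
  | insert k s hk ih =>
    intro f hf
    have hfs : ∀ i ∈ s, MeasurableSet[⨆ i' ∈ B i, m i'] (f i) := fun i hi =>
      hf i (Finset.mem_insert_of_mem hi)
    rw [Finset.prod_insert hk, ← ih hfs, Finset.set_biInter_insert]
    have hdisj : Disjoint (B k) (⋃ i ∈ s, B i) := by
      refine Set.disjoint_iUnion₂_right.2 fun i hi => hB ?_
      rintro rfl
      exact hk hi
    have h := indep_iSup_of_disjoint hle hind hdisj
    refine (Indep_iff _ _ _).1 h _ _ (hf k (Finset.mem_insert_self _ _)) ?_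
    refine MeasurableSet.biInter s.countable_toSet fun i hi => ?_
    have hmono : (⨆ i' ∈ B i, m i') ≤ ⨆ i' ∈ ⋃ i ∈ s, B i, m i' :=
      biSup_mono fun i' hi' => Set.mem_biUnion hi hi'
    exact hmono _ (hfs i hi)

theorem IsPoissonProcessWith.map {Ω E F : Type*} [MeasurableSpace Ω] [MeasurableSpace E]
    [MeasurableSpace F] {Y : ℕ → Ω → E} {Λ : Measure E} {μ : Measure Ω}
    (h : IsPoissonProcessWith Y Λ μ) {f : E → F} (hf : Measurable f) :
    IsPoissonProcessWith (fun j ω => f (Y j ω)) (Λ.map f) μ where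
  measurable j := hf.comp (h.measurable j)
  count_law B hB hΛ n := by
    rw [Measure.map_apply hf hB] at hΛ ⊢
    exact h.count_law _ (hf hB) hΛ n
  count_indep m B hB hd := h.count_indep m (fun k => f ⁻¹' B k) (fun k => hf (hB k))
    fun k k' hk => (hd hk).preimage f

theorem IsPoissonProcess.with_smul_volume {Ω : Type*} [MeasurableSpace Ω] {X : ℕ → Ω → Plane}
    {lam : ℝ} {μ : Measure Ω} (h : IsPoissonProcess X lam μ) (hlam : 0 < lam) :
    IsPoissonProcessWith X (ENNReal.ofReal lam • volume) μ where
  measurable := h.measurable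
  count_law B hB hΛ n := by
    have hv : volume B ≠ ∞ := by
      intro hv
      refine hΛ ?_
      rw [Measure.smul_apply, hv, smul_eq_mul, ENNReal.mul_top]
      simpa using hlam
    have := h.count_law B hB hv n
    refine this.trans ?_
    congr 2
    rw [Measure.smul_apply, smul_eq_mul, ENNReal.toNNReal_mul, Real.toNNReal_mul hlam.le]
    congr 1
    rw [measureReal_def]
    exact Real.toNNReal_coe
  count_indep := h.count_indep

/-! ### The normalised squared distances -/

theorem volume_norm_sq_lt {c : ℝ} (hc : 0 < c) (t : ℝ) :
    volume {x : Plane | c * ‖x‖ ^ 2 < t} = ENNReal.ofReal (Real.pi / c * max t 0) := by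
  rcases le_or_gt t 0 with ht | ht
  · have : {x : Plane | c * ‖x‖ ^ 2 < t} = ∅ := by
      ext x
      simp only [Set.mem_ofPred_eq, Set.mem_empty_iff_false, iff_false, not_lt]
      exact ht.trans (by positivity)
    rw [this, max_eq_right ht]
    simp
  · have : {x : Plane | c * ‖x‖ ^ 2 < t} = Metric.ball 0 (Real.sqrt (t / c)) := by
      ext x
      rw [mem_ball_zero_iff, Real.lt_sqrt (norm_nonneg _), lt_div_iff₀' hc]
      rfl
    rw [this, EuclideanSpace.volume_ball_fin_two, max_eq_left ht.le]
    rw [← ENNReal.ofReal_pow (Real.sqrt_nonneg _), Real.sq_sqrt (by positivity)]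
    rw [← ENNReal.ofReal_mul (by positivity)]
    congr 1
    field_simp

/-- The area of a disc is linear in its squared radius, so squared distances carry Lebesgue measure
on the half-line up to the constant π/c. Half-open intervals, i.e. differences of discs, determine
the measure. -/
theorem map_norm_sq_volume {lam c : ℝ} (hlam : 0 < lam) (hc : 0 < c) :
    (ENNReal.ofReal lam • (volume : Measure Plane)).map (fun x => c * ‖x‖ ^ 2)
      = ENNReal.ofReal (lam * (Real.pi / c)) • volume.restrict (Set.Ioi 0) := by
  have hm : Measurable fun x : Plane => c * ‖x‖ ^ 2 := by fun_prop
  have : IsLocallyFiniteMeasure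
      (ENNReal.ofReal (lam * (Real.pi / c)) • volume.restrict (Set.Ioi (0 : ℝ))) :=
    inferInstanceAs (IsLocallyFiniteMeasure
      ((lam * (Real.pi / c)).toNNReal • volume.restrict (Set.Ioi (0 : ℝ))))
  symm
  refine Measure.ext_of_Ico _ _ fun s t hst => ?_
  have hk : 0 < Real.pi / c := by positivity
  rw [Measure.map_apply hm measurableSet_Ico, Measure.smul_apply, Measure.smul_apply]
  have hpre : (fun x : Plane => c * ‖x‖ ^ 2) ⁻¹' Set.Ico s t
      = {x : Plane | c * ‖x‖ ^ 2 < t} \ {x : Plane | c * ‖x‖ ^ 2 < s} := by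
    ext x
    simp [and_comm]
  rw [hpre, measure_sdiff (show {x : Plane | c * ‖x‖ ^ 2 < s} ⊆ {x : Plane | c * ‖x‖ ^ 2 < t} from
    fun x hx => lt_trans hx hst)
    (measurableSet_lt hm measurable_const).nullMeasurableSet
    (by rw [volume_norm_sq_lt hc]; exact ENNReal.ofReal_ne_top), volume_norm_sq_lt hc,
    volume_norm_sq_lt hc, ← ENNReal.ofReal_sub _ (by positivity), restrict_Ioi_eq_restrict_Ici,
    Measure.restrict_apply measurableSet_Ico, Set.Ico_inter_Ici, Real.volume_Ico, smul_eq_mul,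
    smul_eq_mul, ENNReal.ofReal_mul hlam.le, mul_assoc, ← ENNReal.ofReal_mul hk.le]
  congr 1
  rcases le_or_gt t 0 with ht | ht
  · rw [max_eq_right ht, max_eq_right (hst.le.trans ht)]
    rw [ENNReal.ofReal_of_nonpos, ENNReal.ofReal_of_nonpos]
    · simp
    · rw [sub_zero]; exact mul_nonpos_of_nonneg_of_nonpos hk.le ht
  · rw [max_eq_left ht.le, mul_sub]

/-! ### Which sources of randomness determine which quantities -/

namespace Network

variable {Ω : Type*} (S : Network Ω) (p : Params)

/-- The σ-algebra generated by a set of sources. -/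
@[reducible]
def sigma (A : Set Source) : MeasurableSpace Ω :=
  ⨆ s ∈ A, MeasurableSpace.comap (S.source s) inferInstance

theorem measurable_source {A : Set Source} {s : Source} (hs : s ∈ A) :
    Measurable[S.sigma A] (S.source s) :=
  (comap_measurable (S.source s)).mono
    (le_biSup (fun s => MeasurableSpace.comap (S.source s) inferInstance) hs) le_rfl

/-- Normalised squared distance: `meanPower = T ^ (-α / 2)`. -/
noncomputable def T (i : Fin 2) (j : ℕ) (ω : Ω) : ℝ := p.P i ^ (-(2 / p.α)) * ‖S.X i j ω‖ ^ 2

/-- The marked field seen by a user requesting content `n`. -/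
noncomputable def field (n : ℕ) : Field Ω where
  T := S.T p
  h b := S.h b.1 b.2
  can b := S.CanDeliver n b
  tr b := S.Transmits b

/-- Sources that determine the positions. -/
def posSources : Set Source := Set.range Source.pos

/-- Sources that determine the mark of a station. -/
def markSources (c : Fin 2 × ℕ) : Set Source :=
  {s | s = .fade c.1 c.2 ∨ (c.1 = 1 ∧ (s = .cache c.2 ∨ s = .active c.2))}

/-- Sources that determine the load and the backhaul. -/
def userSources : Set Source :=
  {s | (∃ i, s = .load i) ∨ (∃ k, s = .miss k) ∨ s = .sched}

section SigmaMeasurability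

variable {A : Set Source}

/-- Measurability is stated relative to the sources actually used: two quantities with disjoint
sources are then independent without further work. -/
theorem measurable_T {i : Fin 2} (hA : Source.pos i ∈ A) (j : ℕ) :
    Measurable[S.sigma A] (S.T p i j) := by
  have h : Measurable[S.sigma A] (fun ω => S.X i j ω) :=
    (measurable_pi_apply (X := fun _ : ℕ => Plane) j).comp (S.measurable_source hA)
  have hf : Measurable fun x : Plane => p.P i ^ (-(2 / p.α)) * ‖x‖ ^ 2 := by fun_prop
  exact hf.comp h

theorem measurable_h {i : Fin 2} {j : ℕ} (hA : Source.fade i j ∈ A) :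
    Measurable[S.sigma A] (S.h i j) :=
  S.measurable_source hA

theorem measurable_canDeliver (n : ℕ) {c : Fin 2 × ℕ} (hA : c.1 = 1 → Source.cache c.2 ∈ A) :
    Measurable[S.sigma A] (S.CanDeliver n c) := by
  obtain ⟨i, j⟩ := c
  fin_cases i
  · have : S.CanDeliver n (0, j) = fun _ => True := by ext ω; simp [CanDeliver]
    exact this ▸ @measurable_const _ _ _ (S.sigma A) _
  · have : S.CanDeliver n (1, j) = fun ω => n ∈ S.cache j ω := by ext ω; simp [CanDeliver]
    change Measurable[S.sigma A] (S.CanDeliver n (1, j))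
    rw [this]
    exact (measurable_set_mem n).comp (S.measurable_source (hA rfl))

theorem measurable_transmits {c : Fin 2 × ℕ} (hA : c.1 = 1 → Source.active c.2 ∈ A) :
    Measurable[S.sigma A] (S.Transmits c) := by
  obtain ⟨i, j⟩ := c
  fin_cases i
  · have : S.Transmits (0, j) = fun _ => True := by ext ω; simp [Transmits]
    exact this ▸ @measurable_const _ _ _ (S.sigma A) _
  · have : S.Transmits (1, j) = fun ω => S.active j ω = true := by ext ω; simp [Transmits]
    change Measurable[S.sigma A] (S.Transmits (1, j))
    rw [this]
    have hb : Measurable fun b : Bool => b = true := measurable_of_countable _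
    exact hb.comp (S.measurable_source (hA rfl))

theorem measurable_mark (n : ℕ) {c : Fin 2 × ℕ} (hA : markSources c ⊆ A) :
    Measurable[S.sigma A] ((S.field p n).mark c) :=
  (S.measurable_h (hA (Or.inl rfl))).prodMk
    ((S.measurable_canDeliver n fun hc => hA (Or.inr ⟨hc, Or.inl rfl⟩)).prodMk
      (S.measurable_transmits fun hc => hA (Or.inr ⟨hc, Or.inr rfl⟩)))

theorem measurable_pos (n : ℕ) (hA : posSources ⊆ A) :
    Measurable[S.sigma A] (S.field p n).pos :=
  @measurable_pi_lambda _ _ _ (S.sigma A) _ _ fun i =>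
    @measurable_pi_lambda _ _ _ (S.sigma A) _ _ fun j => S.measurable_T p (hA ⟨i, rfl⟩) j

end SigmaMeasurability

end Network

/-! ### The network as a marked field, and the closed forms -/

namespace Params

variable (p : Params)

/-- Rate of the normalised squared distances of a tier. -/
noncomputable def rate (i : Fin 2) : ℝ := p.lam i * (Real.pi / p.P i ^ (-(2 / p.α)))

open Classical in
/-- Probability that a station of a tier can deliver content `n`. -/
noncomputable def canProb (n : ℕ) : Fin 2 → ℝ := ![1, if n ∈ p.groupLp then p.pLp else 0]

/-- Probability that a station of a tier transmits. -/
noncomputable def trProb : Fin 2 → ℝ := ![1, p.pa]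

end Params

namespace Network

variable {Ω : Type*}

/-- Sources that determine positions and marks. -/
def netSources : Set Source := posSources ∪ ⋃ c, markSources c

/-- The user requesting content `n` is served by tier `k` with signal-to-interference ratio above
`δ`. -/
def sirEvent (S : Network Ω) (p : Params) (n : ℕ) (k : Fin 2) (δ : ℝ) : Set Ω :=
  {ω | ∃ j, ω ∈ (S.field p n).good δ p.α (k, j)}

/-- Only positions and marks are involved, which makes the event independent of loads and backhaul.
The σ-algebra is passed explicitly because it is smaller than the ambient one. -/
theorem measurableSet_sirEvent (S : Network Ω) (p : Params) (n : ℕ) (k : Fin 2) (δ : ℝ) :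
    MeasurableSet[S.sigma netSources] (sirEvent S p n k δ) := by
  have hc : ∀ c : Fin 2 × ℕ, markSources c ⊆ netSources := fun c =>
    (Set.subset_iUnion _ c).trans Set.subset_union_right
  have hf : @Field.IsMeasurable Ω (S.field p n) (S.sigma netSources) :=
    @Field.IsMeasurable.mk Ω (S.field p n) (S.sigma netSources)
      (fun i j => S.measurable_T p (Or.inl ⟨i, rfl⟩) j)
      (fun c => S.measurable_h (hc c (Or.inl rfl)))
      (fun c => S.measurable_canDeliver n fun h => hc c (Or.inr ⟨h, Or.inl rfl⟩))
      (fun c => S.measurable_transmits fun h => hc c (Or.inr ⟨h, Or.inr rfl⟩))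
  have : sirEvent S p n k δ = ⋃ j, (S.field p n).good δ p.α (k, j) := by
    ext ω; simp [sirEvent]
  rw [this]
  exact @MeasurableSet.iUnion _ _ (S.sigma netSources) _ _ fun j =>
    @Field.IsMeasurable.good Ω (S.field p n) (S.sigma netSources) hf δ p.α (k, j)

variable [mΩ : MeasurableSpace Ω] {S : Network Ω} {p : Params} {μ : Measure Ω}

namespace IsModel

theorem comap_source_le (hS : S.IsModel p μ) (s : Source) :
    MeasurableSpace.comap (S.source s) inferInstance ≤ mΩ :=
  (hS.measurable s).comap_le

theorem sigma_le (hS : S.IsModel p μ) (A : Set Source) : S.sigma A ≤ mΩ :=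
  iSup₂_le fun s _ => hS.comap_source_le s

theorem iIndep_source (hS : S.IsModel p μ) :
    iIndep (fun s => MeasurableSpace.comap (S.source s) inferInstance) μ :=
  hS.indep.iIndep

theorem indep_sigma (hS : S.IsModel p μ) {A B : Set Source} (h : Disjoint A B) :
    Indep (S.sigma A) (S.sigma B) μ :=
  indep_iSup_of_disjoint hS.comap_source_le hS.iIndep_source h

theorem indepFun_of_sigma (hS : S.IsModel p μ) {A B : Set Source} (h : Disjoint A B)
    {E F : Type*} [MeasurableSpace E] [MeasurableSpace F] {f : Ω → E} {g : Ω → F}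
    (hf : Measurable[S.sigma A] f) (hg : Measurable[S.sigma B] g) : IndepFun f g μ := by
  rw [IndepFun_iff_Indep]
  exact indep_of_indep_of_le_left (indep_of_indep_of_le_right (hS.indep_sigma h) hg.comap_le)
    hf.comap_le

theorem field_isMeasurable (hS : S.IsModel p μ) (n : ℕ) : (S.field p n).IsMeasurable where
  T _ j := (S.measurable_T p (Set.mem_univ _) j).mono (hS.sigma_le _) le_rfl
  h _ := (S.measurable_h (Set.mem_univ _)).mono (hS.sigma_le _) le_rfl
  can _ := (S.measurable_canDeliver n fun _ => Set.mem_univ _).mono (hS.sigma_le _) le_rfl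
  tr _ := (S.measurable_transmits fun _ => Set.mem_univ _).mono (hS.sigma_le _) le_rfl

/-- Cache and activity labels carry an index but no tier. They belong to helpers alone, so MBS j and
helper j share nothing. -/
theorem markSources_disjoint {c c' : Fin 2 × ℕ} (h : c ≠ c') :
    Disjoint (markSources c) (markSources c') := by
  obtain ⟨i, j⟩ := c
  obtain ⟨i', j'⟩ := c'
  refine Set.disjoint_left.2 ?_
  rintro s hs hs'
  simp only [markSources, Set.mem_ofPred_eq] at hs hs'
  apply h
  rcases hs with rfl | ⟨rfl, rfl | rfl⟩ <;> rcases hs' with hs' | ⟨rfl, hs' | hs'⟩ <;>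
    simp_all

theorem netSources_disjoint : Disjoint netSources userSources := by
  refine Set.disjoint_left.2 ?_
  rintro s (⟨i, rfl⟩ | hs) h
  · simp [userSources] at h
  · obtain ⟨c, hc⟩ := Set.mem_iUnion.1 hs
    rcases hc with rfl | ⟨-, rfl | rfl⟩ <;> simp [userSources] at h

theorem measureReal_sirEvent_inter (hS : S.IsModel p μ) (n : ℕ) (k : Fin 2) (δ : ℝ) {Z : Set Ω}
    (hZ : MeasurableSet[S.sigma userSources] Z) :
    μ.real (sirEvent S p n k δ ∩ Z) = μ.real (sirEvent S p n k δ) * μ.real Z := by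
  have h := (Indep_iff _ _ _).1 (hS.indep_sigma netSources_disjoint) _ _
    (measurableSet_sirEvent S p n k δ) hZ
  rw [measureReal_def, h, ENNReal.toReal_mul]
  rfl

variable [IsProbabilityMeasure μ]

/-- The field seen by a user requesting content `n` satisfies the assumptions of the abstract
model. -/
theorem field_isModel (hS : S.IsModel p μ) (n : ℕ) :
    (S.field p n).IsModel p.rate (p.canProb n) p.trProb μ where
  meas := hS.field_isMeasurable n
  a_pos i := by
    have := p.lam_pos i
    have := Real.rpow_pos_of_pos (p.P_pos i) (-(2 / p.α))
    unfold Params.rate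
    positivity
  poisson i := by
    have hc := Real.rpow_pos_of_pos (p.P_pos i) (-(2 / p.α))
    have h := ((hS.poisson i).with_smul_volume (p.lam_pos i)).map
      (f := fun x : Plane => p.P i ^ (-(2 / p.α)) * ‖x‖ ^ 2) (by fun_prop)
    rw [map_norm_sq_volume (p.lam_pos i) hc] at h
    exact h
  indep_tiers := by
    have h := hS.indep.precomp (g := fun i : Fin 2 => Source.pos i)
      (fun i j hij => by simpa using hij)
    have hf : ∀ i : Fin 2, Measurable fun (x : ℕ → Plane) (j : ℕ) =>
        p.P i ^ (-(2 / p.α)) * ‖x j‖ ^ 2 := fun i => by fun_prop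
    exact h.comp (fun i (x : ℕ → Plane) (j : ℕ) => p.P i ^ (-(2 / p.α)) * ‖x j‖ ^ 2) hf
  indep_marks := by
    rw [iIndepFun_iff_iIndep]
    have h := iIndep_iSup_of_disjoint (B := markSources) hS.comap_source_le hS.iIndep_source
      fun c c' hc => markSources_disjoint hc
    rw [iIndep_iff]
    exact fun s f hf => (iIndep_iff _ _).1 h s fun c hc =>
      (S.measurable_mark p n subset_rfl).comap_le _ (hf c hc)
  indep_pos_marks := by
    refine hS.indepFun_of_sigma (A := posSources) (B := ⋃ c, markSources c) ?_
      (S.measurable_pos p n subset_rfl)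
      (@measurable_pi_lambda _ _ _ (S.sigma _) _ _ fun c =>
        S.measurable_mark p n (Set.subset_iUnion _ c))
    refine Set.disjoint_iUnion_right.2 fun c => Set.disjoint_left.2 ?_
    rintro _ ⟨i, rfl⟩ h
    simp [markSources] at h
  indep_fade b := by
    refine hS.indepFun_of_sigma (A := {s | s ≠ .fade b.1 b.2}) (B := {.fade b.1 b.2})
      (Set.disjoint_left.2 fun s h h' => h h') ?_ (S.measurable_h rfl)
    refine (S.measurable_pos p n ?_).prodMk ((S.measurable_canDeliver n fun _ => by simp).prodMk
      (@measurable_pi_lambda _ _ _ (S.sigma _) _ _ fun c => S.measurable_mark p n ?_))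
    · rintro _ ⟨i, rfl⟩
      simp
    · rintro s hs rfl
      refine Set.disjoint_left.1 (markSources_disjoint c.2) hs (Or.inl rfl)
  -- For an MBS both predicates are constant, so naming the cache and activity of the helper with
  -- the same index is harmless.
  indep_can c := by
    refine hS.indepFun_of_sigma (A := {.cache c.2}) (B := {.fade c.1 c.2, .active c.2}) ?_
      (S.measurable_canDeliver n fun _ => rfl)
      ((S.measurable_h (by simp)).prodMk (S.measurable_transmits fun _ => by simp))
    simp
  indep_tr c :=
    hS.indepFun_of_sigma (A := {.active c.2}) (B := {.fade c.1 c.2}) (by simp)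
      (S.measurable_transmits fun _ => rfl) (S.measurable_h rfl)
  fade_law c := hS.fading c.1 c.2
  can_prob := by
    rintro ⟨i, j⟩
    fin_cases i
    · have : {ω | (S.field p n).can (0, j) ω} = Set.univ := by
        ext ω; simp [field, CanDeliver]
      change μ.real {ω | (S.field p n).can (0, j) ω} = _
      rw [this]
      simp [Params.canProb]
    · have : {ω | (S.field p n).can (1, j) ω} = {ω | n ∈ S.cache j ω} := by
        ext ω; simp [field, CanDeliver]
      change μ.real {ω | (S.field p n).can (1, j) ω} = _
      rw [this]
      by_cases hn : n ∈ p.groupLp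
      · simp [Params.canProb, hn, hS.cache_prob j n hn]
      · have : {ω | n ∈ S.cache j ω} = ∅ := by
          ext ω
          simp only [Set.mem_ofPred_eq, Set.mem_empty_iff_false, iff_false]
          exact fun h => hn (by exact_mod_cast hS.cache_subset j ω h)
        rw [this]
        simp [Params.canProb, hn]
  tr_prob := by
    rintro ⟨i, j⟩
    fin_cases i
    · have : {ω | (S.field p n).tr (0, j) ω} = Set.univ := by
        ext ω; simp [field, Transmits]
      change μ.real {ω | (S.field p n).tr (0, j) ω} = _
      rw [this]
      simp [Params.trProb]
    · have : {ω | (S.field p n).tr (1, j) ω} = {ω | S.active j ω = true} := by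
        ext ω; simp [field, Transmits]
      change μ.real {ω | (S.field p n).tr (1, j) ω} = _
      rw [this, hS.active_prob]
      simp [Params.trProb]

/-- MBSs can deliver every content, so their loss is at least 1. -/
theorem sum_rate_loss_pos (hS : S.IsModel p μ) (n : ℕ) {δ : ℝ} (hδ : 0 ≤ δ) :
    0 < ∑ i, p.rate i * loss δ p.α (p.canProb n i) (p.trProb i) := by
  have hF := hS.field_isModel n
  have h0 : ∀ i, p.canProb n i ≤ loss δ p.α (p.canProb n i) (p.trProb i) := fun i =>
    loss_nonneg p.two_lt_α hδ (hF.π_mem i) (hF.ρ_mem i)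
  have h1 : 1 ≤ loss δ p.α (p.canProb n 0) (p.trProb 0) := h0 0
  have h2 := (hF.π_mem 1).1.trans (h0 1)
  rw [Fin.sum_univ_two]
  have h3 := mul_nonneg (hF.a_pos 1).le h2
  have h4 := mul_pos (hF.a_pos 0) (zero_lt_one.trans_le h1)
  linarith

theorem rate_eq (p : Params) (i : Fin 2) : p.rate i = Real.pi * (p.lam i * p.P i ^ (2 / p.α)) := by
  rw [Params.rate, Real.rpow_neg (p.P_pos i).le, div_inv_eq_mul]
  ring

/-- Closed form for a content of the second group. -/
theorem measureReal_sirEvent_groupLp (hS : S.IsModel p μ) {n : ℕ} (hn : n ∈ p.groupLp)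
    (k : Fin 2) {δ : ℝ} (hδ : 0 ≤ δ) :
    μ.real (sirEvent S p n k δ) = (p.ξ k * G δ p.α + p.ς k * H δ p.α + p.ζ k)⁻¹ := by
  have hK := hS.sum_rate_loss_pos n hδ
  have h := (hS.field_isModel n).measureReal_good hδ p.two_lt_α k hK
  rw [sirEvent, h, Params.ξ, Params.ς, Params.ζ, div_mul_eq_mul_div, div_mul_eq_mul_div, ← add_div,
    ← add_div, inv_div]
  have hpi := Real.pi_pos
  have hnum : p.canProb n k * p.rate k = Real.pi * (p.lamEq k * p.P k ^ (2 / p.α)) := by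
    rw [rate_eq]
    fin_cases k
    · simp [Params.canProb, Params.lamEq]
    · simp [Params.canProb, Params.lamEq, hn]; ring
  -- The loss is 1 + G for MBSs and pLp + (1 - pLp) pa H + pLp pa G for helpers; grouping by G, H
  -- and constants gives the numerators of `ξ`, `ς`, `ζ`.
  have hden : ∑ i, p.rate i * loss δ p.α (p.canProb n i) (p.trProb i)
      = Real.pi * ((p.lam 0 * p.P 0 ^ (2 / p.α) + p.pa * p.pLp * p.lam 1 * p.P 1 ^ (2 / p.α)) *
          G δ p.α + p.pa * (1 - p.pLp) * p.lam 1 * p.P 1 ^ (2 / p.α) * H δ p.α +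
        (p.lam 0 * p.P 0 ^ (2 / p.α) + p.pLp * p.lam 1 * p.P 1 ^ (2 / p.α))) := by
    rw [Fin.sum_univ_two, rate_eq, rate_eq, loss, loss]
    simp [Params.canProb, Params.trProb, hn]
    ring
  rw [hnum, hden, mul_div_mul_left _ _ hpi.ne']

/-- Closed form for a content outside the second group. -/
theorem measureReal_sirEvent_of_notMem (hS : S.IsModel p μ) {n : ℕ} (hn : n ∉ p.groupLp)
    {δ : ℝ} (hδ : 0 ≤ δ) :
    μ.real (sirEvent S p n 0 δ) = (G δ p.α + p.pa * (p.lam 1 / p.lam 0) *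
      (p.P 1 / p.P 0) ^ (2 / p.α) * H δ p.α + 1)⁻¹ := by
  have hK := hS.sum_rate_loss_pos n hδ
  have h := (hS.field_isModel n).measureReal_good hδ p.two_lt_α 0 hK
  rw [sirEvent, h]
  have hpi := Real.pi_pos
  have hl0 := p.lam_pos 0
  have hx0 := Real.rpow_pos_of_pos (p.P_pos 0) (2 / p.α)
  have hnum : p.canProb n 0 * p.rate 0 = Real.pi * (p.lam 0 * p.P 0 ^ (2 / p.α)) := by
    rw [rate_eq]
    simp [Params.canProb]
  -- No helper can deliver here, so helpers only interfere, from anywhere, with loss pa H.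
  have hden : ∑ i, p.rate i * loss δ p.α (p.canProb n i) (p.trProb i)
      = Real.pi * (p.lam 0 * p.P 0 ^ (2 / p.α)) * (G δ p.α + p.pa * (p.lam 1 / p.lam 0) *
      (p.P 1 / p.P 0) ^ (2 / p.α) * H δ p.α + 1) := by
    rw [Fin.sum_univ_two, rate_eq, rate_eq, loss, loss, Real.div_rpow (p.P_pos 1).le (p.P_pos 0).le]
    simp [Params.canProb, Params.trProb, hn]
    field_simp
    ring
  rw [hnum, hden, ← div_div, div_self (by positivity), one_div]

end IsModel

end Network

/-! ### The limit of vanishing noise -/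

theorem tendsto_measureReal_iUnion_pos {Ω : Type*} [MeasurableSpace Ω] {μ : Measure Ω}
    [IsFiniteMeasure μ] {E : ℝ → Set Ω} (hE : ∀ v v', 0 < v → v ≤ v' → E v' ⊆ E v) :
    Tendsto (fun v => μ.real (E v)) (𝓝[>] 0) (𝓝 (μ.real (⋃ v > 0, E v))) := by
  -- With t = 1/v the limit becomes continuity from below at infinity; F is empty for t ≤ 0, so it
  -- is monotone on the whole line.
  set F : ℝ → Set Ω := fun t => {ω | 0 < t ∧ ω ∈ E t⁻¹} with hF
  have hmono : Monotone F := by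
    rintro t t' htt ω ⟨ht, hω⟩
    have ht' := ht.trans_le htt
    exact ⟨ht', hE _ _ (inv_pos.2 ht') (inv_anti₀ ht htt) hω⟩
  have hU : ⋃ v > 0, E v = ⋃ t, F t := by
    ext ω
    simp only [Set.mem_iUnion, hF, Set.mem_ofPred_eq, exists_prop]
    refine ⟨?_, ?_⟩
    · rintro ⟨v, hv, h⟩
      exact ⟨v⁻¹, inv_pos.2 hv, by rwa [inv_inv]⟩
    · rintro ⟨t, ht, h⟩
      exact ⟨t⁻¹, inv_pos.2 ht, h⟩
  have h1 := (tendsto_measure_iUnion_atTop (μ := μ) hmono).comp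
    (tendsto_inv_nhdsGT_zero (𝕜 := ℝ))
  have h2 := (ENNReal.tendsto_toReal (measure_ne_top μ (⋃ t, F t))).comp h1
  rw [hU]
  refine h2.congr' ?_
  filter_upwards [self_mem_nhdsWithin] with v hv
  have : F v⁻¹ = E v := by
    ext ω
    simp only [hF, Set.mem_ofPred_eq, inv_inv, inv_pos]
    exact ⟨fun h => h.2, fun h => ⟨hv, h⟩⟩
  simp [this, measureReal_def]

/-- Any positive noise makes a non-strict bound strict after its removal, and conversely a strict
bound leaves room for some noise. Infinite interference fails on both sides. -/
theorem exists_noise_le_toReal_div {δ s : ℝ} (hδ : 0 < δ) (I : ℝ≥0∞) :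
    (∃ v > 0, δ ≤ (ENNReal.ofReal s / (I + ENNReal.ofReal v)).toReal) ↔
      ENNReal.ofReal δ * I < ENNReal.ofReal s := by
  have hδ' : ENNReal.ofReal δ ≠ 0 := by simpa using hδ
  constructor
  · rintro ⟨v, hv, h⟩
    have hv' : ENNReal.ofReal v ≠ 0 := by simpa using hv
    have h0 : ENNReal.ofReal s / (I + ENNReal.ofReal v) ≠ ∞ :=
      ENNReal.div_ne_top ENNReal.ofReal_ne_top (by simp [hv])
    have h1 := (ENNReal.ofReal_le_iff_le_toReal h0).2 h
    rw [ENNReal.le_div_iff_mul_le (Or.inl (by simp [hv])) (Or.inr ENNReal.ofReal_ne_top),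
      mul_add] at h1
    refine lt_of_lt_of_le (ENNReal.lt_add_right ?_ (mul_ne_zero hδ' hv')) h1
    exact ne_top_of_le_ne_top ENNReal.ofReal_ne_top (le_self_add.trans h1)
  · intro h
    have hI : I ≠ ∞ := by
      rintro rfl
      rw [ENNReal.mul_top hδ'] at h
      exact not_top_lt h
    lift I to ℝ≥0 using hI
    have hs : δ * I < s := by
      have h' : ENNReal.ofReal (δ * I) < ENNReal.ofReal s := by
        rwa [ENNReal.ofReal_mul hδ.le, ENNReal.ofReal_coe_nnreal]
      exact (ENNReal.ofReal_lt_ofReal_iff_of_nonneg (by positivity)).1 h'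
    -- This noise level solves s = δ(I + v), so the threshold is met with equality.
    have hv : 0 < (s - δ * I) / δ := div_pos (by linarith) hδ
    refine ⟨(s - δ * I) / δ, hv, le_of_eq ?_⟩
    have h0 : 0 < (I : ℝ) + (s - δ * I) / δ := add_pos_of_nonneg_of_pos I.2 hv
    have hs0 : 0 < s := lt_of_le_of_lt (by positivity) hs
    rw [← ENNReal.ofReal_coe_nnreal, ← ENNReal.ofReal_add I.coe_nonneg hv.le, ← ENNReal.ofReal_div_of_pos h0,
      ENNReal.toReal_ofReal (by positivity),
      show (I : ℝ) + (s - δ * I) / δ = s / δ by field_simp; ring, div_div_cancel₀ hs0.ne']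

theorem Params.δ_pos (p : Params) (l : ℕ) : 0 < p.δ l := by
  have := p.R0_pos
  have := p.W_pos
  have h : (1 : ℝ) < 2 ^ (((l : ℝ) + 1) * (p.R0 / p.W)) :=
    Real.one_lt_rpow (by norm_num) (by positivity)
  unfold Params.δ
  linarith

theorem Params.R0_le_rate_iff (p : Params) (l : ℕ) {y : ℝ} (hy : 0 ≤ y) :
    p.R0 ≤ p.W / ((l + 1 : ℕ) : ℝ) * Real.logb 2 (1 + y) ↔ p.δ l ≤ y := by
  have hW := p.W_pos
  have hl : (0 : ℝ) < (l : ℝ) + 1 := by positivity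
  rw [Params.δ, sub_le_iff_le_add', ← Real.le_logb_iff_rpow_le (by norm_num) (by linarith)]
  push_cast
  rw [div_mul_eq_mul_div, le_div_iff₀ hl, mul_div_assoc', div_le_iff₀ hW, mul_comm p.R0,
    mul_comm p.W]

namespace Network

variable {Ω : Type*} (S : Network Ω) (p : Params)

theorem meanPower_eq (b : Fin 2 × ℕ) (ω : Ω) :
    S.meanPower p b ω = S.T p b.1 b.2 ω ^ (-(p.α / 2)) := by
  have hα : p.α ≠ 0 := by have := p.two_lt_α; linarith
  have hP := p.P_pos b.1
  rw [meanPower, T, Real.mul_rpow (by positivity) (by positivity), ← Real.rpow_mul hP.le,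
    ← Real.rpow_natCast, ← Real.rpow_mul (norm_nonneg _)]
  have h1 : -(2 / p.α) * -(p.α / 2) = 1 := by field_simp
  have h2 : ((2 : ℕ) : ℝ) * -(p.α / 2) = -p.α := by push_cast; ring
  rw [h1, h2, Real.rpow_one]

theorem rxPower_eq (b : Fin 2 × ℕ) (ω : Ω) :
    S.rxPower p b ω = S.meanPower p b ω * S.h b.1 b.2 ω := by
  rw [rxPower, meanPower]; ring

variable {S p} {ω : Ω}

theorem measurableSet_load (S : Network Ω) (k : Fin 2) (l : ℕ) :
    MeasurableSet[S.sigma userSources] {ω | S.L k ω = l} :=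
  S.measurable_source (A := userSources) (s := .load k) (Or.inl ⟨k, rfl⟩)
    (show MeasurableSet {x : ℕ | x = l} from trivial)

theorem meanPower_pos (hT : ∀ i j, 0 < S.T p i j ω) (b : Fin 2 × ℕ) : 0 < S.meanPower p b ω := by
  rw [meanPower_eq]
  exact Real.rpow_pos_of_pos (hT _ _) _

theorem meanPower_le_iff (hT : ∀ i j, 0 < S.T p i j ω) (b c : Fin 2 × ℕ) :
    S.meanPower p c ω ≤ S.meanPower p b ω ↔ S.T p b.1 b.2 ω ≤ S.T p c.1 c.2 ω := by
  have := p.two_lt_α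
  rw [meanPower_eq, meanPower_eq]
  exact Real.rpow_le_rpow_iff_of_neg (hT _ _) (hT _ _) (by linarith)

theorem serves_iff (hT : ∀ i j, 0 < S.T p i j ω) (n : ℕ) (b : Fin 2 × ℕ) :
    S.Serves p n b ω ↔ S.CanDeliver n b ω ∧
      ∀ c, S.CanDeliver n c ω → S.T p b.1 b.2 ω ≤ S.T p c.1 c.2 ω := by
  simp only [Serves, meanPower_le_iff hT]

/-- The quantity (T_b / T_c)^(α/2) is the mean power of c relative to that of b, so the costs are
received powers in units of the mean power of the server. -/
theorem tsum_interfCost (hT : ∀ i j, 0 < S.T p i j ω) {δ : ℝ} (hδ : 0 ≤ δ) (n : ℕ)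
    (b : Fin 2 × ℕ) :
    ∑' c : {c // c ≠ b}, interfCost δ p.α (S.T p b.1 b.2 ω) (S.T p c.1.1 c.1.2 ω)
        ((S.field p n).mark c ω)
      = ENNReal.ofReal δ * S.interference p b ω / ENNReal.ofReal (S.meanPower p b ω) := by
  classical
  have hm := meanPower_pos hT b
  refine (tsum_subtype {c | c ≠ b} fun c => interfCost δ p.α (S.T p b.1 b.2 ω) (S.T p c.1 c.2 ω)
    ((S.field p n).mark c ω)).trans ?_
  rw [div_eq_mul_inv, mul_right_comm, interference,
    ← ENNReal.tsum_mul_left]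
  refine tsum_congr fun c => ?_
  have hmark : ((S.field p n).mark c ω).2.2 = S.Transmits c ω := rfl
  have hmark' : ((S.field p n).mark c ω).1 = S.h c.1 c.2 ω := rfl
  by_cases hc : c = b
  · simp [hc]
  by_cases ht : S.Transmits c ω
  · rw [Set.indicator_of_mem (show c ∈ {c | c ≠ b} from hc),
      Set.indicator_of_mem (show c ∈ {c | c ≠ b ∧ S.Transmits c ω} from ⟨hc, ht⟩), interfCost,
      hmark, if_pos ht, hmark', rxPower_eq, ENNReal.ofReal_mul (meanPower_pos hT c).le,
      ← ENNReal.ofReal_inv_of_pos hm]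
    have hratio : δ * (S.T p b.1 b.2 ω / S.T p c.1 c.2 ω) ^ (p.α / 2)
        = δ * (S.meanPower p b ω)⁻¹ * S.meanPower p c ω := by
      rw [meanPower_eq, meanPower_eq, Real.rpow_neg (hT _ _).le, Real.rpow_neg (hT _ _).le, inv_inv,
        Real.div_rpow (hT _ _).le (hT _ _).le]
      ring
    rw [hratio, ENNReal.ofReal_mul (by positivity), ENNReal.ofReal_mul hδ, mul_assoc]
  · rw [Set.indicator_of_notMem (show c ∉ {c | c ≠ b ∧ S.Transmits c ω} from fun h => ht h.2),
      Set.indicator_of_mem (show c ∈ {c | c ≠ b} from hc), interfCost, hmark, if_neg ht, mul_zero]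

theorem mem_good_iff (hT : ∀ i j, 0 < S.T p i j ω) {δ : ℝ} (hδ : 0 ≤ δ) (n : ℕ)
    (b : Fin 2 × ℕ) :
    ω ∈ (S.field p n).good δ p.α b ↔ S.Serves p n b ω ∧
      ENNReal.ofReal δ * S.interference p b ω < ENNReal.ofReal (S.rxPower p b ω) := by
  have hm := meanPower_pos hT b
  rw [serves_iff hT, and_assoc, rxPower_eq, ENNReal.ofReal_mul hm.le, mul_comm (ENNReal.ofReal (S.meanPower p b ω)),
    ← ENNReal.div_lt_iff (Or.inl (by simpa using hm)) (Or.inl ENNReal.ofReal_ne_top),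
    ← tsum_interfCost hT hδ n b]
  rfl

theorem sinr_anti {v v' : ℝ} (hv : 0 < v) (hvv : v ≤ v') (b : Fin 2 × ℕ) :
    S.sinr p v' b ω ≤ S.sinr p v b ω := by
  refine ENNReal.toReal_mono (ENNReal.div_ne_top ENNReal.ofReal_ne_top (by simp [hv])) ?_
  gcongr

theorem R0_le_accessRate_iff (v : ℝ) (b : Fin 2 × ℕ) :
    p.R0 ≤ S.accessRate p v b ω ↔ ∃ l, S.L b.1 ω = l + 1 ∧ p.δ l ≤ S.sinr p v b ω := by
  rw [accessRate]
  -- A load 0 makes the rate W/0 · log = 0, which is below the demand.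
  rcases hL : S.L b.1 ω with _ | l
  · simp [p.R0_pos]
  · rw [p.R0_le_rate_iff l (y := S.sinr p v b ω) ENNReal.toReal_nonneg]
    constructor
    · exact fun h => ⟨l, rfl, h⟩
    · rintro ⟨l', h, h'⟩
      rwa [Nat.succ_injective h]

theorem accessEvent_anti {v v' : ℝ} (hv : 0 < v) (hvv : v ≤ v') (n : ℕ) (k : Fin 2) :
    S.accessEvent p v' n k ⊆ S.accessEvent p v n k := by
  rintro ω ⟨j, hj, h⟩
  refine ⟨j, hj, ?_⟩
  rw [R0_le_accessRate_iff] at h ⊢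
  obtain ⟨l, hl, h⟩ := h
  exact ⟨l, hl, h.trans (sinr_anti hv hvv _)⟩

theorem mem_iUnion_accessEvent_iff (hT : ∀ i j, 0 < S.T p i j ω) (n : ℕ) (k : Fin 2) :
    ω ∈ ⋃ v > 0, S.accessEvent p v n k ↔
      ∃ l, S.L k ω = l + 1 ∧ ω ∈ sirEvent S p n k (p.δ l) := by
  simp only [Set.mem_iUnion, accessEvent, Set.mem_ofPred_eq, R0_le_accessRate_iff, sirEvent,
    mem_good_iff hT (p.δ_pos _).le, exists_prop]
  constructor
  · rintro ⟨v, hv, j, hj, l, hl, h⟩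
    exact ⟨l, hl, j, hj, (exists_noise_le_toReal_div (p.δ_pos l) _).1 ⟨v, hv, h⟩⟩
  · rintro ⟨l, hl, j, hj, h⟩
    obtain ⟨v, hv, h⟩ := (exists_noise_le_toReal_div (p.δ_pos l) _).2 h
    exact ⟨v, hv, j, hj, l, hl, h⟩

namespace IsModel

variable [mΩ : MeasurableSpace Ω] {μ : Measure Ω} [IsProbabilityMeasure μ]

theorem ae_T_pos (hS : S.IsModel p μ) : ∀ᵐ ω ∂μ, ∀ i j, 0 < S.T p i j ω :=
  (hS.field_isModel 0).ae_pos

theorem ae_h_pos (hS : S.IsModel p μ) : ∀ᵐ ω ∂μ, ∀ i j, 0 < S.h i j ω := by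
  simp_rw [ae_all_iff]
  intro i j
  have hm : Measurable (S.h i j) := hS.measurable (.fade i j)
  have h := expMeasure_tail 0
  rw [← hS.fading i j, expNeg_zero] at h
  have hs : {x : ℝ | 0 < ENNReal.ofReal x} = Set.Ioi 0 := by ext x; simp
  rw [hs, Measure.map_apply hm measurableSet_Ioi] at h
  exact (mem_ae_iff_prob_eq_one (hm measurableSet_Ioi)).2 h

/-- The probability that tier `k` serves the user. -/
theorem measureReal_serves (hS : S.IsModel p μ) (n : ℕ) (k : Fin 2) :
    μ.real {ω | ∃ j, S.Serves p n (k, j) ω} = μ.real (sirEvent S p n k 0) := by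
  refine measureReal_congr ?_
  filter_upwards [hS.ae_T_pos, hS.ae_h_pos] with ω hT hh
  refine propext (exists_congr fun j => ?_)
  -- At δ = 0 the ratio condition only asks for a positive received power, which holds almost
  -- surely.
  rw [mem_good_iff hT le_rfl, rxPower_eq]
  have : 0 < S.meanPower p (k, j) ω * S.h k j ω := mul_pos (meanPower_pos hT _) (hh k j)
  simp [this]

theorem G_zero (y : ℝ) : G 0 y = 0 := by simp [G]

theorem H_zero {y : ℝ} (hy : 2 < y) : H 0 y = 0 := by
  rw [H, Real.zero_rpow (div_pos two_pos (by linarith)).ne']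
  simp

theorem measureReal_serves_of_notMem (hS : S.IsModel p μ) {n : ℕ} (hn : n ∉ p.groupLp) :
    μ.real {ω | ∃ j, S.Serves p n (0, j) ω} = 1 := by
  rw [hS.measureReal_serves, hS.measureReal_sirEvent_of_notMem hn le_rfl, G_zero, H_zero p.two_lt_α]
  simp

theorem measureReal_serves_groupLp (hS : S.IsModel p μ) {n : ℕ} (hn : n ∈ p.groupLp) (k : Fin 2) :
    μ.real {ω | ∃ j, S.Serves p n (k, j) ω} = p.ALp k := by
  rw [hS.measureReal_serves, hS.measureReal_sirEvent_groupLp hn k le_rfl, G_zero,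
    H_zero p.two_lt_α, mul_zero, mul_zero, zero_add, zero_add, Params.ζ, inv_div, Params.ALp,
    Fin.sum_univ_two]
  simp [Params.lamEq]

/-- Contributions of the loads to the limiting access probability, on an event determined by the
loads and the backhaul. -/
theorem hasSum_accessEvent_inter (hS : S.IsModel p μ) (n : ℕ) (k : Fin 2) {Z : Set Ω}
    (hZ : MeasurableSet[S.sigma userSources] Z) :
    HasSum (fun l => μ.real (sirEvent S p n k (p.δ l)) * μ.real ({ω | S.L k ω = l + 1} ∩ Z))
      (μ.real (⋃ v > 0, S.accessEvent p v n k ∩ Z)) := by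
  have hZl : ∀ l, MeasurableSet[S.sigma userSources] ({ω | S.L k ω = l + 1} ∩ Z) := fun l =>
    @MeasurableSet.inter _ (S.sigma userSources) _ _ (measurableSet_load S k (l + 1)) hZ
  -- Read backwards, independence turns each term into the probability of one piece of a partition
  -- by the load.
  simp_rw [← fun l => hS.measureReal_sirEvent_inter n k (p.δ l) (hZl l)]
  have h := hasSum_measureReal_iUnion (μ := μ)
    (f := fun l => sirEvent S p n k (p.δ l) ∩ ({ω | S.L k ω = l + 1} ∩ Z)) ?_ ?_
  · convert h using 1
    refine measureReal_congr ?_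
    filter_upwards [hS.ae_T_pos] with ω hT
    have := mem_iUnion_accessEvent_iff hT n k
    refine propext ?_
    change (ω ∈ ⋃ v > 0, S.accessEvent p v n k ∩ Z) ↔ ω ∈ ⋃ l, _
    simp only [Set.mem_iUnion, Set.mem_inter_iff, exists_prop, Set.mem_ofPred_eq] at this ⊢
    constructor
    · rintro ⟨v, hv, h, hz⟩
      obtain ⟨l, hl, h⟩ := this.1 ⟨v, hv, h⟩
      exact ⟨l, h, hl, hz⟩
    · rintro ⟨l, h, hl, hz⟩
      obtain ⟨v, hv, h⟩ := this.2 ⟨l, hl, h⟩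
      exact ⟨v, hv, h, hz⟩
  · intro l l' hne
    refine Set.disjoint_left.2 ?_
    rintro ω ⟨-, h, -⟩ ⟨-, h', -⟩
    exact hne (Nat.succ_injective (h.symm.trans h'))
  · exact fun l => (hS.sigma_le _ _ (measurableSet_sirEvent S p n k _)).inter
      (hS.sigma_le _ _ (hZl l))

end IsModel

end Network

/-! ### The load distribution -/

/-- Both sides are Γ(s) times the rising factorial s(s+1)⋯(s+l-1). -/
theorem Gamma_nat_add_eq_choose {s : ℝ} (hs : 0 < s) (l : ℕ) :
    Real.Gamma (l + s) = l.factorial * Ring.choose (s + l - 1) l * Real.Gamma s := by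
  have h1 : (l.factorial : ℝ) * Ring.choose (s + l - 1) l = (ascPochhammer ℝ l).eval s := by
    have h := Ring.factorial_nsmul_multichoose_eq_ascPochhammer s l
    rw [nsmul_eq_mul, Ring.multichoose_eq, Polynomial.ascPochhammer_smeval_eq_eval] at h
    exact h
  rw [h1]
  clear h1
  induction l with
  | zero => simp
  | succ l ih =>
    rw [ascPochhammer_succ_eval, Nat.cast_succ, show (l : ℝ) + 1 + s = l + s + 1 by ring,
      Real.Gamma_add_one (by positivity), ih]
    ring

/-- Negative binomial series. -/
theorem hasSum_Gamma_mul_pow {s x : ℝ} (hs : 0 < s) (hx : |x| < 1) :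
    HasSum (fun l : ℕ => Real.Gamma (l + s) / l.factorial * x ^ l)
      (Real.Gamma s * (1 - x) ^ (-s)) := by
  have h := (Real.one_div_one_sub_rpow_hasFPowerSeriesOnBall_zero s).hasSum
    (y := x) (by simpa [enorm_eq_nnnorm, ← NNReal.coe_lt_coe] using hx)
  have h1 := h.mul_left (Real.Gamma s)
  have hx1 : 0 ≤ 1 - x := by linarith [le_abs_self x]
  rw [zero_add, one_div, ← Real.rpow_neg hx1] at h1
  refine (congrArg (HasSum · _) (funext fun l => ?_)).mpr h1
  rw [Gamma_nat_add_eq_choose hs, FormalMultilinearSeries.ofScalars_apply_eq, smul_eq_mul]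
  have : (l.factorial : ℝ) ≠ 0 := by positivity
  field_simp

namespace Params

variable (p : Params)

theorem groupLp_nonempty : p.groupLp.Nonempty := by
  have := p.N2_pos
  have := p.N2_le
  exact ⟨p.N, by simp only [groupLp, Finset.mem_Ioc]; omega⟩

theorem q_pos {n : ℕ} (hn : n ∈ Finset.Icc 1 p.N) : 0 < p.q n := by
  have h : ∀ k ∈ Finset.Icc 1 p.N, 0 < (k : ℝ) ^ (-p.γ) := fun k hk =>
    Real.rpow_pos_of_pos (by exact_mod_cast (Finset.mem_Icc.1 hk).1) _
  exact div_pos (h n hn) (Finset.sum_pos h ⟨n, hn⟩)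

theorem groupMp_subset : p.groupMp ⊆ Finset.Icc 1 p.N :=
  Finset.Icc_subset_Icc_right (by have := p.N2_le; omega)

theorem groupLp_subset : p.groupLp ⊆ Finset.Icc 1 p.N := fun n hn => by
  simp only [groupLp, Finset.mem_Ioc, Finset.mem_Icc] at hn ⊢
  omega

theorem QMp_nonneg : 0 ≤ p.QMp :=
  Finset.sum_nonneg fun _ hn => (p.q_pos (p.groupMp_subset hn)).le

theorem QLp_pos : 0 < p.QLp :=
  Finset.sum_pos (fun _ hn => p.q_pos (p.groupLp_subset hn)) p.groupLp_nonempty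

theorem pLp_pos : 0 < p.pLp := by
  have h1 : (p.NMp : ℝ) + p.N2 ≤ p.N := by exact_mod_cast p.N2_le
  have h2 : (0 : ℝ) < p.N2 := by exact_mod_cast p.N2_pos
  exact div_pos h2 (by linarith)

theorem ALp_pos (k : Fin 2) : 0 < p.ALp k := by
  have h : ∀ i, 0 < p.lamEq i * p.P i ^ (2 / p.α) := by
    intro i
    refine mul_pos ?_ (Real.rpow_pos_of_pos (p.P_pos i) _)
    fin_cases i
    · exact p.lam_pos 0
    · exact mul_pos p.pLp_pos (p.lam_pos 1)
  exact div_pos (h k) (Finset.sum_pos (fun i _ => h i) Finset.univ_nonempty)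

theorem A_pos (k : Fin 2) : 0 < p.A k := by
  have h := fun k => mul_pos p.QLp_pos (p.ALp_pos k)
  fin_cases k
  · exact add_pos_of_nonneg_of_pos p.QMp_nonneg (h 0)
  · exact h 1

theorem loadPMF_pos (k : Fin 2) (l : ℕ) : 0 < p.loadPMF k l := by
  have h1 : 0 < p.A k * p.lamU / p.lam k := div_pos (mul_pos (p.A_pos k) p.lamU_pos) (p.lam_pos k)
  have h2 : 0 < Real.Gamma ((l : ℝ) + 4.5) := Real.Gamma_pos_of_pos (by positivity)
  have h3 : 0 < Real.Gamma 3.5 := Real.Gamma_pos_of_pos (by norm_num)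
  unfold loadPMF
  positivity

/-- Negative binomial series with exponent 4.5 at x = a/(3.5 + a), where 1 - x = 3.5/(3.5 + a). The
powers of 3.5 + a cancel, and so do those of 3.5 since Γ(4.5) = 3.5 Γ(3.5). -/
theorem hasSum_loadPMF (k : Fin 2) : HasSum (p.loadPMF k) 1 := by
  have ha : 0 < p.A k * p.lamU / p.lam k := div_pos (mul_pos (p.A_pos k) p.lamU_pos) (p.lam_pos k)
  unfold loadPMF
  generalize p.A k * p.lamU / p.lam k = a at ha
  have hb : 0 < 3.5 + a := by positivity
  have hx : |a / (3.5 + a)| < 1 := by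
    rw [abs_of_pos (by positivity), div_lt_one hb]
    linarith
  have hΓ : 0 < Real.Gamma 3.5 := Real.Gamma_pos_of_pos (by norm_num)
  have hΓ' : Real.Gamma 4.5 = 3.5 * Real.Gamma 3.5 := by
    rw [← Real.Gamma_add_one (by norm_num)]; norm_num
  have h := (hasSum_Gamma_mul_pow (s := 4.5) (by norm_num) hx).mul_left
    ((3.5 : ℝ) ^ (3.5 : ℝ) / Real.Gamma 3.5 * (3.5 + a) ^ (-4.5 : ℝ))
  have h1 : 1 - a / (3.5 + a) = 3.5 / (3.5 + a) := by field_simp; ring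
  have h2 : (3.5 : ℝ) ^ (3.5 : ℝ) / Real.Gamma 3.5 * (3.5 + a) ^ (-4.5 : ℝ) *
      (Real.Gamma 4.5 * (1 - a / (3.5 + a)) ^ (-4.5 : ℝ)) = 1 := by
    rw [h1, hΓ', Real.div_rpow (by norm_num) hb.le]
    have h3 : (3.5 : ℝ) ^ (3.5 : ℝ) * 3.5 * (3.5 : ℝ) ^ (-4.5 : ℝ) = 1 := by
      nth_rewrite 3 [← Real.rpow_one 3.5]
      rw [← Real.rpow_add (by norm_num), ← Real.rpow_add (by norm_num)]
      norm_num
    have h4 : (3.5 + a) ^ (-4.5 : ℝ) ≠ 0 := by positivity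
    field_simp
    linarith
  rw [h2] at h
  refine (congrArg (HasSum · _) (funext fun l => ?_)).mpr h
  rw [neg_add, Real.rpow_add hb, Real.rpow_neg hb.le (l : ℝ), Real.rpow_natCast, div_pow]
  field_simp

end Params

/-! ### The backhaul link -/

theorem volume_real_mul_le {m c : ℝ} (hm : 0 < m) (hc : 0 ≤ c) :
    (volume.restrict (Set.Icc (0 : ℝ) 1)).real {u | u * m ≤ c} = min 1 (c / m) := by
  have h1 : {u : ℝ | u * m ≤ c} ∩ Set.Icc 0 1 = Set.Icc 0 (min 1 (c / m)) := by
    ext u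
    simp only [Set.mem_inter_iff, Set.mem_ofPred_eq, Set.mem_Icc, le_min_iff, le_div_iff₀ hm]
    tauto
  have hms : MeasurableSet {u : ℝ | u * m ≤ c} :=
    measurableSet_le (by fun_prop) measurable_const
  rw [measureReal_def, Measure.restrict_apply hms, h1, Real.volume_Icc, sub_zero,
    ENNReal.toReal_ofReal (le_min zero_le_one (by positivity))]

namespace Network

variable {Ω : Type*} {S : Network Ω} {p : Params} {ω : Ω}

theorem mem_backhaulEvent_iff :
    ω ∈ S.backhaulEvent p ↔ S.U ω * ((S.otherMisses ω : ℝ) + 1) ≤ p.Nb := by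
  change p.R0 ≤ S.backhaulRate p ω ↔ _
  rw [backhaulRate, Set.indicator_apply]
  change p.R0 ≤ (if S.U ω * ((S.otherMisses ω : ℝ) + 1) ≤ p.Nb then p.R0 else 0) ↔ _
  split_ifs with h
  · simp [h]
  · simp [h, p.R0_pos]

theorem otherMisses_eq_card {l : ℕ} (hl : S.L 0 ω = l + 1) :
    S.otherMisses ω = (Finset.univ.filter fun k : Fin l => S.miss k ω = true).card := by
  have : {k | k + 1 < S.L 0 ω ∧ S.miss k ω = true}
      = Fin.val '' ((Finset.univ.filter fun k : Fin l => S.miss k ω = true : Finset (Fin l)) :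
        Set (Fin l)) := by
    ext k
    simp only [hl, Set.mem_ofPred_eq, Set.mem_image, Finset.coe_filter, Finset.mem_univ, true_and]
    constructor
    · rintro ⟨h, h'⟩
      exact ⟨⟨k, by omega⟩, h', rfl⟩
    · rintro ⟨i, h, rfl⟩
      exact ⟨by omega, h⟩
  rw [otherMisses, this, Set.ncard_image_of_injective _ Fin.val_injective, Set.ncard_coe_finset]

/-- The load is `l + 1`, and the users numbered by `s` are the other users in need of the backhaul
link. -/
def missPattern (S : Network Ω) (l : ℕ) (s : Finset (Fin l)) : Set Ω :=
  {ω | S.L 0 ω = l + 1 ∧ ∀ k : Fin l, S.miss k ω = decide (k ∈ s)}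

/-- Splitting by the exact set of other users in need, not just by their number, makes every piece a
finite intersection of events of distinct sources. -/
theorem iUnion_missPattern_inter (S : Network Ω) (p : Params) (l : ℕ) :
    {ω | S.L 0 ω = l + 1} ∩ S.backhaulEvent p
      = ⋃ s ∈ (Finset.univ : Finset (Finset (Fin l))),
        S.missPattern l s ∩ {ω | S.U ω * ((s.card : ℝ) + 1) ≤ p.Nb} := by
  ext ω
  simp only [Set.mem_inter_iff, Set.mem_ofPred_eq, mem_backhaulEvent_iff, Finset.mem_univ,
    Set.iUnion_true, Set.mem_iUnion, missPattern]
  constructor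
  · rintro ⟨hl, h⟩
    rw [otherMisses_eq_card hl] at h
    exact ⟨_, ⟨hl, fun k => by simp⟩, h⟩
  · rintro ⟨s, ⟨hl, hs⟩, h⟩
    refine ⟨hl, ?_⟩
    rw [otherMisses_eq_card hl]
    simpa [hs] using h

theorem measurableSet_missPattern_inter [MeasurableSpace Ω] (hL : Measurable (S.L 0))
    (hmiss : ∀ k, Measurable (S.miss k)) (hU : Measurable S.U) (c : ℝ) (l : ℕ)
    (s : Finset (Fin l)) :
    MeasurableSet (S.missPattern l s ∩ {ω | S.U ω * ((s.card : ℝ) + 1) ≤ c}) := by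
  refine MeasurableSet.inter (MeasurableSet.inter (hL (measurableSet_singleton _)) ?_)
    (measurableSet_le (by fun_prop) measurable_const)
  have : {ω | ∀ k : Fin l, S.miss k ω = decide (k ∈ s)}
      = ⋂ k : Fin l, S.miss k ⁻¹' {decide (k ∈ s)} := by
    ext ω; simp
  change MeasurableSet {ω | ∀ k : Fin l, S.miss k ω = decide (k ∈ s)}
  rw [this]
  exact MeasurableSet.iInter fun k => hmiss k (measurableSet_singleton _)

theorem otherMisses_of_load_eq_zero (h : S.L 0 ω = 0) : S.otherMisses ω = 0 := by
  simp [otherMisses, h]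

/-- The σ-algebra is left arbitrary so that the result serves both the ambient one and the one
generated by the user sources. -/
theorem measurableSet_backhaulEvent_of_measurable [MeasurableSpace Ω] (hL : Measurable (S.L 0))
    (hmiss : ∀ k, Measurable (S.miss k)) (hU : Measurable S.U) (p : Params) :
    MeasurableSet (S.backhaulEvent p) := by
  have : S.backhaulEvent p = ({ω | S.L 0 ω = 0} ∩ {ω | S.U ω ≤ p.Nb}) ∪
      ⋃ l : ℕ, ({ω | S.L 0 ω = l + 1} ∩ S.backhaulEvent p) := by
    ext ω
    rcases hL0 : S.L 0 ω with _ | l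
    · simp [hL0, mem_backhaulEvent_iff, otherMisses_of_load_eq_zero hL0]
    · simp [hL0]
  rw [this]
  refine MeasurableSet.union ((hL (measurableSet_singleton 0)).inter
    (measurableSet_le hU measurable_const)) (MeasurableSet.iUnion fun l => ?_)
  rw [iUnion_missPattern_inter]
  exact Finset.measurableSet_biUnion _ fun s _ =>
    measurableSet_missPattern_inter hL hmiss hU p.Nb l s

theorem measurableSet_backhaulEvent (S : Network Ω) (p : Params) :
    MeasurableSet[S.sigma userSources] (S.backhaulEvent p) :=
  @measurableSet_backhaulEvent_of_measurable Ω S (S.sigma userSources)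
    (S.measurable_source (s := .load 0) (Or.inl ⟨0, rfl⟩))
    (fun k => S.measurable_source (s := .miss k) (Or.inr (Or.inl ⟨k, rfl⟩)))
    (S.measurable_source (s := .sched) (Or.inr (Or.inr rfl))) p

namespace IsModel

variable [mΩ : MeasurableSpace Ω] {μ : Measure Ω}

theorem measurable_load (hS : S.IsModel p μ) (k : Fin 2) : Measurable (S.L k) :=
  hS.measurable (.load k)

theorem measurable_miss (hS : S.IsModel p μ) (k : ℕ) : Measurable (S.miss k) :=
  hS.measurable (.miss k)

theorem measurable_sched (hS : S.IsModel p μ) : Measurable S.U :=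
  hS.measurable .sched

theorem measureReal_sched (hS : S.IsModel p μ) (m : ℕ) :
    μ.real {ω | S.U ω * ((m : ℝ) + 1) ≤ p.Nb} = min 1 (p.Nb / ((m : ℝ) + 1)) := by
  have hN : 0 ≤ p.Nb := (div_pos p.Cb_pos p.R0_pos).le
  have hms : MeasurableSet {u : ℝ | u * ((m : ℝ) + 1) ≤ p.Nb} :=
    measurableSet_le (by fun_prop) measurable_const
  rw [← volume_real_mul_le (by positivity) hN, ← hS.sched_law,
    map_measureReal_apply hS.measurable_sched hms]
  rfl

theorem measurableSet_load_eq (hS : S.IsModel p μ) (k : Fin 2) (l : ℕ) :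
    MeasurableSet {ω | S.L k ω = l} :=
  hS.measurable_load k (measurableSet_singleton l)

variable [IsProbabilityMeasure μ]

theorem measureReal_miss_eq (hS : S.IsModel p μ) (k : ℕ) (b : Bool) :
    μ.real {ω | S.miss k ω = b} = if b then p.pb else 1 - p.pb := by
  have h := hS.miss_prob k
  cases b
  · have hc : {ω | S.miss k ω = false} = {ω | S.miss k ω = true}ᶜ := by ext ω; simp
    have hm : MeasurableSet {ω | S.miss k ω = true} :=
      hS.measurable_miss k (measurableSet_singleton true)
    rw [hc, probReal_compl_eq_one_sub hm, h]
    simp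
  · simpa using h

/-- Sources relevant to the backhaul at load `l + 1`. -/
def backhaulSource (l : ℕ) : Option (Option (Fin l)) → Source
  | none => .load 0
  | some none => .sched
  | some (some k) => .miss k

theorem backhaulSource_injective (l : ℕ) : Function.Injective (backhaulSource l) := by
  rintro (_ | _ | k) (_ | _ | k') h <;> simp_all [backhaulSource, Fin.ext_iff]

theorem measureReal_missPattern_inter (hS : S.IsModel p μ) (l : ℕ) (s : Finset (Fin l)) :
    μ.real (S.missPattern l s ∩ {ω | S.U ω * ((s.card : ℝ) + 1) ≤ p.Nb})
      = p.loadPMF 0 l * ((1 - p.pb) ^ (l - s.card) * p.pb ^ s.card *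
        min 1 (p.Nb / ((s.card : ℝ) + 1))) := by
  set E : Option (Option (Fin l)) → Set Ω := fun i => match i with
    | none => {ω | S.L 0 ω = l + 1}
    | some none => {ω | S.U ω * ((s.card : ℝ) + 1) ≤ p.Nb}
    | some (some k) => {ω | S.miss k ω = decide (k ∈ s)} with hE
  have hset : S.missPattern l s ∩ {ω | S.U ω * ((s.card : ℝ) + 1) ≤ p.Nb} = ⋂ i, E i := by
    ext ω
    simp only [Set.mem_iInter, Option.forall, hE, missPattern, Set.mem_inter_iff,
      Set.mem_ofPred_eq]
    tauto
  have hind := hS.indep.precomp (backhaulSource_injective l)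
  have h := hind.meas_iInter (s := E) ?_
  · rw [hset, measureReal_def, h, Fintype.prod_option, Fintype.prod_option, ENNReal.toReal_mul,
      ENNReal.toReal_mul, ENNReal.toReal_prod]
    change μ.real {ω | S.L 0 ω = l + 1} * (μ.real {ω | S.U ω * ((s.card : ℝ) + 1) ≤ p.Nb} *
      ∏ k : Fin l, μ.real {ω | S.miss k ω = decide (k ∈ s)}) = _
    rw [hS.load_law, hS.measureReal_sched]
    simp_rw [hS.measureReal_miss_eq, decide_eq_true_eq]
    rw [Finset.prod_ite, Finset.prod_const, Finset.prod_const, Finset.filter_mem_eq_inter,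
      Finset.univ_inter, Finset.filter_not, Finset.filter_mem_eq_inter, Finset.univ_inter,
      ← Finset.compl_eq_univ_sdiff, Finset.card_compl, Fintype.card_fin]
    ring
  · rintro (_ | _ | k)
    · exact ⟨{x : ℕ | x = l + 1}, trivial, rfl⟩
    · exact ⟨{u : ℝ | u * ((s.card : ℝ) + 1) ≤ p.Nb},
        measurableSet_le (by fun_prop) measurable_const, rfl⟩
    · exact ⟨{b : Bool | b = decide (k ∈ s)}, trivial, rfl⟩

/-- Joint probability of the load and of a sufficient backhaul rate. -/
theorem measureReal_load_inter_backhaul (hS : S.IsModel p μ) (l : ℕ) :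
    μ.real ({ω | S.L 0 ω = l + 1} ∩ S.backhaulEvent p) = p.loadPMF 0 l * p.sbdp l := by
  rw [iUnion_missPattern_inter, measureReal_biUnion_finset]
  · simp_rw [hS.measureReal_missPattern_inter]
    -- The probability of a pattern depends only on its size, so grouping patterns by size produces
    -- the binomial coefficients.
    rw [← Finset.mul_sum, ← Finset.powerset_univ, Params.sbdp,
      Finset.sum_powerset_apply_card (fun m => (1 - p.pb) ^ (l - m) * p.pb ^ m *
        min 1 (p.Nb / ((m : ℝ) + 1)))]
    rw [Finset.card_univ, Fintype.card_fin]
    congr 1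
    refine Finset.sum_congr rfl fun m _ => ?_
    rw [nsmul_eq_mul]
    ring
  · intro s _ s' _ hne
    refine Set.disjoint_left.2 ?_
    rintro ω ⟨⟨-, h⟩, -⟩ ⟨⟨-, h'⟩, -⟩
    refine hne (Finset.ext fun k => ?_)
    have := (h k).symm.trans (h' k)
    simpa using this
  · exact fun s _ => measurableSet_missPattern_inter (hS.measurable_load 0) hS.measurable_miss
      hS.measurable_sched p.Nb l s

/-- The law is prescribed at the values l + 1 only, but these probabilities add up to 1, so load 0
is null. -/
theorem ae_load_pos (hS : S.IsModel p μ) (k : Fin 2) : ∀ᵐ ω ∂μ, ω ∈ ⋃ l : ℕ, {ω | S.L k ω = l + 1} := by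
  have hd : Pairwise (Function.onFun Disjoint fun l : ℕ => {ω | S.L k ω = l + 1}) := by
    intro l l' hne
    refine Set.disjoint_left.2 fun ω h h' => hne (Nat.succ_injective ?_)
    exact h.symm.trans h'
  have hm : ∀ l : ℕ, MeasurableSet {ω | S.L k ω = l + 1} := fun l =>
    hS.measurableSet_load_eq k (l + 1)
  have h := hasSum_measureReal_iUnion (μ := μ) hd hm
  simp_rw [hS.load_law] at h
  have h1 := h.unique (p.hasSum_loadPMF k)
  refine (mem_ae_iff_prob_eq_one (MeasurableSet.iUnion hm)).2 ?_
  rw [← ofReal_measureReal, h1, ENNReal.ofReal_one]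

theorem hasSum_backhaul (hS : S.IsModel p μ) :
    HasSum (fun l => p.loadPMF 0 l * p.sbdp l) (μ.real (S.backhaulEvent p)) := by
  have hb := measurableSet_backhaulEvent_of_measurable (hS.measurable_load 0) hS.measurable_miss
    hS.measurable_sched p
  have h := hasSum_measureReal_iUnion (μ := μ)
    (f := fun l : ℕ => {ω | S.L 0 ω = l + 1} ∩ S.backhaulEvent p) ?_ fun l =>
      (hS.measurableSet_load_eq 0 (l + 1)).inter hb
  · simp_rw [hS.measureReal_load_inter_backhaul] at h
    convert h using 1
    rw [← Set.iUnion_inter]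
    refine measureReal_congr ?_
    filter_upwards [hS.ae_load_pos 0] with ω hω
    exact propext ⟨fun h => ⟨hω, h⟩, fun h => h.2⟩
  · intro l l' hne
    refine Set.disjoint_left.2 ?_
    rintro ω ⟨h, -⟩ ⟨h', -⟩
    exact hne (Nat.succ_injective (h.symm.trans h'))

theorem cond_real_backhaul (hS : S.IsModel p μ) (l : ℕ) :
    (cond μ {ω | S.L 0 ω = l + 1}).real (S.backhaulEvent p) = p.sbdp l := by
  have hpos := p.loadPMF_pos 0 l
  rw [measureReal_def, cond_apply (hS.measurableSet_load_eq 0 (l + 1)), ENNReal.toReal_mul,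
    ENNReal.toReal_inv, ← measureReal_def, ← measureReal_def, hS.load_law,
    hS.measureReal_load_inter_backhaul, inv_mul_cancel_left₀ hpos.ne']

end IsModel

end Network

/-! ### Almost surely no ties between the tiers -/

namespace Field.IsModel

variable {Ω : Type*} {S : Field Ω} [MeasurableSpace Ω] {a π ρ : Fin 2 → ℝ} {μ : Measure Ω}
  [IsProbabilityMeasure μ]

theorem map_T_singleton (hS : S.IsModel a π ρ μ) (i : Fin 2) (j : ℕ) (t : ℝ) :
    μ.map (S.T i j) {t} = 0 := by
  have h0 : (ENNReal.ofReal (a i) • volume.restrict (Set.Ioi (0 : ℝ))) {t} = 0 := by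
    rw [Measure.smul_apply, measure_singleton, smul_zero]
  have h1 := (hS.poisson i).count_law {t} (measurableSet_singleton t) (by simp [h0]) 0
  rw [h0, poissonMeasure_singleton] at h1
  have hm : MeasurableSet {ω | count (fun j => S.T i j ω) {t} = 0} :=
    (hS.poisson i).measurable_count (measurableSet_singleton t) (measurableSet_singleton 0)
  have h2 : ∀ᵐ ω ∂μ, ω ∈ {ω | count (fun j => S.T i j ω) {t} = 0} := by
    refine (mem_ae_iff_prob_eq_one (μ := μ) hm).2 ?_
    simpa using h1
  rw [Measure.map_apply (hS.meas.T i j) (measurableSet_singleton t)]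
  refine measure_mono_null (t := {ω | ω ∉ {ω | count (fun j => S.T i j ω) {t} = 0}}) ?_ h2
  intro ω hω h
  have : j ∈ {j | S.T i j ω ∈ ({t} : Set ℝ)} := hω
  rw [Set.encard_eq_zero.1 h] at this
  exact this

/-- The two positions are independent and have no atoms, so by Fubini their joint law does not
charge the diagonal. Since serving allows ties, this is what makes service by the two tiers
disjoint. -/
theorem ae_T_ne (hS : S.IsModel a π ρ μ) : ∀ᵐ ω ∂μ, ∀ j j', S.T 0 j ω ≠ S.T 1 j' ω := by
  simp_rw [ae_all_iff]
  intro j j'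
  have hind : IndepFun (S.T 0 j) (S.T 1 j') μ :=
    (hS.indep_tiers.indepFun (show (0 : Fin 2) ≠ 1 by decide)).comp
      (measurable_pi_apply j) (measurable_pi_apply j')
  have h0 := hS.meas.T 0 j
  have h1 := hS.meas.T 1 j'
  have hprod := (indepFun_iff_map_prod_eq_prod_map_map h0.aemeasurable h1.aemeasurable).1 hind
  have hd : MeasurableSet {x : ℝ × ℝ | x.1 = x.2} := measurableSet_eq_fun measurable_fst measurable_snd
  have hnull : μ.map (fun ω => (S.T 0 j ω, S.T 1 j' ω)) {x : ℝ × ℝ | x.1 = x.2} = 0 := by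
    rw [hprod, Measure.prod_apply hd]
    refine (lintegral_congr fun x => ?_).trans lintegral_zero
    have : Prod.mk x ⁻¹' {x : ℝ × ℝ | x.1 = x.2} = {x} := by ext y; simp [eq_comm]
    rw [this, hS.map_T_singleton]
  rw [Measure.map_apply (h0.prodMk h1) hd] at hnull
  refine measure_mono_null (fun ω hω => ?_) hnull
  exact not_not.1 hω

end Field.IsModel

/-! ### Success events and their limits -/

namespace Network

variable {Ω : Type*} {S : Network Ω} {p : Params} {ω : Ω}

theorem successEvent_anti {v v' : ℝ} (hv : 0 < v) (hvv : v ≤ v') (n : ℕ) :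
    S.successEvent p v' n ⊆ S.successEvent p v n := by
  rintro ω ⟨b, hb, h, hbh⟩
  refine ⟨b, hb, ?_, hbh⟩
  rw [R0_le_accessRate_iff] at h ⊢
  obtain ⟨l, hl, h⟩ := h
  exact ⟨l, hl, h.trans (sinr_anti hv hvv _)⟩

theorem successEvent_of_mem {n : ℕ} (hn : n ∈ p.groupLp) (v : ℝ) :
    S.successEvent p v n
      = (S.accessEvent p v n 0 ∩ S.backhaulEvent p) ∪ S.accessEvent p v n 1 := by
  ext ω
  simp only [successEvent, accessEvent, Set.mem_union, Set.mem_inter_iff, Set.mem_ofPred_eq,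
    Prod.exists, Fin.exists_fin_two]
  simp [hn, ← and_assoc, exists_and_right]

namespace IsModel

variable [mΩ : MeasurableSpace Ω] {μ : Measure Ω}

theorem successEvent_of_notMem (hS : S.IsModel p μ) {n : ℕ} (hn : n ∉ p.groupLp) (v : ℝ) :
    S.successEvent p v n = S.accessEvent p v n 0 := by
  ext ω
  have h1 : ∀ j, ¬ S.Serves p n (1, j) ω := by
    intro j h
    rcases h.1 with h | h
    · exact absurd h one_ne_zero
    · exact hn (by exact_mod_cast hS.cache_subset j ω h)
  simp [successEvent, accessEvent, Fin.exists_fin_two, hn, h1]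

variable [IsProbabilityMeasure μ]

theorem aedisjoint_sirEvent (hS : S.IsModel p μ) (n : ℕ) (δ δ' : ℝ) :
    AEDisjoint μ (sirEvent S p n 0 δ) (sirEvent S p n 1 δ') := by
  refine measure_mono_null ?_ (hS.field_isModel n).ae_T_ne
  rintro ω ⟨⟨j, h⟩, ⟨j', h'⟩⟩ hne
  exact hne j j' (le_antisymm (h.2.1 _ h'.1) (h'.2.1 _ h.1))

/-- Limiting success probability for a content of the second group. -/
theorem measureReal_iUnion_successEvent (hS : S.IsModel p μ) {n : ℕ} (hn : n ∈ p.groupLp) :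
    μ.real (⋃ v > 0, S.successEvent p v n)
      = μ.real (⋃ v > 0, S.accessEvent p v n 0 ∩ S.backhaulEvent p)
        + μ.real (⋃ v > 0, S.accessEvent p v n 1) := by
  have hU : ⋃ v > 0, S.successEvent p v n
      = (⋃ v > 0, S.accessEvent p v n 0 ∩ S.backhaulEvent p) ∪ ⋃ v > 0, S.accessEvent p v n 1 := by
    simp_rw [successEvent_of_mem hn, Set.iUnion_union_distrib]
  -- Measurability of the uncountable union over the noise is obtained up to null sets, from the
  -- countable union over loads.
  have hae : (⋃ v > 0, S.accessEvent p v n 1 : Set Ω) =ᵐ[μ]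
      (⋃ l : ℕ, {ω | S.L 1 ω = l + 1} ∩ sirEvent S p n 1 (p.δ l) : Set Ω) := by
    filter_upwards [hS.ae_T_pos] with ω hT
    refine propext ((mem_iUnion_accessEvent_iff hT n 1).trans ?_)
    exact (Set.mem_iUnion (s := fun l : ℕ => {ω | S.L 1 ω = l + 1} ∩
      sirEvent S p n 1 (p.δ l))).symm
  have hm : NullMeasurableSet (⋃ v > 0, S.accessEvent p v n 1) μ := by
    refine (MeasurableSet.iUnion fun l => ?_).nullMeasurableSet.congr hae.symm
    exact (hS.measurableSet_load_eq 1 (l + 1)).inter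
      (hS.sigma_le _ _ (measurableSet_sirEvent S p n 1 _))
  have hd : AEDisjoint μ (⋃ v > 0, S.accessEvent p v n 0 ∩ S.backhaulEvent p)
      (⋃ v > 0, S.accessEvent p v n 1) := by
    have h : ∀ᵐ ω ∂μ, ∀ l l', ω ∉ sirEvent S p n 0 (p.δ l) ∩ sirEvent S p n 1 (p.δ l') := by
      simp_rw [ae_all_iff]
      exact fun l l' => measure_eq_zero_iff_ae_notMem.1 (hS.aedisjoint_sirEvent n _ _)
    refine measure_eq_zero_iff_ae_notMem.2 ?_
    filter_upwards [hS.ae_T_pos, h] with ω hT h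
    rintro ⟨h0, h1⟩
    rw [← Set.iUnion₂_inter] at h0
    obtain ⟨l, -, hl⟩ := (mem_iUnion_accessEvent_iff hT n 0).1 h0.1
    obtain ⟨l', -, hl'⟩ := (mem_iUnion_accessEvent_iff hT n 1).1 h1
    exact h l l' ⟨hl, hl'⟩
  rw [hU, measureReal_def, measure_union₀ hm hd,
    ENNReal.toReal_add (measure_ne_top _ _) (measure_ne_top _ _)]
  rfl

theorem hasSum_accessEvent (hS : S.IsModel p μ) (n : ℕ) (k : Fin 2) :
    HasSum (fun l => μ.real (sirEvent S p n k (p.δ l)) * p.loadPMF k l)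
      (μ.real (⋃ v > 0, S.accessEvent p v n k)) := by
  have h := hS.hasSum_accessEvent_inter n k (Z := Set.univ)
    (@MeasurableSet.univ _ (S.sigma userSources))
  simp_rw [Set.inter_univ, hS.load_law] at h
  exact h

theorem hasSum_termMp (hS : S.IsModel p μ) {n : ℕ} (hn : n ∉ p.groupLp) :
    HasSum p.termMp (μ.real (⋃ v > 0, S.accessEvent p v n 0)) := by
  have h := hS.hasSum_accessEvent n 0
  simp_rw [hS.measureReal_sirEvent_of_notMem hn (p.δ_pos _).le] at h
  exact h

theorem hasSum_termLp (hS : S.IsModel p μ) {n : ℕ} (hn : n ∈ p.groupLp) (k : Fin 2) :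
    HasSum (p.termLp k) (μ.real (⋃ v > 0, S.accessEvent p v n k)) := by
  have h := hS.hasSum_accessEvent n k
  simp_rw [hS.measureReal_sirEvent_groupLp hn k (p.δ_pos _).le] at h
  exact h

/-- Access and backhaul depend on the same load and are independent only once it is fixed, so the
product is formed inside the sum. -/
theorem hasSum_termLp_mul_sbdp (hS : S.IsModel p μ) {n : ℕ} (hn : n ∈ p.groupLp) :
    HasSum (fun l => p.termLp 0 l * p.sbdp l)
      (μ.real (⋃ v > 0, S.accessEvent p v n 0 ∩ S.backhaulEvent p)) := by
  have h := hS.hasSum_accessEvent_inter n 0 (measurableSet_backhaulEvent S p)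
  simp_rw [hS.measureReal_sirEvent_groupLp hn 0 (p.δ_pos _).le, hS.measureReal_load_inter_backhaul,
    ← mul_assoc] at h
  exact h

theorem tendsto_accessEvent (S : Network Ω) (p : Params) (n : ℕ) (k : Fin 2) :
    Tendsto (fun v => μ.real (S.accessEvent p v n k)) (𝓝[>] 0)
      (𝓝 (μ.real (⋃ v > 0, S.accessEvent p v n k))) :=
  tendsto_measureReal_iUnion_pos fun _ _ hv hvv => accessEvent_anti hv hvv n k

theorem tendsto_accessEvent_of_notMem (hS : S.IsModel p μ) {n : ℕ} (hn : n ∉ p.groupLp) :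
    Tendsto (fun v => μ.real (S.accessEvent p v n 0)) (𝓝[>] 0) (𝓝 (∑' l, p.termMp l)) := by
  rw [(hS.hasSum_termMp hn).tsum_eq]
  exact tendsto_accessEvent S p n 0

theorem tendsto_accessEvent_groupLp (hS : S.IsModel p μ) {n : ℕ} (hn : n ∈ p.groupLp)
    (k : Fin 2) :
    Tendsto (fun v => μ.real (S.accessEvent p v n k)) (𝓝[>] 0) (𝓝 (∑' l, p.termLp k l)) := by
  rw [(hS.hasSum_termLp hn k).tsum_eq]
  exact tendsto_accessEvent S p n k

theorem tendsto_successEvent_groupLp (hS : S.IsModel p μ) {n : ℕ} (hn : n ∈ p.groupLp) :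
    Tendsto (fun v => μ.real (S.successEvent p v n)) (𝓝[>] 0)
      (𝓝 (∑' l, p.termLp 0 l * p.sbdp l + ∑' l, p.termLp 1 l)) := by
  rw [(hS.hasSum_termLp_mul_sbdp hn).tsum_eq, (hS.hasSum_termLp hn 1).tsum_eq,
    ← hS.measureReal_iUnion_successEvent hn]
  exact tendsto_measureReal_iUnion_pos fun _ _ hv hvv => successEvent_anti hv hvv n

end IsModel

end Network

namespace Params

theorem notMem_groupLp (p : Params) {n : ℕ} (hn : n ∈ p.groupMp) : n ∉ p.groupLp := by
  simp only [groupMp, groupLp, Finset.mem_Icc, Finset.mem_Ioc] at hn ⊢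
  omega

theorem sum_Icc_eq (p : Params) (f : ℕ → ℝ) :
    ∑ n ∈ Finset.Icc 1 p.N, f n = ∑ n ∈ p.groupMp, f n + ∑ n ∈ p.groupLp, f n := by
  have h : Finset.Icc 1 p.N = p.groupMp ∪ p.groupLp := by
    ext n
    have := p.N2_le
    simp only [groupMp, groupLp, Finset.mem_union, Finset.mem_Icc, Finset.mem_Ioc]
    omega
  rw [h, Finset.sum_union (Finset.disjoint_left.2 fun n hn => p.notMem_groupLp hn)]

end Params

theorem tendsto_sum_mul {s : Finset ℕ} {q : ℕ → ℝ} {f : ℕ → ℝ → ℝ} {l : Filter ℝ} {c : ℝ}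
    (h : ∀ n ∈ s, Tendsto (f n) l (𝓝 c)) :
    Tendsto (fun v => ∑ n ∈ s, q n * f n v) l (𝓝 ((∑ n ∈ s, q n) * c)) := by
  rw [Finset.sum_mul]
  exact tendsto_finsetSum _ fun n hn => (h n hn).const_mul _

end HetNet

theorem corollary1 {Ω : Type*} [MeasurableSpace Ω] (μ : Measure Ω) [IsProbabilityMeasure μ]
    (p : HetNet.Params) (S : HetNet.Network Ω) (hS : S.IsModel p μ) :
    -- the association probabilities entering the formulas are those of the network
    (∀ n ∈ p.groupMp, μ.real {ω | ∃ j, S.Serves p n (0, j) ω} = 1) ∧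
    (∀ n ∈ p.groupLp, ∀ k, μ.real {ω | ∃ j, S.Serves p n (k, j) ω} = p.ALp k) ∧
    -- all series converge
    Summable p.termMp ∧ (∀ k, Summable (p.termLp k)) ∧
    Summable (fun l => p.termLp 0 l * p.sbdp l) ∧
    Summable (fun l => p.loadPMF 0 l * p.sbdp l) ∧
    -- successful access delivery probabilities as the noise power tends to zero
    (∀ n ∈ p.groupMp, Tendsto (fun v => μ.real (S.accessEvent p v n 0)) (𝓝[>] 0)
      (𝓝 (∑' l, p.termMp l))) ∧
    (∀ n ∈ p.groupLp, ∀ k, Tendsto (fun v => μ.real (S.accessEvent p v n k)) (𝓝[>] 0)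
      (𝓝 (∑' l, p.termLp k l))) ∧
    -- successful backhaul delivery probability, given the load and on average
    (∀ l : ℕ, (cond μ {ω | S.L 0 ω = l + 1}).real (S.backhaulEvent p) = p.sbdp l) ∧
    μ.real (S.backhaulEvent p) = ∑' l, p.loadPMF 0 l * p.sbdp l ∧
    -- successful content delivery probability
    Tendsto (fun v => S.scdp p μ v) (𝓝[>] 0)
      (𝓝 (p.QMp * ∑' l, p.termMp l + p.QLp * ∑' l, p.termLp 1 l +
        p.QLp * ∑' l, p.termLp 0 l * p.sbdp l)) ∧
    -- the product form, with access and backhaul links treated as independent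
    Tendsto (fun v => S.scdpIndepLinks p μ v) (𝓝[>] 0)
      (𝓝 (p.QMp * ∑' l, p.termMp l + p.QLp * ∑' l, p.termLp 1 l +
        p.QLp * (∑' l, p.termLp 0 l) * ∑' l, p.loadPMF 0 l * p.sbdp l)) := by
  obtain ⟨n₀, hn₀⟩ := p.groupLp_nonempty
  -- The first group may be empty, so convergence of its series is read off from the fictitious
  -- content 0, which no helper caches.
  have h0 : 0 ∉ p.groupLp := by simp [HetNet.Params.groupLp]
  refine ⟨fun n hn => hS.measureReal_serves_of_notMem (p.notMem_groupLp hn),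
    fun n hn k => hS.measureReal_serves_groupLp hn k, (hS.hasSum_termMp h0).summable,
    fun k => (hS.hasSum_termLp hn₀ k).summable, (hS.hasSum_termLp_mul_sbdp hn₀).summable,
    hS.hasSum_backhaul.summable, fun n hn => hS.tendsto_accessEvent_of_notMem (p.notMem_groupLp hn),
    fun n hn k => hS.tendsto_accessEvent_groupLp hn k, hS.cond_real_backhaul,
    hS.hasSum_backhaul.tsum_eq.symm, ?_, ?_⟩
  · simp_rw [HetNet.Network.scdp, p.sum_Icc_eq]
    have hMp := HetNet.tendsto_sum_mul (s := p.groupMp) (q := p.q) (l := 𝓝[>] 0)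
      (f := fun n v => μ.real (S.successEvent p v n)) (c := ∑' l, p.termMp l) fun n hn => by
        simp_rw [hS.successEvent_of_notMem (p.notMem_groupLp hn)]
        exact hS.tendsto_accessEvent_of_notMem (p.notMem_groupLp hn)
    have hLp := HetNet.tendsto_sum_mul (s := p.groupLp) (q := p.q) (l := 𝓝[>] 0)
      fun n hn => hS.tendsto_successEvent_groupLp hn
    convert hMp.add hLp using 2
    rw [HetNet.Params.QMp, HetNet.Params.QLp]
    ring
  · have hMp := HetNet.tendsto_sum_mul (s := p.groupMp) (q := p.q) (l := 𝓝[>] 0)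
      fun n hn => hS.tendsto_accessEvent_of_notMem (p.notMem_groupLp hn)
    have hLp₁ := HetNet.tendsto_sum_mul (s := p.groupLp) (q := p.q) (l := 𝓝[>] 0)
      fun n hn => hS.tendsto_accessEvent_groupLp hn 1
    have hLp₀ := HetNet.tendsto_sum_mul (s := p.groupLp) (q := p.q) (l := 𝓝[>] 0)
      fun n hn => (hS.tendsto_accessEvent_groupLp hn 0).mul_const (μ.real (S.backhaulEvent p))
    rw [hS.hasSum_backhaul.tsum_eq, mul_assoc]
    exact (hMp.add hLp₁).add hLp₀
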